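/- **Model (conventional buffer system, CBS, with multiple vacations).** A source generates packets at the points of a Poisson process of rate $\lambda>0$ and sends them immediately to a single server with a one-packet buffer. The processing times are i.i.d. copies of a random variable $H\ge 0$, the vacation times are i.i.d. copies of a random variable $V\ge 0$ with $\mathbf P(V>0)>0$; generation process, processing times and vacation times are independent, and $\mathbf E[H],\mathbf E[V]<\infty$. At time $0$ the buffer is empty and the server starts a vacation. Whenever the server returns from a vacation and finds no packet in the buffer it takes another vacation; otherwise it processes the packet, and it goes on vacation again as soon as this packet is completed. The buffer is available only while the server is on vacation: packets arriving during processing are rejected, and a packet arriving during a vacation replaces the packet in the buffer, if any. Let $r_{\{l\}}$ and $C_{\{l\}}$ be the generation time and the completion time of the $l$-th packet that is served ($l=0,1,2,\dots$), let $\Delta(t)=t-\max\{r_{\{l\}}:C_{\{l\}}\le t\}$ be the age at time $t$ (before the first completion, $\Delta(t)=t+a$ with a given initial age $a\ge 0$), and let $A_{\{l\}}=\Delta(C_{\{l\}}-)$ be the $l$-th peak of the age. Let $X^{*}(s)=\mathbf E[e^{-sX}]$, $s\ge 0$, be the Laplace–Stieltjes transform of $X$ and $X^{*(n)}$ its $n$-th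 derivative (one-sided at $s=0$). **Theorem.** (i) *PAoI.* The peaks $A_{\{l\}}$ are integrable and converge in distribution to a random variable $A$ with finite mean, and $\lim_{l\to\infty}\mathbf E[A_{\{l\}}]=\mathbf E[A]$, $\lim_{k\to\infty}\frac1k\sum_{l<k}A_{\{l\}}=\mathbf E[A]$ almost surely, where $$\mathbf E[A]=\frac1\lambda+\frac{V^{*(1)}(\lambda)-V^{*(1)}(0)}{1-V^{*}(\lambda)}-2H^{*(1)}(0).$$ Suppose in addition that $\mathbf E[H^2]<\infty$ and $\mathbf E[V^2]<\infty$. (ii) *Variance of peak age.* The $A_{\{l\}}$ and $A$ are square integrable, and $\lim_{l\to\infty}\mathrm{Var}(A_{\{l\}})=\mathrm{Var}(A)$ with $$\mathrm{Var}(A)=\frac{V^{*(2)}(0)-V^{*(2)}(\lambda)}{1-V^{*}(\lambda)}-\left(\frac{V^{*(1)}(\lambda)-V^{*(1)}(0)}{1-V^{*}(\lambda)}\right)^{2}+\frac1{\lambda^{2}}+2H^{*(2)}(0)-2\left(H^{*(1)}(0)\right)^{2}.$$ (iii) *AoI.* Let $$\mathbf E[\Delta]=-\frac{1}{2\left(H^{*(1)}(0)+\frac{V^{*(1)}(0)}{1-V^{*}(\lambda)}\right)}\left[H^{*(2)}(0)+2H^{*(1)}(0)\frac{V^{*(1)}(0)}{1-V^{*}(\lambda)}+\frac{2V^{*(1)}(0)V^{*(1)}(\lambda)}{(1-V^{*}(\lambda))^{2}}+\frac{V^{*(2)}(0)}{1-V^{*}(\lambda)}\right]+\frac1\lambda+\frac{V^{*(1)}(\lambda)}{1-V^{*}(\lambda)}-H^{*(1)}(0).$$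 Almost surely, $\Delta$ is integrable on bounded intervals and $\lim_{T\to\infty}\frac1T\int_0^T\Delta(t)\,dt=\mathbf E[\Delta]$. Moreover $\Delta(t)$ is integrable for every $t\ge0$, $\lim_{T\to\infty}\frac1T\int_0^T\mathbf E[\Delta(t)]\,dt=\mathbf E[\Delta]$, and $\lim_{t\to\infty}\mathbf E[\Delta(t)]=\mathbf E[\Delta]$ whenever this limit exists. -/

import Mathlib

open MeasureTheory ProbabilityTheory Filter Topology

noncomputable section

/-! ### Laplace--Stieltjes transforms -/

/-- The Laplace--Stieltjes transform `X*(s) = E[exp(-s X)]` of a law `μ` on the real line. -/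
def lst (μ : Measure ℝ) (s : ℝ) : ℝ := ∫ x, Real.exp (-s * x) ∂μ

/-- The `n`-th derivative `X*⁽ⁿ⁾(s)` of the transform, as a function on its domain `[0, ∞)`.
At `s > 0` it is the ordinary derivative; at `s = 0` it is the one-sided (right) derivative, because
the transform of a law on `[0, ∞)` may be infinite at every `s < 0`. -/
def lstDeriv (n : ℕ) (μ : Measure ℝ) (s : ℝ) : ℝ :=
  iteratedDerivWithin n (lst μ) (Set.Ici 0) s

/-! ### Sample paths of the conventional buffer system -/

/-- The input of the system along one sample path: the times between successive packet
generations, the processing times of the successively served packets, and the lengths of the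
successive vacations. -/
structure CBSPath where
  interarrival : ℕ → ℝ
  service : ℕ → ℝ
  vacation : ℕ → ℝ

namespace CBSPath

variable (p : CBSPath)

/-- Generation time (= arrival time at the server) of the `n`-th packet, `n = 0, 1, 2, …`. -/
def arrival (n : ℕ) : ℝ := ∑ i ∈ Finset.range (n + 1), p.interarrival i

/-- The end of the `j`-th vacation in an uninterrupted string of vacations that starts at time `c`
and uses the vacations with indices `k, k + 1, …`. -/
def vacationEnd (c : ℝ) (k j : ℕ) : ℝ := c + ∑ i ∈ Finset.range j, p.vacation (k + i)

/-- The number of vacations the server takes in a string that starts at time `c`, with an empty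
buffer, using the vacations `k, k + 1, …`: it takes another vacation until, upon returning from
one, it finds that a packet has arrived since `c`. -/
def numVacations (c : ℝ) (k : ℕ) : ℕ :=
  sInf {j | ∃ n, p.arrival n ∈ Set.Ioc c (p.vacationEnd c k j)}

/-- The pair consisting of the time at which the server goes on vacation before serving the
`l`-th served packet (`l = 0, 1, 2, …`) and of the number of vacations taken up to that time.
At time `0` the buffer is empty and the server goes on vacation; after that it goes on vacation
whenever it completes a packet. -/
def leave : ℕ → ℝ × ℕ
  | 0 => (0, 0)
  | l + 1 =>
    let c := (leave l).1
    let k := (leave l).2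
    let m := p.numVacations c k
    (p.vacationEnd c k m + p.service l, k + m)

/-- The time `S_l` at which the server returns from vacation, finds a packet and starts
processing the `l`-th served packet. -/
def serviceStart (l : ℕ) : ℝ :=
  p.vacationEnd (p.leave l).1 (p.leave l).2 (p.numVacations (p.leave l).1 (p.leave l).2)

/-- The time `C_l = S_l + H_l` at which the `l`-th served packet is completed. -/
def completion (l : ℕ) : ℝ := p.serviceStart l + p.service l

/-- The generation time `r_l` of the `l`-th served packet. The buffer is available exactly while
the server is on vacation (packets arriving during processing are rejected), and a newly arriving
packet replaces the one in the buffer; so the packet found at `S_l` is the latest one among those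
that arrived since the server went on vacation. (The supremum is almost surely the maximum of a
nonempty finite set.) -/
def generation (l : ℕ) : ℝ :=
  sSup {x | x ∈ Set.range p.arrival ∧ x ∈ Set.Ioc (p.leave l).1 (p.serviceStart l)}

/-- The age `Δ(t) = t - max {r_l : C_l ≤ t}`. The receiver holds at time `0` an update of age
`a`, i.e. one generated at time `-a`, and this is what counts until the first completion. -/
def age (a t : ℝ) : ℝ :=
  t - sSup (insert (-a) {x | ∃ l, p.completion l ≤ t ∧ x = p.generation l})

/-- The `l`-th peak `A_l` of the age process: the value that the age has reached immediately
before it drops at the completion time `C_l`. -/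
def peakAge (a : ℝ) (l : ℕ) : ℝ := Function.leftLim (p.age a) (p.completion l)

end CBSPath

/-- The random sample path built from random inter-generation times `T`, processing times `H` and
vacation times `V`. -/
def cbsPath {Ω : Type*} (T H V : ℕ → Ω → ℝ) (ω : Ω) : CBSPath where
  interarrival n := T n ω
  service n := H n ω
  vacation n := V n ω

/-! ### The three closed forms

Here `lam` is the generation rate and `μH`, `μV` are the laws of a processing time `H` and of a
vacation time `V`. -/

/-- Closed form for the AoI. -/
def cbsAoI (lam : ℝ) (μH μV : Measure ℝ) : ℝ :=
  -(1 / (2 * (lstDeriv 1 μH 0 + lstDeriv 1 μV 0 / (1 - lst μV lam)))) *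
      (lstDeriv 2 μH 0
        + 2 * lstDeriv 1 μH 0 * (lstDeriv 1 μV 0 / (1 - lst μV lam))
        + 2 * lstDeriv 1 μV 0 * lstDeriv 1 μV lam / (1 - lst μV lam) ^ 2
        + lstDeriv 2 μV 0 / (1 - lst μV lam))
    + 1 / lam + lstDeriv 1 μV lam / (1 - lst μV lam) - lstDeriv 1 μH 0

/-- Closed form for the PAoI. -/
def cbsPAoI (lam : ℝ) (μH μV : Measure ℝ) : ℝ :=
  1 / lam + (lstDeriv 1 μV lam - lstDeriv 1 μV 0) / (1 - lst μV lam) - 2 * lstDeriv 1 μH 0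

/-- Closed form for the variance of peak age. -/
def cbsVarPeak (lam : ℝ) (μH μV : Measure ℝ) : ℝ :=
  (lstDeriv 2 μV 0 - lstDeriv 2 μV lam) / (1 - lst μV lam)
    - ((lstDeriv 1 μV lam - lstDeriv 1 μV 0) / (1 - lst μV lam)) ^ 2
    + 1 / lam ^ 2 + 2 * lstDeriv 2 μH 0 - 2 * (lstDeriv 1 μH 0) ^ 2

end

noncomputable section

namespace ConventionalBuffer

/-! ### Derivatives of the Laplace--Stieltjes transform -/

/-! The system regenerates whenever a packet is completed and the server goes on vacation with an
empty buffer. Cut time at the completions. A cycle consists of a string of vacations of total length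
X, at whose end the freshest packet has age W, followed by a processing time H. It has length Y = X
+ H and leaves the age G = W + H behind. Poisson arrivals are memoryless, so what follows a cycle is
independent of it and has the original law (`lintegral_cycle_mul`). Hence the pairs (Y, G) are
i.i.d. over the cycles (`map_cycles`, `isRenewalCycle`).

Between completions the age grows with slope 1. The peak that ends cycle l ≥ 1 is therefore G_{l-1}
+ Y_l, a sum of two independent terms, and the integral of the age over this cycle is G_{l-1} Y_l +
Y_l²/2. Consequently E[A] = E[G] + E[Y], Var(A) = Var(G) + Var(Y), and the renewal reward theorem
gives E[Δ] = (E[G] E[Y] + E[Y²]/2) / E[Y]. The joint law of Y and G within one cycle never matters.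

The moments of X and W come from conditioning on the first vacation: a vacation of length v is
without arrival with probability e^{-λv}, and then the string starts afresh. With q = V*(λ) this
yields E[X] = E[V] + q E[X], E[X²] = E[V²] + 2 E[V e^{-λV}] E[X] + q E[X²], and E[φ(W)] = E[∫_0^V
φ(t) λ e^{-λt} dt] + q E[φ(W)]. The last equation uses that the time since the last arrival before d
is distributed as min(T, d) with T exponential (`map_sub_lastEpoch`). See `integral_vacLength`,
`integral_vacWait` and their second-moment versions.

Almost sure averages follow from the strong law; rewards of neighbouring cycles are dependent, so
even and odd indices are treated separately (`ae_tendsto_reward`). For the time average of the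
expected age (`tendsto_integral_average_age`), the lower bound is bounded convergence after
truncation, and the upper bound rests on a Chernoff estimate for the number of completions by time
t. If E[Δ(t)] converges at all, its limit must be this average. -/

lemma ae_nonneg_of_measure_Iio_eq_zero {μ : Measure ℝ} (h : μ (Set.Iio 0) = 0) :
    ∀ᵐ x ∂μ, 0 ≤ x := by
  rw [ae_iff]
  convert h using 2
  ext x
  simp

lemma abs_exp_neg_sub_exp_neg_le {a b : ℝ} (ha : 0 ≤ a) (hb : 0 ≤ b) :
    |Real.exp (-a) - Real.exp (-b)| ≤ |a - b| := by
  wlog h : a ≤ b generalizing a b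
  · rw [abs_sub_comm, abs_sub_comm a b]
    exact this hb ha (le_of_not_ge h)
  have h1 : Real.exp (-b) ≤ Real.exp (-a) := Real.exp_le_exp.2 (by linarith)
  rw [abs_of_nonneg (by linarith), abs_of_nonpos (by linarith)]
  have h2 : Real.exp (-b) = Real.exp (-a) * Real.exp (a - b) := by
    rw [← Real.exp_add]; ring_nf
  have h3 := Real.add_one_le_exp (a - b)
  have h4 : Real.exp (-a) ≤ 1 := Real.exp_le_one_iff.2 (by linarith)
  have h5 : 0 < Real.exp (-a) := Real.exp_pos _
  rw [h2]
  nlinarith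

lemma integrable_pow_mul_exp {μ : Measure ℝ} (h0 : μ (Set.Iio 0) = 0) {k : ℕ}
    (hk : Integrable (fun x : ℝ => x ^ k) μ) {s : ℝ} (hs : 0 ≤ s) :
    Integrable (fun x : ℝ => x ^ k * Real.exp (-s * x)) μ := by
  refine hk.mono (hk.aestronglyMeasurable.mul (by fun_prop)) ?_
  filter_upwards [ae_nonneg_of_measure_Iio_eq_zero h0] with x hx
  rw [norm_mul, Real.norm_of_nonneg (Real.exp_pos _).le]
  exact mul_le_of_le_one_right (norm_nonneg _) (Real.exp_le_one_iff.2 (by nlinarith))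

/-- Differentiation under the integral. On [0, ∞) the exponential e^{-u} is 1-Lipschitz, so the
difference quotients are dominated by |x^(k+1)| for all parameters s, t ≥ 0. The domination does not
degenerate as s → 0, which is why the one-sided derivative at 0 is covered as well. -/
lemma hasDerivWithinAt_integral_pow_mul_exp {μ : Measure ℝ} (h0 : μ (Set.Iio 0) = 0) {k : ℕ}
    (hk : Integrable (fun x : ℝ => x ^ k) μ) (hk1 : Integrable (fun x : ℝ => x ^ (k + 1)) μ)
    {s : ℝ} (hs : 0 ≤ s) :
    HasDerivWithinAt (fun s => ∫ x, x ^ k * Real.exp (-s * x) ∂μ)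
      (-∫ x, x ^ (k + 1) * Real.exp (-s * x) ∂μ) (Set.Ici 0) s := by
  rw [hasDerivWithinAt_iff_tendsto_slope, ← integral_neg]
  have key : Tendsto (fun t => ∫ x, x ^ k * slope (fun u => Real.exp (-u * x)) s t ∂μ)
      (𝓝[Set.Ici 0 \ {s}] s) (𝓝 (∫ x, -(x ^ (k + 1) * Real.exp (-s * x)) ∂μ)) := by
    refine tendsto_integral_filter_of_dominated_convergence (fun x => ‖x ^ (k + 1)‖) ?_ ?_
      hk1.norm ?_
    · refine Eventually.of_forall fun t => ?_
      simp only [slope_def_field]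
      exact hk.aestronglyMeasurable.mul (by fun_prop)
    · filter_upwards [self_mem_nhdsWithin] with t ht
      filter_upwards [ae_nonneg_of_measure_Iio_eq_zero h0] with x hx
      have hts : 0 < |t - s| := abs_pos.2 (sub_ne_zero.2 ht.2)
      have h1 := abs_exp_neg_sub_exp_neg_le (mul_nonneg (Set.mem_Ici.1 ht.1) hx) (mul_nonneg hs hx)
      rw [← sub_mul, abs_mul, abs_of_nonneg hx] at h1
      rw [pow_succ, norm_mul, norm_mul, slope_def_field, Real.norm_eq_abs (_ / _), abs_div,
        Real.norm_of_nonneg hx]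
      gcongr
      rw [div_le_iff₀ hts, neg_mul, neg_mul, mul_comm x]
      exact h1
    · refine Eventually.of_forall fun x => ?_
      have h1 : HasDerivAt (fun u => Real.exp (-u * x)) (Real.exp (-s * x) * (-1 * x)) s :=
        ((hasDerivAt_id s).neg.mul_const x).exp
      have h2 := (hasDerivAt_iff_tendsto_slope.1 h1).mono_left
        (nhdsWithin_mono s (fun t (ht : t ∈ Set.Ici 0 \ {s}) => ht.2))
      convert! h2.const_mul (x ^ k) using 2
      ring
  refine key.congr' ?_
  filter_upwards [self_mem_nhdsWithin] with t ht
  rw [slope_def_field, ← integral_sub (integrable_pow_mul_exp h0 hk ht.1)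
    (integrable_pow_mul_exp h0 hk hs), ← integral_div]
  refine integral_congr_ae (Eventually.of_forall fun x => ?_)
  simp only [slope_def_field]
  ring

lemma lstDeriv_one {μ : Measure ℝ} [IsProbabilityMeasure μ] (h0 : μ (Set.Iio 0) = 0)
    (h1 : Integrable (fun x : ℝ => x) μ) {s : ℝ} (hs : 0 ≤ s) :
    lstDeriv 1 μ s = -∫ x, x * Real.exp (-s * x) ∂μ := by
  rw [lstDeriv, iteratedDerivWithin_one]
  have := hasDerivWithinAt_integral_pow_mul_exp h0 (k := 0) (by simp) (by simpa using h1) hs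
  simp only [pow_zero, one_mul, zero_add, pow_one] at this
  exact this.derivWithin (uniqueDiffOn_Ici 0 s hs)

lemma lstDeriv_two {μ : Measure ℝ} [IsProbabilityMeasure μ] (h0 : μ (Set.Iio 0) = 0)
    (h1 : Integrable (fun x : ℝ => x) μ) (h2 : Integrable (fun x : ℝ => x ^ 2) μ)
    {s : ℝ} (hs : 0 ≤ s) :
    lstDeriv 2 μ s = ∫ x, x ^ 2 * Real.exp (-s * x) ∂μ := by
  rw [lstDeriv, iteratedDerivWithin_succ]
  have h := (hasDerivWithinAt_integral_pow_mul_exp h0 (k := 1) (by simpa using h1)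
    (by simpa using h2) hs).neg
  simp only [pow_one, Nat.reduceAdd, neg_neg] at h
  have h' : HasDerivWithinAt (iteratedDerivWithin 1 (lst μ) (Set.Ici 0))
      (∫ x, x ^ 2 * Real.exp (-s * x) ∂μ) (Set.Ici 0) s :=
    h.congr (fun t ht => lstDeriv_one h0 h1 ht) (lstDeriv_one h0 h1 hs)
  exact h'.derivWithin (uniqueDiffOn_Ici 0 s hs)

lemma lst_lt_one {μ : Measure ℝ} [IsProbabilityMeasure μ] (h0 : μ (Set.Iio 0) = 0)
    (hpos : μ (Set.Ioi 0) ≠ 0) {s : ℝ} (hs : 0 < s) : lst μ s < 1 := by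
  have hi : Integrable (fun x : ℝ => Real.exp (-s * x)) μ := by
    simpa using integrable_pow_mul_exp h0 (k := 0) (by simp) hs.le
  have hnn : ∀ᵐ x ∂μ, 0 ≤ 1 - Real.exp (-s * x) := by
    filter_upwards [ae_nonneg_of_measure_Iio_eq_zero h0] with x hx
    have : Real.exp (-s * x) ≤ 1 := Real.exp_le_one_iff.2 (by nlinarith)
    linarith
  have h : 0 < ∫ x, (1 - Real.exp (-s * x)) ∂μ := by
    rw [integral_pos_iff_support_of_nonneg_ae hnn (by fun_prop)]
    refine lt_of_lt_of_le (pos_iff_ne_zero.2 hpos) (measure_mono fun x (hx : 0 < x) => ?_)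
    have : Real.exp (-s * x) < 1 := Real.exp_lt_one_iff.2 (by nlinarith)
    exact (sub_pos.2 this).ne'
  rw [integral_sub (by simp) hi] at h
  simp only [integral_const, probReal_univ, smul_eq_mul, mul_one] at h
  exact sub_pos.1 h

lemma lst_nonneg (μ : Measure ℝ) (s : ℝ) : 0 ≤ lst μ s :=
  integral_nonneg fun _ => (Real.exp_pos _).le

end ConventionalBuffer

end

noncomputable section

namespace ConventionalBuffer

open scoped ENNReal

/-! ### Sequences, their partial sums, and splitting off the first term -/

/-- The sum of the first `n` terms of a sequence. -/
def psum (x : ℕ → ℝ) (n : ℕ) : ℝ := ∑ i ∈ Finset.range n, x i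

/-- The sequence without its first term. -/
def seqTail {α : Type*} (x : ℕ → α) : ℕ → α := fun i => x (i + 1)

@[simp] lemma psum_zero (x : ℕ → ℝ) : psum x 0 = 0 := by simp [psum]

lemma psum_succ (x : ℕ → ℝ) (n : ℕ) : psum x (n + 1) = psum x n + x n :=
  Finset.sum_range_succ x n

lemma psum_succ' (x : ℕ → ℝ) (n : ℕ) : psum x (n + 1) = x 0 + psum (seqTail x) n := by
  rw [psum, Finset.sum_range_succ', add_comm]; rfl

lemma psum_add (x : ℕ → ℝ) (m n : ℕ) : psum x (m + n) = psum x m + psum (fun i => x (m + i)) n :=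
  Finset.sum_range_add x m n

@[fun_prop]
lemma measurable_psum (n : ℕ) : Measurable fun x : ℕ → ℝ => psum x n :=
  Finset.measurable_sum _ fun i _ => measurable_pi_apply i

@[fun_prop]
lemma measurable_seqTail {α : Type*} [MeasurableSpace α] :
    Measurable (seqTail : (ℕ → α) → ℕ → α) :=
  measurable_pi_iff.2 fun i => measurable_pi_apply (i + 1)

lemma psum_mono {x : ℕ → ℝ} (hx : ∀ i, 0 ≤ x i) : Monotone (psum x) :=
  monotone_nat_of_le_succ fun n => by rw [psum_succ]; linarith [hx n]

lemma psum_strictMono {x : ℕ → ℝ} (hx : ∀ i, 0 < x i) : StrictMono (psum x) :=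
  strictMono_nat_of_lt_succ fun n => by rw [psum_succ]; linarith [hx n]

lemma psum_nonneg {x : ℕ → ℝ} (hx : ∀ i, 0 ≤ x i) (n : ℕ) : 0 ≤ psum x n :=
  Finset.sum_nonneg fun i _ => hx i

/-- The law of an i.i.d. sequence. -/
abbrev iidSeq {α : Type*} [MeasurableSpace α] (μ : Measure α) [IsProbabilityMeasure μ] :
    Measure (ℕ → α) :=
  Measure.infinitePi fun _ : ℕ => μ

section HeadTail

variable {α : Type*} [MeasurableSpace α] (μ : Measure α) [IsProbabilityMeasure μ]

/-- Put a term in front of a sequence. -/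
def seqCons (z : α × (ℕ → α)) : ℕ → α := fun i => Nat.casesOn i z.1 z.2

@[simp] lemma seqCons_zero {α : Type*} (z : α × (ℕ → α)) : seqCons z 0 = z.1 := rfl

@[simp] lemma seqCons_succ {α : Type*} (z : α × (ℕ → α)) (i : ℕ) : seqCons z (i + 1) = z.2 i := rfl

lemma measurable_seqCons : Measurable (seqCons : α × (ℕ → α) → ℕ → α) := by
  refine measurable_pi_iff.2 fun i => ?_
  cases i with
  | zero => exact measurable_fst
  | succ i => exact (measurable_pi_apply i).comp measurable_snd

/-- A law of sequences is that of an i.i.d. sequence if it is so on finite initial segments. -/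
lemma eq_iidSeq {ν : Measure (ℕ → α)}
    (hν : ∀ (N : ℕ) (t : ℕ → Set α), (∀ i, MeasurableSet (t i)) →
      ν {x | ∀ i < N, x i ∈ t i} = ∏ i ∈ Finset.range N, μ (t i)) : ν = iidSeq μ := by
  refine Measure.eq_infinitePi _ fun s t ht => ?_
  classical
  obtain ⟨N, hN⟩ : ∃ N, ∀ i ∈ s, i < N :=
    ⟨s.sup id + 1, fun i hi => Nat.lt_succ_of_le (Finset.le_sup (f := id) hi)⟩
  have h := hν N (fun i => if i ∈ s then t i else Set.univ) fun i => by
    by_cases h : i ∈ s <;> simp [h, ht]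
  have hset : {x : ℕ → α | ∀ i < N, x i ∈ if i ∈ s then t i else Set.univ} = Set.pi s t := by
    ext x
    simp only [Set.mem_ofPred_eq, Set.mem_pi, Finset.mem_coe]
    constructor
    · intro hx i hi
      simpa [hi] using hx i (hN i hi)
    · intro hx i _
      by_cases hi : i ∈ s
      · simpa [hi] using hx i hi
      · simp [hi]
  rw [← hset, h, ← Finset.prod_subset (fun i hi => Finset.mem_range.2 (hN i hi))]
  · exact Finset.prod_congr rfl fun i hi => by simp [hi]
  · intro i _ hi
    simp [hi]

lemma map_seqCons : (μ.prod (iidSeq μ)).map seqCons = iidSeq μ := by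
  refine eq_iidSeq μ fun N t ht => ?_
  have hm : MeasurableSet {x : ℕ → α | ∀ i < N, x i ∈ t i} := by
    have : {x : ℕ → α | ∀ i < N, x i ∈ t i} = Set.pi (Finset.range N) t := by
      ext x; simp [Set.mem_pi]
    rw [this]
    exact MeasurableSet.pi (Finset.range N).countable_toSet fun i _ => ht i
  rw [Measure.map_apply measurable_seqCons hm]
  rcases N with _ | N
  · simp
  · have hset : (seqCons ⁻¹' {x : ℕ → α | ∀ i < N + 1, x i ∈ t i})
        = t 0 ×ˢ Set.pi (Finset.range N) fun i => t (i + 1) := by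
      ext z
      simp only [Set.mem_preimage, Set.mem_pi, Finset.mem_coe, Set.mem_prod, Finset.mem_range,
        Set.mem_ofPred_eq]
      constructor
      · exact fun h => ⟨h 0 N.succ_pos, fun i hi => h (i + 1) (Nat.succ_lt_succ hi)⟩
      · rintro ⟨h0, h1⟩ i hi
        cases i with
        | zero => exact h0
        | succ i => exact h1 i (Nat.lt_of_succ_lt_succ hi)
    rw [hset, Measure.prod_prod, Measure.infinitePi_pi _ (fun i _ => ht _), mul_comm,
      ← Finset.prod_range_succ' fun i => μ (t i)]

lemma map_head_tail : (iidSeq μ).map (fun x => (x 0, seqTail x)) = μ.prod (iidSeq μ) := by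
  conv_lhs => rw [← map_seqCons μ]
  rw [Measure.map_map (by fun_prop) measurable_seqCons]
  exact Measure.map_id

/-- Conditioning on the first term of an i.i.d. sequence. Every recursion below starts from this. -/
lemma lintegral_head_tail {F : α × (ℕ → α) → ℝ≥0∞} (hF : Measurable F) :
    ∫⁻ x, F (x 0, seqTail x) ∂(iidSeq μ) = ∫⁻ t, ∫⁻ x, F (t, x) ∂(iidSeq μ) ∂μ := by
  rw [← lintegral_prod _ hF.aemeasurable, ← map_head_tail, lintegral_map hF (by fun_prop)]

lemma map_head : (iidSeq μ).map (fun x => x 0) = μ :=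
  Measure.infinitePi_map_eval (fun _ : ℕ => μ) 0

end HeadTail

/-- Partial sums of i.i.d. nonnegative terms, not almost surely zero, are unbounded. -/
lemma ae_psum_unbounded (μ : Measure ℝ) [IsProbabilityMeasure μ] (h0 : μ (Set.Iio 0) = 0)
    (hpos : μ (Set.Ioi 0) ≠ 0) : ∀ᵐ x ∂(iidSeq μ), ∀ y, ∃ n, y < psum x n := by
  -- No mean is assumed here. Truncation at 1 makes the strong law applicable, keeps the mean
  -- positive, and only decreases the partial sums.
  have hmeas : Measurable fun t : ℝ => min t 1 := by fun_prop
  have hbd : ∀ᵐ t ∂μ, ‖min t 1‖ ≤ 1 := by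
    filter_upwards [ae_nonneg_of_measure_Iio_eq_zero h0] with t ht
    rw [Real.norm_of_nonneg (le_min ht zero_le_one)]
    exact min_le_right _ _
  have hint : Integrable (fun t : ℝ => min t 1) μ :=
    Integrable.of_bound hmeas.aestronglyMeasurable 1 hbd
  have hm : 0 < ∫ t, min t 1 ∂μ := by
    rw [integral_pos_iff_support_of_nonneg_ae _ hint]
    · refine lt_of_lt_of_le (pos_iff_ne_zero.2 hpos) (measure_mono fun t (ht : 0 < t) => ?_)
      exact (lt_min ht one_pos).ne'
    · filter_upwards [ae_nonneg_of_measure_Iio_eq_zero h0] with t ht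
      exact le_min ht zero_le_one
  have hmp : ∀ i : ℕ, MeasurePreserving (fun x : ℕ → ℝ => x i) (iidSeq μ) μ := fun i =>
    measurePreserving_eval_infinitePi (fun _ : ℕ => μ) i
  have hind : iIndepFun (fun (i : ℕ) (x : ℕ → ℝ) => min (x i) 1) (iidSeq μ) :=
    iIndepFun_infinitePi (P := fun _ : ℕ => μ) (X := fun _ t => min t 1) (fun _ => hmeas)
  have hsl := strong_law_ae_real (μ := iidSeq μ) (fun (i : ℕ) (x : ℕ → ℝ) => min (x i) 1)
    ((hmp 0).integrable_comp_of_integrable hint) (fun i j hij => hind.indepFun hij)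
    (fun i => ⟨(hmeas.comp (measurable_pi_apply i)).aemeasurable,
      (hmeas.comp (measurable_pi_apply 0)).aemeasurable, by
        change Measure.map ((fun t : ℝ => min t 1) ∘ fun x : ℕ → ℝ => x i) _ =
          Measure.map ((fun t : ℝ => min t 1) ∘ fun x : ℕ → ℝ => x 0) _
        rw [← Measure.map_map hmeas (measurable_pi_apply i),
          ← Measure.map_map hmeas (measurable_pi_apply 0), (hmp i).map_eq, (hmp 0).map_eq]⟩)
  filter_upwards [hsl] with x hx y
  have hlim : ∫ z : ℕ → ℝ, min (z 0) 1 ∂(iidSeq μ) = ∫ t, min t 1 ∂μ := by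
    conv_rhs => rw [← (hmp 0).map_eq]
    rw [integral_map (measurable_pi_apply 0).aemeasurable hmeas.aestronglyMeasurable]
  rw [hlim] at hx
  have h1 := (tendsto_natCast_atTop_atTop (R := ℝ)).atTop_mul_pos hm hx
  obtain ⟨n, hn, hn0⟩ := ((h1.eventually_gt_atTop y).and (eventually_gt_atTop 0)).exists
  refine ⟨n, hn.trans_le ?_⟩
  have hn' : (n : ℝ) ≠ 0 := by positivity
  rw [mul_div_cancel₀ _ hn']
  exact Finset.sum_le_sum fun i _ => min_le_left _ _

/-! ### The exponential law -/

lemma expMeasure_Iic {lam : ℝ} (hlam : 0 < lam) {s : ℝ} (hs : 0 ≤ s) :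
    expMeasure lam (Set.Iic s) = ENNReal.ofReal (1 - Real.exp (-(lam * s))) := by
  have := isProbabilityMeasure_expMeasure hlam
  rw [← ofReal_cdf, cdf_expMeasure_eq hlam, if_pos hs]

lemma expMeasure_Ioi {lam : ℝ} (hlam : 0 < lam) {s : ℝ} (hs : 0 ≤ s) :
    expMeasure lam (Set.Ioi s) = ENNReal.ofReal (Real.exp (-(lam * s))) := by
  have := isProbabilityMeasure_expMeasure hlam
  have h1 : Real.exp (-(lam * s)) ≤ 1 := Real.exp_le_one_iff.2 (by nlinarith)
  rw [← Set.compl_Iic, prob_compl_eq_one_sub measurableSet_Iic, expMeasure_Iic hlam hs,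
    ← ENNReal.ofReal_one, ← ENNReal.ofReal_sub _ (by linarith)]
  congr 1
  ring

instance (lam : ℝ) : NullSingletonClass (expMeasure lam) := by
  unfold expMeasure gammaMeasure
  infer_instance

lemma expMeasure_Ici {lam : ℝ} (hlam : 0 < lam) {s : ℝ} (hs : 0 ≤ s) :
    expMeasure lam (Set.Ici s) = ENNReal.ofReal (Real.exp (-(lam * s))) := by
  rw [← expMeasure_Ioi hlam hs]
  exact (measure_congr Ioi_ae_eq_Ici).symm

lemma expMeasure_Iic_zero {lam : ℝ} (hlam : 0 < lam) : expMeasure lam (Set.Iic 0) = 0 := by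
  simp [expMeasure_Iic hlam le_rfl]

lemma expMeasure_ae_pos {lam : ℝ} (hlam : 0 < lam) : ∀ᵐ t ∂(expMeasure lam), 0 < t := by
  rw [ae_iff]
  convert expMeasure_Iic_zero hlam using 2
  ext x
  simp

/-- Absence of memory of the exponential law. -/
lemma map_sub_restrict_expMeasure {lam : ℝ} (hlam : 0 < lam) {s : ℝ} (hs : 0 ≤ s) :
    ((expMeasure lam).restrict (Set.Ioi s)).map (fun t => t - s)
      = ENNReal.ofReal (Real.exp (-(lam * s))) • expMeasure lam := by
  have := isProbabilityMeasure_expMeasure hlam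
  refine Measure.ext_of_Ici _ _ fun a => ?_
  have hm : Measurable fun t : ℝ => t - s := by fun_prop
  have hmp : 0 ≤ Real.exp (-(lam * s)) := (Real.exp_pos _).le
  have hpre : (fun t : ℝ => t - s) ⁻¹' Set.Ici a = Set.Ici (a + s) := by
    ext t; simp only [Set.mem_preimage, Set.mem_Ici]; constructor <;> intro h <;> linarith
  rw [Measure.map_apply hm measurableSet_Ici, hpre, Measure.restrict_apply measurableSet_Ici,
    Measure.smul_apply, smul_eq_mul]
  rcases le_or_gt a 0 with ha | ha
  · have h1 : Set.Ici (a + s) ∩ Set.Ioi s = Set.Ioi s :=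
      Set.inter_eq_right.2 fun t (ht : s < t) => Set.mem_Ici.2 (by linarith)
    have h2 : expMeasure lam (Set.Ici a) = 1 := by
      refine le_antisymm prob_le_one ?_
      rw [← ENNReal.ofReal_one, ← Real.exp_zero]
      have := expMeasure_Ici hlam (le_refl (0 : ℝ))
      simp only [mul_zero, neg_zero] at this
      rw [← this]
      exact measure_mono (Set.Ici_subset_Ici.2 ha)
    rw [h1, expMeasure_Ioi hlam hs, h2, mul_one]
  · have h1 : Set.Ici (a + s) ∩ Set.Ioi s = Set.Ici (a + s) :=
      Set.inter_eq_left.2 fun t (ht : a + s ≤ t) => Set.mem_Ioi.2 (by linarith)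
    rw [h1, expMeasure_Ici hlam (by linarith), expMeasure_Ici hlam ha.le, ← ENNReal.ofReal_mul hmp,
      ← Real.exp_add]
    ring_nf

lemma lintegral_indicator_sub_expMeasure {lam : ℝ} (hlam : 0 < lam) {s : ℝ} (hs : 0 ≤ s)
    {f : ℝ → ℝ≥0∞} (hf : Measurable f) :
    ∫⁻ t, (Set.Ioi s).indicator (fun t => f (t - s)) t ∂(expMeasure lam)
      = ENNReal.ofReal (Real.exp (-(lam * s))) * ∫⁻ t, f t ∂(expMeasure lam) := by
  rw [lintegral_indicator measurableSet_Ioi, ← lintegral_map hf (by fun_prop),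
    map_sub_restrict_expMeasure hlam hs, lintegral_smul_measure, smul_eq_mul]

end ConventionalBuffer

end

noncomputable section

namespace ConventionalBuffer

open scoped ENNReal

/-! ### Restarting a renewal sequence at a fixed time -/

/-- The number of epochs in `[0, d]` of the renewal process with gaps `x`. -/
def passIdx (d : ℝ) (x : ℕ → ℝ) : ℕ := sInf {k | d < psum x (k + 1)}

/-- The last epoch before `d`, or `0` if there is none. -/
def lastEpoch (d : ℝ) (x : ℕ → ℝ) : ℝ := psum x (passIdx d x)

/-- Shorten the first gap by `s`. -/
def delay (s : ℝ) (x : ℕ → ℝ) : ℕ → ℝ := fun i => if i = 0 then x 0 - s else x i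

/-- The gaps seen from time `d`, if there are `n` epochs before `d`. -/
def elapseAt (n : ℕ) (d : ℝ) (x : ℕ → ℝ) : ℕ → ℝ := delay (d - psum x n) fun i => x (n + i)

/-- The gaps of the renewal process seen from time `d`. -/
def elapse (d : ℝ) (x : ℕ → ℝ) : ℕ → ℝ := elapseAt (passIdx d x) d x

/-- Gaps that are positive and have unbounded partial sums. -/
structure GoodGaps (x : ℕ → ℝ) : Prop where
  pos : ∀ i, 0 < x i
  unbounded : ∀ y, ∃ n, y < psum x n

/-- The set of gap sequences with `n` epochs before `d`. -/
def passSet (n : ℕ) (d : ℝ) : Set (ℕ → ℝ) := {x | psum x n ≤ d ∧ d < psum x (n + 1)}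

/-- Seen from `d`, the later epochs are the old ones translated by `d`. The index starts at 1
because the shortened first gap carries the translation, while the empty sum stays 0. -/
lemma psum_elapseAt (n : ℕ) (d : ℝ) (x : ℕ → ℝ) (k : ℕ) :
    psum (elapseAt n d x) (k + 1) = psum x (n + k + 1) - d := by
  induction k with
  | zero =>
    rw [zero_add, add_zero, psum_succ, psum_succ, psum_zero]
    simp only [elapseAt, delay, if_pos, add_zero]
    ring
  | succ k ih =>
    rw [psum_succ, ih, ← add_assoc n k 1, psum_succ x (n + k + 1)]
    simp only [elapseAt, delay, Nat.succ_ne_zero, if_neg, not_false_eq_true]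
    rw [show n + (k + 1) = n + k + 1 by ring]
    ring

lemma passIdx_eq {x : ℕ → ℝ} (hx : ∀ i, 0 ≤ x i) {d : ℝ} {n : ℕ} (h : x ∈ passSet n d) :
    passIdx d x = n := by
  refine le_antisymm (Nat.sInf_le h.2) ?_
  by_contra! hlt
  have h1 : d < psum x (passIdx d x + 1) := Nat.sInf_mem (s := {k | d < psum x (k + 1)}) ⟨n, h.2⟩
  have h2 := psum_mono hx hlt
  exact absurd h.1 (not_le.2 (h1.trans_le h2))

lemma lastEpoch_le (x : ℕ → ℝ) {d : ℝ} (hd : 0 ≤ d) : lastEpoch d x ≤ d := by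
  unfold lastEpoch
  rcases h : passIdx d x with _ | k
  · simpa using hd
  · by_contra! hlt
    have : passIdx d x ≤ k := Nat.sInf_le hlt
    omega

lemma psum_elapse (d : ℝ) (x : ℕ → ℝ) (k : ℕ) :
    psum (elapse d x) (k + 1) = psum x (passIdx d x + k + 1) - d := psum_elapseAt _ _ _ _

namespace GoodGaps

variable {x : ℕ → ℝ}

lemma nonneg (hx : GoodGaps x) (i : ℕ) : 0 ≤ x i := (hx.pos i).le

lemma lt_psum_passIdx_succ (hx : GoodGaps x) (d : ℝ) : d < psum x (passIdx d x + 1) := by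
  obtain ⟨n, hn⟩ := hx.unbounded d
  exact Nat.sInf_mem (s := {k | d < psum x (k + 1)})
    ⟨n, hn.trans_le (psum_mono hx.nonneg n.le_succ)⟩

lemma mem_passSet (hx : GoodGaps x) {d : ℝ} (hd : 0 ≤ d) : x ∈ passSet (passIdx d x) d :=
  ⟨lastEpoch_le x hd, hx.lt_psum_passIdx_succ d⟩

lemma mem_passSet_iff (hx : GoodGaps x) {d : ℝ} (hd : 0 ≤ d) {n : ℕ} : x ∈ passSet n d ↔ passIdx d x = n :=
  ⟨passIdx_eq hx.nonneg, fun h => h ▸ hx.mem_passSet hd⟩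

lemma lastEpoch_nonneg (hx : GoodGaps x) (d : ℝ) : 0 ≤ lastEpoch d x := by
  unfold lastEpoch psum
  exact Finset.sum_nonneg fun i _ => hx.nonneg i

lemma lastEpoch_pos_iff (hx : GoodGaps x) {d : ℝ} (hd : 0 ≤ d) : 0 < lastEpoch d x ↔ x 0 ≤ d := by
  constructor
  · intro h
    refine le_trans ?_ (lastEpoch_le x hd)
    unfold lastEpoch at *
    rcases hk : passIdx d x with _ | k
    · simp [hk] at h
    · calc x 0 = psum x 1 := by simp [psum_succ]
        _ ≤ _ := psum_mono hx.nonneg (by omega)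
  · intro h
    have h1 := hx.lt_psum_passIdx_succ d
    unfold lastEpoch
    rcases hk : passIdx d x with _ | k
    · rw [hk, psum_succ, psum_zero, zero_add] at h1
      exact absurd h (not_le.2 h1)
    · calc 0 = psum x 0 := by simp
        _ < _ := psum_strictMono hx.pos (by omega)

/-- Both sides say that no epoch lies in (s, d]. This converts the time elapsed since the last epoch
before `d` into the waiting time from `s` to the next epoch, whose law is known. -/
lemma lastEpoch_le_iff (hx : GoodGaps x) {s d : ℝ} (hs : 0 ≤ s) (hsd : s < d) :
    lastEpoch d x ≤ s ↔ d < psum x (passIdx s x + 1) := by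
  constructor
  · intro h
    have : x ∈ passSet (passIdx d x) s := ⟨h, hsd.trans (hx.lt_psum_passIdx_succ d)⟩
    rw [passIdx_eq hx.nonneg this]
    exact hx.lt_psum_passIdx_succ d
  · intro h
    have : x ∈ passSet (passIdx s x) d := ⟨(lastEpoch_le x hs).trans hsd.le, h⟩
    rw [lastEpoch, passIdx_eq hx.nonneg this]
    exact lastEpoch_le x hs

lemma elapse_goodGaps (hx : GoodGaps x) (d : ℝ) : GoodGaps (elapse d x) where
  pos i := by
    rcases i with _ | i
    · have h := psum_elapse d x 0
      have h1 := hx.lt_psum_passIdx_succ d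
      rw [zero_add, psum_succ, psum_zero, zero_add, add_zero] at h
      rw [h]
      linarith
    · simp only [elapse, elapseAt, delay, Nat.succ_ne_zero, if_neg, not_false_eq_true]
      exact hx.pos _
  unbounded y := by
    obtain ⟨n, hn⟩ := hx.unbounded (y + d)
    refine ⟨n + 1, ?_⟩
    rw [psum_elapse]
    have := psum_mono hx.nonneg (show n ≤ passIdx d x + n + 1 by omega)
    linarith

lemma tail (hx : GoodGaps x) : GoodGaps (seqTail x) where
  pos i := hx.pos _
  unbounded y := by
    obtain ⟨n, hn⟩ := hx.unbounded (y + x 0)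
    refine ⟨n, ?_⟩
    have := psum_mono hx.nonneg n.le_succ
    rw [Nat.succ_eq_add_one, psum_succ'] at this
    linarith

end GoodGaps

@[fun_prop]
lemma measurable_delay : Measurable fun z : ℝ × (ℕ → ℝ) => delay z.1 z.2 := by
  refine measurable_pi_iff.2 fun i => ?_
  unfold delay
  by_cases h : i = 0
  · simp only [h, if_true]; fun_prop
  · simp only [h, if_false]; fun_prop

@[fun_prop]
lemma measurable_elapseAt (n : ℕ) : Measurable fun z : ℝ × (ℕ → ℝ) => elapseAt n z.1 z.2 := by
  unfold elapseAt
  exact measurable_delay.comp (f := fun z : ℝ × (ℕ → ℝ) =>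
    (z.1 - psum z.2 n, fun i => z.2 (n + i))) (by fun_prop)

lemma measurableSet_passSet (n : ℕ) : MeasurableSet {z : ℝ × (ℕ → ℝ) | z.2 ∈ passSet n z.1} :=
  (measurableSet_le ((measurable_psum n).comp measurable_snd) measurable_fst).inter
    (measurableSet_lt measurable_fst ((measurable_psum (n + 1)).comp measurable_snd))

lemma measurable_sInf_nat {α : Type*} [MeasurableSpace α] {p : α → ℕ → Prop}
    (hp : ∀ k, MeasurableSet {a | p a k}) : Measurable fun a => sInf {k | p a k} := by
  refine measurable_to_countable' fun n => ?_
  rcases n with _ | n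
  -- The infimum of the empty set is 0 by convention, so the value 0 also arises when no index
  -- qualifies.
  · have : (fun a => sInf {k | p a k}) ⁻¹' {0} = {a | p a 0} ∪ ⋂ k, {a | p a k}ᶜ := by
      ext a
      simp [Nat.sInf_eq_zero, Set.eq_empty_iff_forall_notMem]
    rw [this]
    exact (hp 0).union (MeasurableSet.iInter fun k => (hp k).compl)
  · have : (fun a => sInf {k | p a k}) ⁻¹' {n + 1}
        = {a | p a (n + 1)} ∩ ⋂ k : Fin (n + 1), {a | p a k}ᶜ := by
      ext a
      simp only [Set.mem_preimage, Set.mem_singleton_iff, Set.mem_inter_iff, Set.mem_ofPred_eq,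
        Set.mem_iInter, Set.mem_compl_iff]
      constructor
      · intro h
        have hne : {k | p a k}.Nonempty := Nat.nonempty_of_sInf_eq_succ h
        refine ⟨h ▸ Nat.sInf_mem hne, fun k hk => ?_⟩
        have := Nat.sInf_le (s := {k | p a k}) hk
        omega
      · rintro ⟨h1, h2⟩
        refine le_antisymm (Nat.sInf_le h1) ?_
        by_contra! hlt
        exact h2 ⟨_, hlt⟩ (Nat.sInf_mem (s := {k | p a k}) ⟨_, h1⟩)
    rw [this]
    exact (hp _).inter (MeasurableSet.iInter fun k => (hp _).compl)

@[fun_prop]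
lemma measurable_passIdx : Measurable fun z : ℝ × (ℕ → ℝ) => passIdx z.1 z.2 :=
  measurable_sInf_nat fun k =>
    measurableSet_lt measurable_fst ((measurable_psum (k + 1)).comp measurable_snd)

@[fun_prop]
lemma measurable_lastEpoch : Measurable fun z : ℝ × (ℕ → ℝ) => lastEpoch z.1 z.2 :=
  (measurable_from_prod_countable_right (f := fun y : ℕ × (ℝ × (ℕ → ℝ)) => psum y.2.2 y.1)
    (fun n => (measurable_psum n).comp measurable_snd)).comp (measurable_passIdx.prodMk measurable_id)

@[fun_prop]
lemma measurable_elapse : Measurable fun z : ℝ × (ℕ → ℝ) => elapse z.1 z.2 :=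
  (measurable_from_prod_countable_right
    (f := fun y : ℕ × (ℝ × (ℕ → ℝ)) => elapseAt y.1 y.2.1 y.2.2)
    (fun n => measurable_elapseAt n)).comp (measurable_passIdx.prodMk measurable_id)

end ConventionalBuffer

end

noncomputable section

namespace ConventionalBuffer

open scoped ENNReal

/-! ### The exponential renewal process restarted at a fixed time -/

instance {lam : ℝ} [h : Fact (0 < lam)] : IsProbabilityMeasure (expMeasure lam) :=
  isProbabilityMeasure_expMeasure h.out

variable (lam : ℝ) [hlam : Fact (0 < lam)]

lemma ae_goodGaps : ∀ᵐ x ∂(iidSeq (expMeasure lam)), GoodGaps x := by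
  have h0 : expMeasure lam (Set.Iio 0) = 0 :=
    measure_mono_null Set.Iio_subset_Iic_self (expMeasure_Iic_zero hlam.out)
  have hpos : expMeasure lam (Set.Ioi 0) ≠ 0 := by
    simp [expMeasure_Ioi hlam.out le_rfl]
  have h1 : ∀ᵐ x ∂(iidSeq (expMeasure lam)), ∀ i, 0 < x i := by
    rw [ae_all_iff]
    intro i
    exact (measurePreserving_eval_infinitePi (fun _ : ℕ => expMeasure lam) i).quasiMeasurePreserving.ae
      (expMeasure_ae_pos hlam.out)
  filter_upwards [h1, ae_psum_unbounded _ h0 hpos] with x h1 h2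
  exact ⟨h1, h2⟩

/-- Memorylessness for the whole sequence: given that the first gap exceeds `s`, its remainder
together with the other gaps is again an i.i.d. exponential sequence. -/
lemma lintegral_delay {s : ℝ} (hs : 0 ≤ s) {Φ : (ℕ → ℝ) → ℝ≥0∞} (hΦ : Measurable Φ) :
    ∫⁻ x, {x : ℕ → ℝ | s < x 0}.indicator (fun x => Φ (delay s x)) x ∂(iidSeq (expMeasure lam))
      = ENNReal.ofReal (Real.exp (-(lam * s))) * ∫⁻ x, Φ x ∂(iidSeq (expMeasure lam)) := by
  have hm : Measurable fun z : ℝ × (ℕ → ℝ) => Φ (seqCons z) := hΦ.comp measurable_seqCons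
  have e1 : ∀ x : ℕ → ℝ, {x : ℕ → ℝ | s < x 0}.indicator (fun x => Φ (delay s x)) x
      = (fun z : ℝ × (ℕ → ℝ) => (Set.Ioi s).indicator
          (fun t => Φ (seqCons (t - s, z.2))) z.1) (x 0, seqTail x) := by
    intro x
    have : delay s x = seqCons (x 0 - s, seqTail x) := by
      funext i; cases i <;> simp [delay, seqTail]
    by_cases h : s < x 0 <;> simp [Set.indicator, h, this]
  have e2 : ∀ x : ℕ → ℝ, Φ x = (fun z : ℝ × (ℕ → ℝ) => Φ (seqCons z)) (x 0, seqTail x) := by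
    intro x
    have : seqCons (x 0, seqTail x) = x := by
      funext i; cases i <;> simp [seqTail]
    simp [this]
  have hF : Measurable fun z : ℝ × (ℕ → ℝ) => (Set.Ioi s).indicator
      (fun t => Φ (seqCons (t - s, z.2))) z.1 := by
    have := (hm.comp (f := fun z : ℝ × (ℕ → ℝ) => (z.1 - s, z.2)) (by fun_prop)).indicator
      (measurable_fst (α := ℝ) (β := ℕ → ℝ) (measurableSet_Ioi (a := s)))
    exact this
  rw [lintegral_congr e1, lintegral_head_tail _ hF, lintegral_congr e2, lintegral_head_tail _ hm,
    ← lintegral_indicator_sub_expMeasure hlam.out hs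
      (f := fun t => ∫⁻ x, Φ (seqCons (t, x)) ∂(iidSeq (expMeasure lam))) hm.lintegral_prod_right']
  refine lintegral_congr fun t => ?_
  by_cases h : s < t <;> simp [Set.indicator, h]

/-- Induction on the number of epochs: removing the first gap t replaces the horizon `d` by d - t
and `g` by its translate g(t + ·), which is why both are generalized. The base case is
`lintegral_delay`. -/
lemma lintegral_passSet (n : ℕ) (d : ℝ) {g : ℝ → ℝ≥0∞} (hg : Measurable g)
    {F : (ℕ → ℝ) → ℝ≥0∞} (hF : Measurable F) :
    ∫⁻ x, (passSet n d).indicator (fun x => g (psum x n) * F (elapseAt n d x)) x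
        ∂(iidSeq (expMeasure lam))
      = (∫⁻ x, (passSet n d).indicator (fun x => g (psum x n)) x ∂(iidSeq (expMeasure lam)))
        * ∫⁻ x, F x ∂(iidSeq (expMeasure lam)) := by
  induction n generalizing d g with
  | zero =>
    have h0 : ∀ x : ℕ → ℝ, elapseAt 0 d x = delay d x := by
      intro x
      simp [elapseAt]
    -- The induction can push the horizon below zero; the event is then empty.
    rcases lt_or_ge d 0 with hd | hd
    · have : passSet 0 d = ∅ := by
        ext x
        simp [passSet, hd]
      simp [this]
    · have h1 : passSet 0 d = {x | d < x 0} := by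
        ext x
        simp [passSet, hd, psum_succ]
      simp only [h0, h1, psum_zero]
      have h2 := lintegral_delay lam hd (Φ := fun x => g 0 * F x) (hF.const_mul _)
      have h3 := lintegral_delay lam hd (Φ := fun _ => g 0) measurable_const
      rw [h2, h3, lintegral_const_mul _ hF]
      simp [mul_assoc]
  | succ n ih =>
    have hset : ∀ x : ℕ → ℝ, x ∈ passSet (n + 1) d ↔ seqTail x ∈ passSet n (d - x 0) := by
      intro x
      simp only [passSet, Set.mem_ofPred_eq, psum_succ' x]
      constructor <;> rintro ⟨h1, h2⟩ <;> constructor <;> linarith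
    have helapse : ∀ x : ℕ → ℝ, elapseAt (n + 1) d x = elapseAt n (d - x 0) (seqTail x) := by
      intro x
      unfold elapseAt
      rw [psum_succ', sub_sub]
      congr 1
      funext i
      simp only [seqTail]
      congr 1
      ring
    have hms : MeasurableSet {z : ℝ × (ℕ → ℝ) | z.2 ∈ passSet n (d - z.1)} :=
      (measurableSet_passSet n).preimage
        (f := fun z : ℝ × (ℕ → ℝ) => (d - z.1, z.2)) (by fun_prop)
    have hmg : Measurable fun z : ℝ × (ℕ → ℝ) => g (z.1 + psum z.2 n) :=
      hg.comp (measurable_fst.add ((measurable_psum n).comp measurable_snd))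
    have hmF : Measurable fun z : ℝ × (ℕ → ℝ) => F (elapseAt n (d - z.1) z.2) :=
      hF.comp ((measurable_elapseAt n).comp (f := fun z : ℝ × (ℕ → ℝ) => (d - z.1, z.2))
        (by fun_prop))
    have e1 : ∀ x : ℕ → ℝ,
        (passSet (n + 1) d).indicator (fun x => g (psum x (n + 1)) * F (elapseAt (n + 1) d x)) x
        = ({z : ℝ × (ℕ → ℝ) | z.2 ∈ passSet n (d - z.1)}.indicator
          (fun z => g (z.1 + psum z.2 n) * F (elapseAt n (d - z.1) z.2))) (x 0, seqTail x) := by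
      intro x
      by_cases h : x ∈ passSet (n + 1) d
      · rw [Set.indicator_of_mem h, Set.indicator_of_mem (by exact (hset x).1 h), helapse, psum_succ']
      · rw [Set.indicator_of_notMem h, Set.indicator_of_notMem (by exact fun h' => h ((hset x).2 h'))]
    have e2 : ∀ x : ℕ → ℝ,
        (passSet (n + 1) d).indicator (fun x => g (psum x (n + 1))) x
        = ({z : ℝ × (ℕ → ℝ) | z.2 ∈ passSet n (d - z.1)}.indicator
          (fun z => g (z.1 + psum z.2 n))) (x 0, seqTail x) := by
      intro x
      by_cases h : x ∈ passSet (n + 1) d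
      · rw [Set.indicator_of_mem h, Set.indicator_of_mem (by exact (hset x).1 h), psum_succ']
      · rw [Set.indicator_of_notMem h, Set.indicator_of_notMem (by exact fun h' => h ((hset x).2 h'))]
    have hmgF : Measurable ({z : ℝ × (ℕ → ℝ) | z.2 ∈ passSet n (d - z.1)}.indicator
        fun z => g (z.1 + psum z.2 n) * F (elapseAt n (d - z.1) z.2)) :=
      (hmg.mul hmF).indicator hms
    rw [lintegral_congr e1, lintegral_congr e2, lintegral_head_tail _ hmgF,
      lintegral_head_tail _ (hmg.indicator hms),
      ← lintegral_mul_const _ (hmg.indicator hms).lintegral_prod_right']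
    refine lintegral_congr fun t => ?_
    have := ih (d - t) (g := fun y => g (t + y)) (hg.comp (by fun_prop))
    exact this

/-- Markov property at a fixed time: the past, as far as the last epoch records it, is independent
of the gaps seen from `d`, and these have the original law. It results from summing
`lintegral_passSet` over the number of epochs before `d`. -/
lemma lintegral_elapse {d : ℝ} (hd : 0 ≤ d) {g : ℝ → ℝ≥0∞} (hg : Measurable g)
    {F : (ℕ → ℝ) → ℝ≥0∞} (hF : Measurable F) :
    ∫⁻ x, g (lastEpoch d x) * F (elapse d x) ∂(iidSeq (expMeasure lam))
      = (∫⁻ x, g (lastEpoch d x) ∂(iidSeq (expMeasure lam)))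
        * ∫⁻ x, F x ∂(iidSeq (expMeasure lam)) := by
  have hms : ∀ n, MeasurableSet (passSet n d) := fun n =>
    (measurableSet_passSet n).preimage (f := fun x : ℕ → ℝ => (d, x)) (by fun_prop)
  have hmg : ∀ n, Measurable fun x : ℕ → ℝ => g (psum x n) := fun n => hg.comp (measurable_psum n)
  have hmF : ∀ n, Measurable fun x : ℕ → ℝ => F (elapseAt n d x) := fun n =>
    hF.comp ((measurable_elapseAt n).comp (f := fun x : ℕ → ℝ => (d, x)) (by fun_prop))
  have key : ∀ G : ℕ → (ℕ → ℝ) → ℝ≥0∞, ∀ᵐ x ∂(iidSeq (expMeasure lam)),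
      G (passIdx d x) x = ∑' n, (passSet n d).indicator (G n) x := by
    intro G
    filter_upwards [ae_goodGaps lam] with x hx
    rw [tsum_eq_single (passIdx d x), Set.indicator_of_mem (hx.mem_passSet hd)]
    intro n hn
    exact Set.indicator_of_notMem (fun h => hn ((hx.mem_passSet_iff hd).1 h).symm) _
  have k1 : ∫⁻ x, g (lastEpoch d x) * F (elapse d x) ∂(iidSeq (expMeasure lam)) = _ :=
    lintegral_congr_ae (key fun n x => g (psum x n) * F (elapseAt n d x))
  have k2 : ∫⁻ x, g (lastEpoch d x) ∂(iidSeq (expMeasure lam)) = _ :=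
    lintegral_congr_ae (key fun n x => g (psum x n))
  have hmgF : ∀ n, Measurable ((passSet n d).indicator
      fun x => g (psum x n) * F (elapseAt n d x)) := fun n => ((hmg n).mul (hmF n)).indicator (hms n)
  rw [k1, k2,
    lintegral_tsum fun n => (hmgF n).aemeasurable,
    lintegral_tsum fun n => ((hmg n).indicator (hms n)).aemeasurable, ← ENNReal.tsum_mul_right]
  exact tsum_congr fun n => lintegral_passSet lam n d hg hF

lemma map_elapse {d : ℝ} (hd : 0 ≤ d) :
    (iidSeq (expMeasure lam)).map (elapse d) = iidSeq (expMeasure lam) := by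
  have hm : Measurable (elapse d) :=
    measurable_elapse.comp (f := fun x : ℕ → ℝ => (d, x)) (by fun_prop)
  ext s hs
  have := lintegral_elapse lam hd (g := fun _ => 1) measurable_const
    (F := s.indicator 1) (measurable_one.indicator hs)
  simp only [one_mul, lintegral_const, measure_univ, mul_one] at this
  rw [lintegral_indicator_one hs, ← lintegral_map (f := s.indicator 1)
    (measurable_one.indicator hs) hm, lintegral_indicator_one hs] at this
  exact this

/-- The time since the last epoch before `d` is distributed as an exponential time cut off
at `d`. -/
lemma map_sub_lastEpoch {d : ℝ} (hd : 0 ≤ d) :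
    (iidSeq (expMeasure lam)).map (fun x => d - lastEpoch d x)
      = (expMeasure lam).map fun t => min t d := by
  have hml : Measurable fun x : ℕ → ℝ => lastEpoch d x :=
    measurable_lastEpoch.comp (f := fun x : ℕ → ℝ => (d, x)) (by fun_prop)
  have hm : Measurable fun x : ℕ → ℝ => d - lastEpoch d x := hml.const_sub d
  have hm' : Measurable fun t : ℝ => min t d := by fun_prop
  have := Measure.isProbabilityMeasure_map (μ := iidSeq (expMeasure lam)) hm.aemeasurable
  refine Measure.ext_of_Ici _ _ fun a => ?_
  rw [Measure.map_apply hm measurableSet_Ici, Measure.map_apply hm' measurableSet_Ici]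
  rcases le_or_gt a 0 with ha | ha
  · rw [measure_congr (t := Set.univ) (eventuallyEq_set.2 ?_),
      measure_congr (μ := expMeasure lam) (t := Set.univ) (eventuallyEq_set.2 ?_), measure_univ,
      measure_univ]
    · filter_upwards [expMeasure_ae_pos hlam.out] with t ht
      simpa using ⟨ha.trans ht.le, ha.trans hd⟩
    · refine Eventually.of_forall fun x => ?_
      have := lastEpoch_le x hd
      simp only [Set.mem_preimage, Set.mem_Ici, Set.mem_univ, iff_true]
      linarith
  · rcases lt_or_ge d a with hda | had
    · rw [measure_congr (t := ∅) (eventuallyEq_set.2 ?_),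
        measure_congr (μ := expMeasure lam) (t := ∅) (eventuallyEq_set.2 ?_), measure_empty,
        measure_empty]
      · refine Eventually.of_forall fun t => ?_
        simp [hda]
      · filter_upwards [ae_goodGaps lam] with x hx
        have := hx.lastEpoch_nonneg d
        simp only [Set.mem_preimage, Set.mem_Ici, Set.mem_empty_iff_false, iff_false]
        linarith
    · have hda : 0 ≤ d - a := by linarith
      have hme : Measurable (elapse (d - a)) :=
        measurable_elapse.comp (f := fun x : ℕ → ℝ => (d - a, x)) (by fun_prop)
      have hs : MeasurableSet {x : ℕ → ℝ | a < x 0} :=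
        measurableSet_lt (by fun_prop) (by fun_prop)
      -- The last epoch lies at least a before `d` exactly if the first gap seen from time d - a
      -- exceeds a; by `map_elapse` that gap is exponential.
      have e1 : (iidSeq (expMeasure lam)) ((fun x => d - lastEpoch d x) ⁻¹' Set.Ici a)
          = (iidSeq (expMeasure lam)).map (elapse (d - a)) {x | a < x 0} := by
        rw [Measure.map_apply hme hs]
        refine measure_congr (eventuallyEq_set.2 ?_)
        filter_upwards [ae_goodGaps lam] with x hx
        have h1 := hx.lastEpoch_le_iff hda (show d - a < d by linarith)
        have h2 : elapse (d - a) x 0 = psum x (passIdx (d - a) x + 1) - (d - a) := by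
          rw [← add_zero (passIdx (d - a) x), ← psum_elapse, psum_succ, psum_zero, zero_add]
        simp only [Set.mem_preimage, Set.mem_Ici, Set.mem_ofPred_eq, h2]
        constructor
        · intro h
          linarith [h1.1 (by linarith)]
        · intro h
          linarith [h1.2 (by linarith)]
      have e2 : (fun t : ℝ => min t d) ⁻¹' Set.Ici a = Set.Ici a := by
        ext t
        simp [had]
      have e3 : {x : ℕ → ℝ | a < x 0} = (fun x : ℕ → ℝ => x 0) ⁻¹' Set.Ioi a := rfl
      rw [e1, e2, map_elapse lam hda, e3, ← Measure.map_apply (measurable_pi_apply 0)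
        measurableSet_Ioi, map_head, expMeasure_Ioi hlam.out ha.le, expMeasure_Ici hlam.out ha.le]

end ConventionalBuffer

end

noncomputable section

namespace ConventionalBuffer

open scoped ENNReal

/-! ### A string of vacations -/

/-- The number of vacations until the first arrival, for a pair of interarrival times and
vacation times. -/
def vacCount (z : (ℕ → ℝ) × (ℕ → ℝ)) : ℕ := sInf {j | z.1 0 ≤ psum z.2 j}

/-- The outcome of a string of `m` vacations: its length, the age at its end of the last packet
that arrived, and the remaining interarrival and vacation times. -/
def vacOutAt (m : ℕ) (z : (ℕ → ℝ) × (ℕ → ℝ)) : (ℝ × ℝ) × ((ℕ → ℝ) × (ℕ → ℝ)) :=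
  ((psum z.2 m, psum z.2 m - lastEpoch (psum z.2 m) z.1),
    (elapse (psum z.2 m) z.1, fun i => z.2 (m + i)))

/-- The outcome of the string of vacations that ends when a packet has arrived. -/
def vacOut (z : (ℕ → ℝ) × (ℕ → ℝ)) : (ℝ × ℝ) × ((ℕ → ℝ) × (ℕ → ℝ)) := vacOutAt (vacCount z) z

/-- The first arrival occurs during the vacation with index `n`. -/
def stringSet (n : ℕ) : Set ((ℕ → ℝ) × (ℕ → ℝ)) :=
  {z | psum z.2 n < z.1 0 ∧ z.1 0 ≤ psum z.2 (n + 1)}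

/-- Nonnegative terms with unbounded partial sums. -/
structure GoodVacations (v : ℕ → ℝ) : Prop where
  nonneg : ∀ i, 0 ≤ v i
  unbounded : ∀ y, ∃ n, y < psum v n

lemma GoodVacations.shift {v : ℕ → ℝ} (hv : GoodVacations v) (m : ℕ) :
    GoodVacations fun i => v (m + i) where
  nonneg i := hv.nonneg _
  unbounded y := by
    obtain ⟨n, hn⟩ := hv.unbounded (y + psum v m)
    refine ⟨n, ?_⟩
    have := psum_mono hv.nonneg (show n ≤ m + n by omega)
    rw [psum_add] at this
    linarith

lemma vacCount_eq {z : (ℕ → ℝ) × (ℕ → ℝ)} (hv : ∀ i, 0 ≤ z.2 i) {n : ℕ} (h : z ∈ stringSet n) :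
    vacCount z = n + 1 := by
  refine le_antisymm (Nat.sInf_le h.2) ?_
  by_contra! hlt
  have h1 : z.1 0 ≤ psum z.2 (vacCount z) := Nat.sInf_mem (s := {j | z.1 0 ≤ psum z.2 j}) ⟨_, h.2⟩
  have h2 := psum_mono hv (Nat.lt_succ_iff.1 hlt)
  exact absurd h.1 (not_lt.2 (h1.trans h2))

lemma exists_mem_stringSet {z : (ℕ → ℝ) × (ℕ → ℝ)} (hx : GoodGaps z.1) (hv : GoodVacations z.2) :
    ∃ n, z ∈ stringSet n ∧ vacCount z = n + 1 := by
  obtain ⟨m, hm⟩ := hv.unbounded (z.1 0)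
  have h1 : z.1 0 ≤ psum z.2 (vacCount z) :=
    Nat.sInf_mem (s := {j | z.1 0 ≤ psum z.2 j}) ⟨_, hm.le⟩
  rcases hk : vacCount z with _ | n
  · rw [hk, psum_zero] at h1
    exact absurd (hx.pos 0) (not_lt.2 h1)
  · refine ⟨n, ⟨?_, hk ▸ h1⟩, rfl⟩
    by_contra! hlt
    have : vacCount z ≤ n := Nat.sInf_le hlt
    omega

@[fun_prop]
lemma measurable_vacOutAt (m : ℕ) : Measurable (vacOutAt m) := by
  have h1 : Measurable fun z : (ℕ → ℝ) × (ℕ → ℝ) => psum z.2 m :=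
    (measurable_psum m).comp measurable_snd
  have h2 : Measurable fun z : (ℕ → ℝ) × (ℕ → ℝ) => (psum z.2 m, z.1) := h1.prodMk measurable_fst
  have h3 : Measurable fun z : (ℕ → ℝ) × (ℕ → ℝ) => fun i => z.2 (m + i) := by fun_prop
  exact (h1.prodMk (h1.sub (measurable_lastEpoch.comp h2))).prodMk
    ((measurable_elapse.comp h2).prodMk h3)

lemma measurable_vacCount : Measurable vacCount :=
  measurable_sInf_nat fun j =>
    measurableSet_le (by fun_prop) ((measurable_psum j).comp measurable_snd)

@[fun_prop]
lemma measurable_vacOut : Measurable vacOut :=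
  (measurable_from_prod_countable_right
    (f := fun y : ℕ × ((ℕ → ℝ) × (ℕ → ℝ)) => vacOutAt y.1 y.2)
    (fun m => measurable_vacOutAt m)).comp (measurable_vacCount.prodMk measurable_id)

lemma measurableSet_stringSet (n : ℕ) : MeasurableSet (stringSet n) :=
  (measurableSet_lt ((measurable_psum n).comp measurable_snd) (by fun_prop)).inter
    (measurableSet_le (by fun_prop) ((measurable_psum (n + 1)).comp measurable_snd))

lemma passIdx_delay (s d : ℝ) (x : ℕ → ℝ) : passIdx d (delay s x) = passIdx (s + d) x := by
  have : ∀ k, psum (delay s x) (k + 1) = psum x (k + 1) - s := by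
    intro k
    rw [psum_succ', psum_succ' x]
    have : seqTail (delay s x) = seqTail x := by funext i; simp [seqTail, delay]
    rw [this]
    simp only [delay, if_true]
    ring
  simp only [passIdx, this]
  congr 1
  ext k
  simp only [Set.mem_ofPred_eq]
  constructor <;> intro h <;> linarith

/-- If the first arrival comes after the first vacation, this vacation can be skipped. -/
lemma vacOutAt_succ_succ {x v : ℕ → ℝ} {n : ℕ} (hg : GoodGaps x)
    (hx : x 0 ≤ psum v (n + 2)) :
    vacOutAt (n + 2) (x, v) =
      (((vacOutAt (n + 1) (delay (v 0) x, seqTail v)).1.1 + v 0,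
        (vacOutAt (n + 1) (delay (v 0) x, seqTail v)).1.2),
      (vacOutAt (n + 1) (delay (v 0) x, seqTail v)).2) := by
  have h1 : psum v (n + 2) = v 0 + psum (seqTail v) (n + 1) := psum_succ' v (n + 1)
  have hidx := passIdx_delay (v 0) (psum (seqTail v) (n + 1)) x
  rw [← h1] at hidx
  set X := psum v (n + 2) with hX
  set X' := psum (seqTail v) (n + 1) with hX'
  have hdel : ∀ k, psum (delay (v 0) x) (k + 1) = psum x (k + 1) - v 0 := by
    intro k
    rw [psum_succ', psum_succ' x]
    have : seqTail (delay (v 0) x) = seqTail x := by funext i; simp [seqTail, delay]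
    rw [this]
    simp only [delay, if_true]
    ring
  -- The first arrival falls into the string, so the index of the last epoch is positive. This
  -- matters because `delay` translates only the partial sums of positive index.
  obtain ⟨k, hk⟩ : ∃ k, passIdx X x = k + 1 := by
    rcases h0 : passIdx X x with _ | k
    · have := hg.lt_psum_passIdx_succ X
      rw [h0] at this
      simp only [psum_succ, psum_zero, zero_add] at this
      exact absurd hx (not_le.2 this)
    · exact ⟨k, rfl⟩
  have hL : lastEpoch X' (delay (v 0) x) = lastEpoch X x - v 0 := by
    rw [lastEpoch, lastEpoch, hidx, hk, hdel]
  have hE : elapse X' (delay (v 0) x) = elapse X x := by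
    rw [elapse, elapse, hidx, hk, elapseAt, elapseAt, hdel]
    congr 1
    · rw [h1]; ring
    · funext i
      simp [delay]
  simp only [vacOutAt, ← hX, ← hX', hL, hE]
  refine Prod.ext (Prod.ext ?_ ?_) (Prod.ext rfl ?_)
  · change X = X' + v 0
    rw [h1]; ring
  · change X - lastEpoch X x = X' - (lastEpoch X x - v 0)
    rw [h1]; ring
  · funext i
    simp only [seqTail]
    congr 1
    ring

lemma seqCons_head_seqTail {α : Type*} (x : ℕ → α) : seqCons (x 0, seqTail x) = x := by
  funext i; cases i <;> simp [seqTail]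

/-! ### The law of a string of vacations -/

variable (lam : ℝ) [hlam : Fact (0 < lam)] (μV : Measure ℝ) [IsProbabilityMeasure μV]

/-- The law of the interarrival and vacation times. -/
abbrev vacLaw : Measure ((ℕ → ℝ) × (ℕ → ℝ)) := (iidSeq (expMeasure lam)).prod (iidSeq μV)

lemma lintegral_vacLaw {F : (ℕ → ℝ) × (ℕ → ℝ) → ℝ≥0∞} (hF : Measurable F) :
    ∫⁻ z, F z ∂(vacLaw lam μV) = ∫⁻ v₀, ∫⁻ v, ∫⁻ x, F (x, seqCons (v₀, v))
      ∂(iidSeq (expMeasure lam)) ∂(iidSeq μV) ∂μV := by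
  have hm : Measurable fun y : ℝ × (ℕ → ℝ) =>
      ∫⁻ x, F (x, seqCons y) ∂(iidSeq (expMeasure lam)) :=
    (hF.comp (measurable_fst.prodMk (measurable_seqCons.comp measurable_snd))
      (f := fun w : (ℕ → ℝ) × (ℝ × (ℕ → ℝ)) => (w.1, seqCons w.2))).lintegral_prod_left'
  rw [vacLaw, lintegral_prod_symm' _ hF, ← lintegral_head_tail _ hm]
  refine lintegral_congr fun v => ?_
  rw [seqCons_head_seqTail]

/-- The expectation of a function of the outcome, on the event that the string consists of
`n + 1` vacations. -/
def stringInt (n : ℕ) (G : (ℝ × ℝ) × ((ℕ → ℝ) × (ℕ → ℝ)) → ℝ≥0∞) : ℝ≥0∞ :=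
  ∫⁻ z, (stringSet n).indicator (fun z => G (vacOutAt (n + 1) z)) z ∂(vacLaw lam μV)

lemma measurable_stringSet_indicator (n : ℕ) {G : (ℝ × ℝ) × ((ℕ → ℝ) × (ℕ → ℝ)) → ℝ≥0∞}
    (hG : Measurable G) : Measurable ((stringSet n).indicator fun z => G (vacOutAt (n + 1) z)) :=
  (hG.comp (measurable_vacOutAt _)).indicator (measurableSet_stringSet _)

lemma measurable_stringInt (n : ℕ) {G : ℝ × ((ℝ × ℝ) × ((ℕ → ℝ) × (ℕ → ℝ))) → ℝ≥0∞}
    (hG : Measurable G) : Measurable fun r => stringInt lam μV n fun y => G (r, y) := by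
  have hm : Measurable ((Prod.snd ⁻¹' stringSet n).indicator
      fun w : ℝ × ((ℕ → ℝ) × (ℕ → ℝ)) => G (w.1, vacOutAt (n + 1) w.2)) :=
    (hG.comp (measurable_fst.prodMk ((measurable_vacOutAt _).comp measurable_snd))).indicator
      ((measurableSet_stringSet n).preimage measurable_snd)
  exact hm.lintegral_prod_right'

variable {μV}

lemma ae_iidSeq_nonneg {μ : Measure ℝ} [IsProbabilityMeasure μ] (h0 : μ (Set.Iio 0) = 0) :
    ∀ᵐ v ∂(iidSeq μ), ∀ i, 0 ≤ v i := by
  rw [ae_all_iff]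
  intro i
  exact (measurePreserving_eval_infinitePi (fun _ : ℕ => μ) i).quasiMeasurePreserving.ae
    (ae_nonneg_of_measure_Iio_eq_zero h0)

/-- Condition on the first vacation `v₀`. It passes without arrival with probability e^{-λ v₀}; by
memorylessness the string then starts afresh, so that its total length grows by `v₀` while the age
of the packet found at the end is unaffected. -/
lemma stringInt_succ (hV0 : μV (Set.Iio 0) = 0) (n : ℕ)
    {G : (ℝ × ℝ) × ((ℕ → ℝ) × (ℕ → ℝ)) → ℝ≥0∞} (hG : Measurable G) :
    stringInt lam μV (n + 1) G = ∫⁻ v₀, ENNReal.ofReal (Real.exp (-(lam * v₀))) *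
      stringInt lam μV n (fun y => G ((y.1.1 + v₀, y.1.2), y.2)) ∂μV := by
  have hGv : ∀ v₀ : ℝ, Measurable fun y : (ℝ × ℝ) × ((ℕ → ℝ) × (ℕ → ℝ)) =>
      G ((y.1.1 + v₀, y.1.2), y.2) := fun v₀ => hG.comp (by fun_prop)
  have hm := fun v₀ => measurable_stringSet_indicator n (hGv v₀)
  rw [stringInt, lintegral_vacLaw lam μV (measurable_stringSet_indicator (n + 1) hG)]
  refine lintegral_congr_ae ?_
  filter_upwards [ae_nonneg_of_measure_Iio_eq_zero hV0] with v₀ hv₀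
  rw [stringInt, lintegral_prod_symm' _ (hm v₀),
    ← lintegral_const_mul _ (hm v₀).lintegral_prod_left']
  refine lintegral_congr_ae ?_
  filter_upwards [ae_iidSeq_nonneg hV0] with v hv
  have key := lintegral_delay lam hv₀ (Φ := fun x => (stringSet n).indicator
    (fun z => G (((vacOutAt (n + 1) z).1.1 + v₀, (vacOutAt (n + 1) z).1.2),
      (vacOutAt (n + 1) z).2)) (x, v)) ((hm v₀).comp (by fun_prop))
  refine Eq.trans (lintegral_congr_ae ?_) key
  filter_upwards [ae_goodGaps lam] with x hx
  have h1 : ∀ k, psum (seqCons (v₀, v)) (k + 1) = v₀ + psum v k := fun k => psum_succ' _ k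
  have h2 : 0 ≤ psum v n := by
    rw [← psum_zero v]
    exact psum_mono hv (Nat.zero_le n)
  have hiff : (x, seqCons (v₀, v)) ∈ stringSet (n + 1) ↔
      v₀ < x 0 ∧ (delay v₀ x, v) ∈ stringSet n := by
    simp only [stringSet, Set.mem_ofPred_eq, h1, delay, if_true]
    constructor
    · rintro ⟨ha, hb⟩
      exact ⟨by linarith, by linarith, by linarith⟩
    · rintro ⟨-, ha, hb⟩
      exact ⟨by linarith, by linarith⟩
  by_cases h : (x, seqCons (v₀, v)) ∈ stringSet (n + 1)
  · rw [Set.indicator_of_mem h, Set.indicator_of_mem (by exact (hiff.1 h).1),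
      Set.indicator_of_mem (hiff.1 h).2, vacOutAt_succ_succ hx h.2]
    rfl
  · rw [Set.indicator_of_notMem h]
    by_cases h' : v₀ < x 0
    · rw [Set.indicator_of_mem (by exact h'),
        Set.indicator_of_notMem fun h'' => h (hiff.2 ⟨h', h''⟩)]
    · rw [Set.indicator_of_notMem (by exact h')]

/-- A single vacation suffices iff the last epoch before its end is positive. In this form the event
depends on the past only through `lastEpoch`, as `lintegral_elapse` requires. -/
lemma stringInt_zero (hV0 : μV (Set.Iio 0) = 0)
    {G : (ℝ × ℝ) × ((ℕ → ℝ) × (ℕ → ℝ)) → ℝ≥0∞} (hG : Measurable G) :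
    stringInt lam μV 0 G = ∫⁻ v₀, ∫⁻ v, ∫⁻ x, (Set.Ioi (0 : ℝ)).indicator
      (fun l => G ((v₀, v₀ - l), (elapse v₀ x, v))) (lastEpoch v₀ x)
      ∂(iidSeq (expMeasure lam)) ∂(iidSeq μV) ∂μV := by
  rw [stringInt, lintegral_vacLaw lam μV (measurable_stringSet_indicator 0 hG)]
  refine lintegral_congr_ae ?_
  filter_upwards [ae_nonneg_of_measure_Iio_eq_zero hV0] with v₀ hv₀
  refine lintegral_congr fun v => lintegral_congr_ae ?_
  filter_upwards [ae_goodGaps lam] with x hx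
  have h1 : psum (seqCons (v₀, v)) 1 = v₀ := by simp [psum_succ]
  have hiff : (x, seqCons (v₀, v)) ∈ stringSet 0 ↔ lastEpoch v₀ x ∈ Set.Ioi 0 := by
    rw [Set.mem_Ioi, hx.lastEpoch_pos_iff hv₀]
    simp [stringSet, h1, hx.pos 0]
  by_cases h : (x, seqCons (v₀, v)) ∈ stringSet 0
  · rw [Set.indicator_of_mem h, Set.indicator_of_mem (hiff.1 h)]
    simp only [vacOutAt, zero_add, h1]
    congr 3
    funext i
    rw [add_comm, seqCons_succ]
  · rw [Set.indicator_of_notMem h, Set.indicator_of_notMem fun h' => h (hiff.2 h')]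

/-- The outcome of a string of vacations is independent of what comes afterwards. -/
lemma stringInt_mul (hV0 : μV (Set.Iio 0) = 0) (n : ℕ) {g : ℝ × ℝ → ℝ≥0∞} (hg : Measurable g)
    {F : (ℕ → ℝ) × (ℕ → ℝ) → ℝ≥0∞} (hF : Measurable F) :
    stringInt lam μV n (fun y => g y.1 * F y.2)
      = stringInt lam μV n (fun y => g y.1) * ∫⁻ z, F z ∂(vacLaw lam μV) := by
  induction n generalizing g with
  | zero =>
    rw [stringInt_zero lam hV0 (by fun_prop), stringInt_zero lam hV0 (by fun_prop)]
    simp only [lintegral_const, measure_univ, mul_one]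
    have hF' : ∫⁻ z, F z ∂(vacLaw lam μV) = ∫⁻ v, ∫⁻ x, F (x, v)
        ∂(iidSeq (expMeasure lam)) ∂(iidSeq μV) := lintegral_prod_symm' _ hF
    have hm : Measurable ((Prod.snd ⁻¹' Set.Ioi (0 : ℝ)).indicator
        fun w : ℝ × ℝ => g (w.1, w.1 - w.2)) :=
      (hg.comp (by fun_prop)).indicator (measurableSet_Ioi.preimage measurable_snd)
    have hm' : Measurable fun v₀ => ∫⁻ x, (Set.Ioi (0 : ℝ)).indicator
        (fun l => g (v₀, v₀ - l)) (lastEpoch v₀ x) ∂(iidSeq (expMeasure lam)) :=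
      (hm.comp (measurable_fst.prodMk measurable_lastEpoch)).lintegral_prod_right'
    rw [← lintegral_mul_const _ hm']
    refine lintegral_congr_ae ?_
    filter_upwards [ae_nonneg_of_measure_Iio_eq_zero hV0] with v₀ hv₀
    rw [hF', ← lintegral_const_mul _ hF.lintegral_prod_left']
    refine lintegral_congr fun v => ?_
    -- The condition that a packet has arrived is absorbed into the function of the last epoch.
    rw [← lintegral_elapse lam hv₀ (g := (Set.Ioi (0 : ℝ)).indicator fun l => g (v₀, v₀ - l))
      (F := fun x => F (x, v)) (Measurable.indicator (by fun_prop) measurableSet_Ioi)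
      (by fun_prop)]
    refine lintegral_congr fun x => ?_
    by_cases h : lastEpoch v₀ x ∈ Set.Ioi 0
    · rw [Set.indicator_of_mem h, Set.indicator_of_mem h]
    · rw [Set.indicator_of_notMem h, Set.indicator_of_notMem h, zero_mul]
  | succ n ih =>
    rw [stringInt_succ lam hV0 n (by fun_prop), stringInt_succ lam hV0 n (by fun_prop)]
    -- Skipping a vacation translates the first argument of `g`, so the induction hypothesis is
    -- applied to the translated function.
    have : ∀ v₀ : ℝ, stringInt lam μV n (fun y => g (y.1.1 + v₀, y.1.2) * F y.2)
        = stringInt lam μV n (fun y => g (y.1.1 + v₀, y.1.2)) * ∫⁻ z, F z ∂(vacLaw lam μV) :=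
      fun v₀ => ih (g := fun w => g (w.1 + v₀, w.2)) (by fun_prop)
    simp only [this, ← mul_assoc]
    have hm : Measurable fun v₀ => stringInt lam μV n fun y => g (y.1.1 + v₀, y.1.2) :=
      measurable_stringInt lam μV n
        (G := fun w : ℝ × ((ℝ × ℝ) × ((ℕ → ℝ) × (ℕ → ℝ))) => g (w.2.1.1 + w.1, w.2.1.2))
        (by fun_prop)
    rw [lintegral_mul_const _ (by fun_prop)]

lemma ae_goodVacations (hV0 : μV (Set.Iio 0) = 0) (hVpos : μV (Set.Ioi 0) ≠ 0) :
    ∀ᵐ v ∂(iidSeq μV), GoodVacations v := by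
  filter_upwards [ae_iidSeq_nonneg hV0, ae_psum_unbounded μV hV0 hVpos] with v h1 h2
  exact ⟨h1, h2⟩

lemma lintegral_vacOut (hV0 : μV (Set.Iio 0) = 0) (hVpos : μV (Set.Ioi 0) ≠ 0)
    {G : (ℝ × ℝ) × ((ℕ → ℝ) × (ℕ → ℝ)) → ℝ≥0∞} (hG : Measurable G) :
    ∫⁻ z, G (vacOut z) ∂(vacLaw lam μV) = ∑' n, stringInt lam μV n G := by
  simp only [stringInt]
  rw [← lintegral_tsum fun n => (measurable_stringSet_indicator n hG).aemeasurable]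
  have hx : ∀ᵐ z ∂(vacLaw lam μV), GoodGaps z.1 :=
    Measure.quasiMeasurePreserving_fst.ae (ae_goodGaps lam)
  have hv : ∀ᵐ z ∂(vacLaw lam μV), GoodVacations z.2 :=
    Measure.quasiMeasurePreserving_snd.ae (ae_goodVacations hV0 hVpos)
  refine lintegral_congr_ae ?_
  filter_upwards [hx, hv] with z hx hv
  obtain ⟨n, hn, hc⟩ := exists_mem_stringSet hx hv
  rw [tsum_eq_single n, Set.indicator_of_mem hn, vacOut, hc]
  intro k hk
  refine Set.indicator_of_notMem (fun h => hk ?_) _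
  have := vacCount_eq hv.nonneg h
  omega

/-- Regeneration at the random time when a packet is found: splitting by the number of vacations
reduces it to the Markov property at fixed times. -/
lemma lintegral_vacOut_mul (hV0 : μV (Set.Iio 0) = 0) (hVpos : μV (Set.Ioi 0) ≠ 0)
    {g : ℝ × ℝ → ℝ≥0∞} (hg : Measurable g)
    {F : (ℕ → ℝ) × (ℕ → ℝ) → ℝ≥0∞} (hF : Measurable F) :
    ∫⁻ z, g (vacOut z).1 * F (vacOut z).2 ∂(vacLaw lam μV)
      = (∫⁻ z, g (vacOut z).1 ∂(vacLaw lam μV)) * ∫⁻ z, F z ∂(vacLaw lam μV) := by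
  rw [lintegral_vacOut lam hV0 hVpos (G := fun y => g y.1 * F y.2) (by fun_prop),
    lintegral_vacOut lam hV0 hVpos (G := fun y => g y.1) (by fun_prop), ← ENNReal.tsum_mul_right]
  exact tsum_congr fun n => stringInt_mul lam hV0 n hg hF

end ConventionalBuffer

end

noncomputable section

namespace ConventionalBuffer

open scoped ENNReal

/-! ### Moments of a string of vacations -/

/-- Summing the recursion gives the equation, but S = c + qS is also solved by S = ∞. Finiteness
therefore needs its own argument: (1 - q) times each partial sum is at most `b 0` plus the sum of
all `d n`. -/
lemma tsum_of_linear_recursion {b d : ℕ → ℝ≥0∞} {q : ℝ≥0∞} (hq : q < 1) (hb0 : b 0 ≠ ∞)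
    (hd : ∑' n, d n ≠ ∞) (h : ∀ n, b (n + 1) = d n + q * b n) :
    ∑' n, b n ≠ ∞ ∧ ∑' n, b n = (b 0 + ∑' n, d n) + q * ∑' n, b n := by
  have heq : ∑' n, b n = (b 0 + ∑' n, d n) + q * ∑' n, b n := by
    conv_lhs => rw [tsum_eq_zero_add' ENNReal.summable]
    simp only [h]
    rw [ENNReal.tsum_add, ENNReal.tsum_mul_left, add_assoc]
  refine ⟨?_, heq⟩
  have hdn : ∀ n, d n ≠ ∞ := fun n => ne_top_of_le_ne_top hd (ENNReal.le_tsum n)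
  have hbn : ∀ n, b n ≠ ∞ := by
    intro n
    induction n with
    | zero => exact hb0
    | succ n ih =>
      rw [h]
      exact ENNReal.add_ne_top.2 ⟨hdn n, ENNReal.mul_ne_top (hq.trans ENNReal.one_lt_top).ne ih⟩
  have hpart : ∀ N, (1 - q) * ∑ n ∈ Finset.range N, b n ≤ b 0 + ∑' n, d n := by
    intro N
    rw [ENNReal.sub_mul fun _ _ => ENNReal.sum_ne_top.2 fun n _ => hbn n, one_mul,
      tsub_le_iff_right]
    calc ∑ n ∈ Finset.range N, b n ≤ ∑ n ∈ Finset.range (N + 1), b n :=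
          Finset.sum_le_sum_of_subset (Finset.range_subset_range.2 N.le_succ)
      _ = ∑ n ∈ Finset.range N, (d n + q * b n) + b 0 := by
          rw [Finset.sum_range_succ']
          simp only [h]
      _ = b 0 + ∑ n ∈ Finset.range N, d n + q * ∑ n ∈ Finset.range N, b n := by
          rw [Finset.sum_add_distrib, Finset.mul_sum]
          ring
      _ ≤ _ := by
          gcongr
          exact ENNReal.sum_le_tsum _
  have hle : (1 - q) * ∑' n, b n ≤ b 0 + ∑' n, d n := by
    rw [← ENNReal.tsum_mul_left, ENNReal.tsum_eq_iSup_nat]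
    refine iSup_le fun N => ?_
    rw [← Finset.mul_sum]
    exact hpart N
  intro htop
  rw [htop, ENNReal.mul_top (tsub_pos_of_lt hq).ne'] at hle
  exact (ENNReal.add_ne_top.2 ⟨hb0, hd⟩) (top_le_iff.1 hle)

lemma eq_ofReal_of_linear {S : ℝ≥0∞} {m q : ℝ} (hS : S ≠ ∞) (hm : 0 ≤ m) (hq0 : 0 ≤ q) (hq1 : q < 1)
    (h : S = ENNReal.ofReal m + ENNReal.ofReal q * S) : S = ENNReal.ofReal (m / (1 - q)) := by
  have h1 : S.toReal = m + q * S.toReal := by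
    conv_lhs => rw [h]
    rw [ENNReal.toReal_add ENNReal.ofReal_ne_top (ENNReal.mul_ne_top ENNReal.ofReal_ne_top hS),
      ENNReal.toReal_mul, ENNReal.toReal_ofReal hm, ENNReal.toReal_ofReal hq0]
  rw [← ENNReal.ofReal_toReal hS]
  congr 1
  rw [eq_div_iff (by linarith)]
  linarith

lemma integrable_and_integral_eq {α : Type*} [MeasurableSpace α] {μ : Measure α} {f : α → ℝ}
    (hf : AEStronglyMeasurable f μ) (h0 : 0 ≤ᵐ[μ] f) {c : ℝ} (hc : 0 ≤ c)
    (h : ∫⁻ x, ENNReal.ofReal (f x) ∂μ = ENNReal.ofReal c) : Integrable f μ ∧ ∫ x, f x ∂μ = c := by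
  refine ⟨(lintegral_ofReal_ne_top_iff_integrable hf h0).1 (h ▸ ENNReal.ofReal_ne_top), ?_⟩
  rw [integral_eq_lintegral_of_nonneg_ae h0 hf, h, ENNReal.toReal_ofReal hc]

/-- The primitive `Φ` is part of the data, so that the fundamental theorem of calculus evaluates the
truncated exponential moments; the density is compared off the two points 0 and `v`, a null set. -/
lemma lintegral_Iio_expMeasure {lam : ℝ} (hlam : 0 < lam) {v : ℝ} (hv : 0 ≤ v) {φ Φ : ℝ → ℝ}
    (hφ : Continuous φ) (hφ0 : ∀ t, 0 ≤ t → 0 ≤ φ t)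
    (hΦ : ∀ t, HasDerivAt Φ (φ t * (lam * Real.exp (-(lam * t)))) t) :
    ∫⁻ t, (Set.Iio v).indicator (fun t => ENNReal.ofReal (φ t)) t ∂(expMeasure lam)
      = ENNReal.ofReal (Φ v - Φ 0) := by
  have hc : Continuous fun t => φ t * (lam * Real.exp (-(lam * t))) := by fun_prop
  have hmφ : Measurable fun t => ENNReal.ofReal (φ t) := hφ.measurable.ennreal_ofReal
  change ∫⁻ t, _ ∂(volume.withDensity (exponentialPDF lam)) = _
  have hmpdf : Measurable (exponentialPDF lam) :=
    (measurable_exponentialPDFReal lam).ennreal_ofReal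
  rw [lintegral_withDensity_eq_lintegral_mul _ hmpdf (hmφ.indicator measurableSet_Iio)]
  have e1 : ∀ᵐ t : ℝ, (exponentialPDF lam * (Set.Iio v).indicator fun t => ENNReal.ofReal (φ t)) t
      = (Set.Ioc 0 v).indicator
        (fun t => ENNReal.ofReal (φ t * (lam * Real.exp (-(lam * t))))) t := by
    have hne0 : ∀ᵐ t : ℝ, t ≠ 0 := by simp [ae_iff]
    have hnev : ∀ᵐ t : ℝ, t ≠ v := by simp [ae_iff]
    filter_upwards [hne0, hnev] with t h0 hv'
    rw [Pi.mul_apply]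
    rcases lt_or_gt_of_ne h0 with h | h
    · rw [exponentialPDF_of_neg h, zero_mul, Set.indicator_of_notMem]
      exact fun h' => absurd h'.1 (not_lt.2 h.le)
    · rcases lt_or_gt_of_ne hv' with h' | h'
      · rw [Set.indicator_of_mem (show t ∈ Set.Iio v from h'),
          Set.indicator_of_mem (show t ∈ Set.Ioc 0 v from ⟨h, h'.le⟩),
          exponentialPDF_of_nonneg h.le, mul_comm, ENNReal.ofReal_mul (hφ0 t h.le)]
      · rw [Set.indicator_of_notMem (show t ∉ Set.Iio v from not_lt.2 h'.le),
          Set.indicator_of_notMem (show t ∉ Set.Ioc 0 v from fun h'' => absurd h''.2 (not_le.2 h')),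
          mul_zero]
  rw [lintegral_congr_ae e1, lintegral_indicator measurableSet_Ioc,
    ← ofReal_integral_eq_lintegral_ofReal, ← intervalIntegral.integral_of_le hv,
    intervalIntegral.integral_eq_sub_of_hasDerivAt (fun t _ => hΦ t) (hc.intervalIntegrable _ _)]
  · exact (hc.intervalIntegrable 0 v).1
  · filter_upwards [ae_restrict_mem measurableSet_Ioc] with t ht
    exact mul_nonneg (hφ0 t ht.1.le) (mul_nonneg hlam.le (Real.exp_pos _).le)

variable (lam : ℝ) [hlam : Fact (0 < lam)] {μV : Measure ℝ} [IsProbabilityMeasure μV]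

/-- By `map_sub_lastEpoch` the age at `d` is min(T, d) in law, with T exponential. The last epoch is
positive iff this age is less than `d`, and there min(T, d) = T. -/
lemma lintegral_lastEpoch_pos {d : ℝ} (hd : 0 ≤ d) {g : ℝ → ℝ≥0∞} (hg : Measurable g) :
    ∫⁻ x, (Set.Ioi (0 : ℝ)).indicator (fun l => g (d - l)) (lastEpoch d x)
        ∂(iidSeq (expMeasure lam))
      = ∫⁻ t, (Set.Iio d).indicator g t ∂(expMeasure lam) := by
  have hm : Measurable ((Set.Iio d).indicator g) := hg.indicator measurableSet_Iio
  have hml : Measurable fun x : ℕ → ℝ => d - lastEpoch d x :=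
    (measurable_lastEpoch.comp (f := fun x : ℕ → ℝ => (d, x)) (by fun_prop)).const_sub d
  have e1 : ∀ x : ℕ → ℝ, (Set.Ioi (0 : ℝ)).indicator (fun l => g (d - l)) (lastEpoch d x)
      = (Set.Iio d).indicator g (d - lastEpoch d x) := by
    intro x
    by_cases h : 0 < lastEpoch d x <;> simp [Set.indicator, h]
  have e2 : ∀ t : ℝ, (Set.Iio d).indicator g (min t d) = (Set.Iio d).indicator g t := by
    intro t
    by_cases h : t < d
    · rw [min_eq_left h.le]
    · simp [Set.indicator, h]
  rw [lintegral_congr e1, ← lintegral_map hm hml, map_sub_lastEpoch lam hd,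
    lintegral_map hm (by fun_prop), lintegral_congr e2]

lemma stringInt_congr (hV0 : μV (Set.Iio 0) = 0) (n : ℕ)
    {G G' : (ℝ × ℝ) × ((ℕ → ℝ) × (ℕ → ℝ)) → ℝ≥0∞} (h : ∀ y, 0 ≤ y.1.1 → G y = G' y) :
    stringInt lam μV n G = stringInt lam μV n G' := by
  have hv : ∀ᵐ z ∂(vacLaw lam μV), ∀ i, 0 ≤ z.2 i :=
    Measure.quasiMeasurePreserving_snd.ae (ae_iidSeq_nonneg hV0)
  refine lintegral_congr_ae ?_
  filter_upwards [hv] with z hv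
  have : 0 ≤ (vacOutAt (n + 1) z).1.1 := psum_nonneg hv _
  by_cases hz : z ∈ stringSet n
  · rw [Set.indicator_of_mem hz, Set.indicator_of_mem hz, h _ this]
  · rw [Set.indicator_of_notMem hz, Set.indicator_of_notMem hz]

lemma stringInt_add (n : ℕ) {G G' : (ℝ × ℝ) × ((ℕ → ℝ) × (ℕ → ℝ)) → ℝ≥0∞}
    (hG : Measurable G) :
    stringInt lam μV n (fun y => G y + G' y) = stringInt lam μV n G + stringInt lam μV n G' := by
  simp only [stringInt]
  rw [← lintegral_add_left (measurable_stringSet_indicator n hG)]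
  refine lintegral_congr fun z => ?_
  by_cases hz : z ∈ stringSet n
  · simp only [Set.indicator_of_mem hz]
  · simp only [Set.indicator_of_notMem hz, add_zero]

lemma stringInt_const_mul (n : ℕ) (c : ℝ≥0∞) {G : (ℝ × ℝ) × ((ℕ → ℝ) × (ℕ → ℝ)) → ℝ≥0∞}
    (hG : Measurable G) :
    stringInt lam μV n (fun y => c * G y) = c * stringInt lam μV n G := by
  simp only [stringInt]
  rw [← lintegral_const_mul _ (measurable_stringSet_indicator n hG)]
  refine lintegral_congr fun z => ?_
  by_cases hz : z ∈ stringSet n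
  · simp only [Set.indicator_of_mem hz]
  · simp only [Set.indicator_of_notMem hz, mul_zero]

/-- The two terms on the left belong to the complementary events that the first vacation does or
does not contain an arrival. The additive form avoids truncated subtraction. -/
lemma stringInt_zero_fst (hV0 : μV (Set.Iio 0) = 0) {f : ℝ → ℝ≥0∞} (hf : Measurable f) :
    stringInt lam μV 0 (fun y => f y.1.1)
      + ∫⁻ v, ENNReal.ofReal (Real.exp (-(lam * v))) * f v ∂μV = ∫⁻ v, f v ∂μV := by
  rw [stringInt_zero lam hV0 (by fun_prop)]
  simp only [lintegral_const, measure_univ, mul_one]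
  rw [← lintegral_add_right _ (by fun_prop)]
  refine lintegral_congr_ae ?_
  filter_upwards [ae_nonneg_of_measure_Iio_eq_zero hV0] with v hv
  rw [lintegral_lastEpoch_pos lam hv (g := fun _ => f v) measurable_const,
    lintegral_indicator measurableSet_Iio, lintegral_const, Measure.restrict_apply_univ,
    ← expMeasure_Ici hlam.out hv, ← Set.compl_Iio, mul_comm _ (f v), ← mul_add,
    measure_add_measure_compl measurableSet_Iio, measure_univ, mul_one]

lemma stringInt_zero_snd (hV0 : μV (Set.Iio 0) = 0) {g : ℝ → ℝ≥0∞} (hg : Measurable g) :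
    stringInt lam μV 0 (fun y => g y.1.2)
      = ∫⁻ v, ∫⁻ t, (Set.Iio v).indicator g t ∂(expMeasure lam) ∂μV := by
  rw [stringInt_zero lam hV0 (by fun_prop)]
  simp only [lintegral_const, measure_univ, mul_one]
  refine lintegral_congr_ae ?_
  filter_upwards [ae_nonneg_of_measure_Iio_eq_zero hV0] with v hv
  exact lintegral_lastEpoch_pos lam hv hg

end ConventionalBuffer

end

/-! ### Solving the recursions for the first and second moments of a string -/

noncomputable section

namespace ConventionalBuffer

open scoped ENNReal

variable (lam : ℝ) [hlam : Fact (0 < lam)] {μV : Measure ℝ} [IsProbabilityMeasure μV]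

lemma lintegral_exp_mul_pow {μV : Measure ℝ} (hV0 : μV (Set.Iio 0) = 0) {k : ℕ}
    (hk : Integrable (fun v : ℝ => v ^ k) μV) :
    ∫⁻ v, ENNReal.ofReal (Real.exp (-(lam * v))) * ENNReal.ofReal v ^ k ∂μV
      = ENNReal.ofReal (∫ v, v ^ k * Real.exp (-lam * v) ∂μV) := by
  rw [ofReal_integral_eq_lintegral_ofReal (integrable_pow_mul_exp hV0 hk hlam.out.le)]
  · refine lintegral_congr_ae ?_
    filter_upwards [ae_nonneg_of_measure_Iio_eq_zero hV0] with v hv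
    rw [ENNReal.ofReal_mul (by positivity), ENNReal.ofReal_pow hv, mul_comm, neg_mul]
  · filter_upwards [ae_nonneg_of_measure_Iio_eq_zero hV0] with v hv
    exact mul_nonneg (pow_nonneg hv k) (Real.exp_pos _).le

lemma lintegral_exp (hV0 : μV (Set.Iio 0) = 0) :
    ∫⁻ v, ENNReal.ofReal (Real.exp (-(lam * v))) ∂μV = ENNReal.ofReal (lst μV lam) := by
  have := lintegral_exp_mul_pow lam hV0 (k := 0) (by simp)
  simpa [lst] using this

lemma lintegral_ofReal_pow {μV : Measure ℝ} (hV0 : μV (Set.Iio 0) = 0) {k : ℕ}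
    (hk : Integrable (fun v : ℝ => v ^ k) μV) :
    ∫⁻ v, ENNReal.ofReal v ^ k ∂μV = ENNReal.ofReal (∫ v, v ^ k ∂μV) := by
  rw [ofReal_integral_eq_lintegral_ofReal hk]
  · refine lintegral_congr_ae ?_
    filter_upwards [ae_nonneg_of_measure_Iio_eq_zero hV0] with v hv
    rw [ENNReal.ofReal_pow hv]
  · filter_upwards [ae_nonneg_of_measure_Iio_eq_zero hV0] with v hv
    exact pow_nonneg hv k

lemma integral_pow_mul_exp_nonneg (lam : ℝ) {μV : Measure ℝ} (hV0 : μV (Set.Iio 0) = 0) (k : ℕ) :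
    0 ≤ ∫ v, v ^ k * Real.exp (-lam * v) ∂μV := by
  refine integral_nonneg_of_ae ?_
  filter_upwards [ae_nonneg_of_measure_Iio_eq_zero hV0] with v hv
  exact mul_nonneg (pow_nonneg hv k) (Real.exp_pos _).le

lemma integral_pow_nonneg {μV : Measure ℝ} (hV0 : μV (Set.Iio 0) = 0) (k : ℕ) : 0 ≤ ∫ v, v ^ k ∂μV := by
  refine integral_nonneg_of_ae ?_
  filter_upwards [ae_nonneg_of_measure_Iio_eq_zero hV0] with v hv
  exact pow_nonneg hv k

lemma tsum_stringInt_one (hV0 : μV (Set.Iio 0) = 0) (hVpos : μV (Set.Ioi 0) ≠ 0) :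
    ∑' n, stringInt lam μV n (fun _ => 1) = 1 := by
  rw [← lintegral_vacOut lam hV0 hVpos measurable_const]
  simp

/-- Integrating X + v against the weight e^{-λv} separates the contribution of the skipped vacation
from q times the previous term, where q = V*(λ). The square is treated likewise in
`stringInt_succ_two`. -/
lemma stringInt_succ_one (hV0 : μV (Set.Iio 0) = 0) (hV1 : Integrable (fun v : ℝ => v) μV)
    (n : ℕ) :
    stringInt lam μV (n + 1) (fun y => ENNReal.ofReal y.1.1)
      = ENNReal.ofReal (∫ v, v ^ 1 * Real.exp (-lam * v) ∂μV) * stringInt lam μV n (fun _ => 1)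
        + ENNReal.ofReal (lst μV lam) * stringInt lam μV n (fun y => ENNReal.ofReal y.1.1) := by
  rw [stringInt_succ lam hV0 n (by fun_prop), ← lintegral_exp lam hV0,
    ← lintegral_exp_mul_pow lam hV0 (k := 1) (by simpa using hV1),
    ← lintegral_mul_const _ (by fun_prop), ← lintegral_mul_const _ (by fun_prop),
    ← lintegral_add_left (by fun_prop)]
  refine lintegral_congr_ae ?_
  filter_upwards [ae_nonneg_of_measure_Iio_eq_zero hV0] with v hv
  have h : stringInt lam μV n (fun y => ENNReal.ofReal (y.1.1 + v))
      = stringInt lam μV n (fun y => ENNReal.ofReal y.1.1 + ENNReal.ofReal v * 1) :=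
    stringInt_congr lam hV0 n fun y hy => by rw [ENNReal.ofReal_add hy hv, mul_one]
  rw [h, stringInt_add lam n (by fun_prop), stringInt_const_mul lam n _ measurable_const]
  ring

lemma stringInt_succ_two (hV0 : μV (Set.Iio 0) = 0) (hV1 : Integrable (fun v : ℝ => v) μV)
    (hV2 : Integrable (fun v : ℝ => v ^ 2) μV) (n : ℕ) :
    stringInt lam μV (n + 1) (fun y => ENNReal.ofReal y.1.1 ^ 2)
      = (2 * ENNReal.ofReal (∫ v, v ^ 1 * Real.exp (-lam * v) ∂μV)
          * stringInt lam μV n (fun y => ENNReal.ofReal y.1.1)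
        + ENNReal.ofReal (∫ v, v ^ 2 * Real.exp (-lam * v) ∂μV) * stringInt lam μV n (fun _ => 1))
        + ENNReal.ofReal (lst μV lam) * stringInt lam μV n (fun y => ENNReal.ofReal y.1.1 ^ 2) := by
  rw [stringInt_succ lam hV0 n (by fun_prop), ← lintegral_exp lam hV0,
    ← lintegral_exp_mul_pow lam hV0 (k := 1) (by simpa using hV1),
    ← lintegral_exp_mul_pow lam hV0 (k := 2) hV2, ← lintegral_const_mul _ (by fun_prop),
    ← lintegral_mul_const _ (by fun_prop), ← lintegral_mul_const _ (by fun_prop),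
    ← lintegral_mul_const _ (by fun_prop), ← lintegral_add_left (by fun_prop),
    ← lintegral_add_left (by fun_prop)]
  refine lintegral_congr_ae ?_
  filter_upwards [ae_nonneg_of_measure_Iio_eq_zero hV0] with v hv
  have h : stringInt lam μV n (fun y => ENNReal.ofReal (y.1.1 + v) ^ 2)
      = stringInt lam μV n (fun y => ENNReal.ofReal y.1.1 ^ 2
        + (2 * ENNReal.ofReal v * ENNReal.ofReal y.1.1 + ENNReal.ofReal v ^ 2 * 1)) :=
    stringInt_congr lam hV0 n fun y hy => by rw [ENNReal.ofReal_add hy hv]; ring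
  rw [h, stringInt_add lam n (by fun_prop), stringInt_add lam n (by fun_prop),
    stringInt_const_mul lam n _ measurable_const, stringInt_const_mul lam n _ (by fun_prop)]
  ring

/-- A skipped vacation does not change the age of the packet found at the end, so the recursion is
purely geometric. The summand 0 matches the shape of `tsum_of_linear_recursion`. -/
lemma stringInt_succ_snd (hV0 : μV (Set.Iio 0) = 0) {g : ℝ → ℝ≥0∞} (hg : Measurable g) (n : ℕ) :
    stringInt lam μV (n + 1) (fun y => g y.1.2)
      = 0 + ENNReal.ofReal (lst μV lam) * stringInt lam μV n (fun y => g y.1.2) := by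
  rw [stringInt_succ lam hV0 n (by fun_prop), ← lintegral_exp lam hV0,
    ← lintegral_mul_const _ (by fun_prop), zero_add]

lemma ofReal_lst_lt_one (hV0 : μV (Set.Iio 0) = 0) (hVpos : μV (Set.Ioi 0) ≠ 0) :
    ENNReal.ofReal (lst μV lam) < 1 := by
  rw [← ENNReal.ofReal_one]
  exact (ENNReal.ofReal_lt_ofReal_iff one_pos).2 (lst_lt_one hV0 hVpos hlam.out)

/-- Strings of one vacation contribute E[V] - E[V e^{-λV}], and the inhomogeneous terms sum to E[V
e^{-λV}]. Together they give E[X] = E[V] + q E[X]. -/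
lemma lintegral_vacLength (hV0 : μV (Set.Iio 0) = 0) (hVpos : μV (Set.Ioi 0) ≠ 0)
    (hV1 : Integrable (fun v : ℝ => v) μV) :
    ∫⁻ z, ENNReal.ofReal (vacOut z).1.1 ∂(vacLaw lam μV)
      = ENNReal.ofReal ((∫ v, v ∂μV) / (1 - lst μV lam)) := by
  rw [lintegral_vacOut lam hV0 hVpos (G := fun y => ENNReal.ofReal y.1.1) (by fun_prop)]
  have hV1' : Integrable (fun v : ℝ => v ^ 1) μV := by simpa using hV1
  have hm := lintegral_ofReal_pow hV0 hV1'
  have h0 := stringInt_zero_fst lam hV0 (f := fun v => ENNReal.ofReal v) (by fun_prop)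
  have he := lintegral_exp_mul_pow lam hV0 hV1'
  simp only [pow_one] at hm he
  rw [hm, he] at h0
  obtain ⟨h1, h2⟩ := tsum_of_linear_recursion
    (b := fun n => stringInt lam μV n fun y => ENNReal.ofReal y.1.1)
    (d := fun n => ENNReal.ofReal (∫ v, v ^ 1 * Real.exp (-lam * v) ∂μV)
      * stringInt lam μV n (fun _ => 1)) (ofReal_lst_lt_one lam hV0 hVpos)
    (ne_top_of_le_ne_top ENNReal.ofReal_ne_top (le_self_add.trans_eq h0))
    (by rw [ENNReal.tsum_mul_left, tsum_stringInt_one lam hV0 hVpos]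
        exact ENNReal.mul_ne_top ENNReal.ofReal_ne_top ENNReal.one_ne_top)
    (stringInt_succ_one lam hV0 hV1)
  rw [ENNReal.tsum_mul_left, tsum_stringInt_one lam hV0 hVpos, mul_one] at h2
  simp only [pow_one] at h2
  rw [h0] at h2
  refine eq_ofReal_of_linear h1 ?_ (lst_nonneg _ _) (lst_lt_one hV0 hVpos hlam.out) h2
  simpa using integral_pow_nonneg hV0 1

/-- The same cancellation of E[V² e^{-λV}] leaves E[X²] = E[V²] + 2 E[V e^{-λV}] E[X] + q E[X²],
into which the first moment is inserted. -/
lemma lintegral_vacLength_sq (hV0 : μV (Set.Iio 0) = 0) (hVpos : μV (Set.Ioi 0) ≠ 0)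
    (hV1 : Integrable (fun v : ℝ => v) μV) (hV2 : Integrable (fun v : ℝ => v ^ 2) μV) :
    ∫⁻ z, ENNReal.ofReal (vacOut z).1.1 ^ 2 ∂(vacLaw lam μV)
      = ENNReal.ofReal (((∫ v, v ^ 2 ∂μV) + 2 * (∫ v, v * Real.exp (-lam * v) ∂μV)
          * ((∫ v, v ∂μV) / (1 - lst μV lam))) / (1 - lst μV lam)) := by
  have hA := lintegral_vacLength lam hV0 hVpos hV1
  rw [lintegral_vacOut lam hV0 hVpos (G := fun y => ENNReal.ofReal y.1.1) (by fun_prop)] at hA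
  rw [lintegral_vacOut lam hV0 hVpos (G := fun y => ENNReal.ofReal y.1.1 ^ 2) (by fun_prop)]
  have hq := lst_lt_one hV0 hVpos hlam.out
  have hm := lintegral_ofReal_pow hV0 hV2
  have h0 := stringInt_zero_fst lam hV0 (f := fun v => ENNReal.ofReal v ^ 2) (by fun_prop)
  have he := lintegral_exp_mul_pow lam hV0 hV2
  rw [hm, he] at h0
  have hf1 : 0 ≤ ∫ v, v * Real.exp (-lam * v) ∂μV := by
    simpa using integral_pow_mul_exp_nonneg lam hV0 1
  have hEX : 0 ≤ (∫ v, v ∂μV) / (1 - lst μV lam) :=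
    div_nonneg (by simpa using integral_pow_nonneg hV0 1) (by linarith)
  have hd : ∑' n, (2 * ENNReal.ofReal (∫ v, v ^ 1 * Real.exp (-lam * v) ∂μV)
          * stringInt lam μV n (fun y => ENNReal.ofReal y.1.1)
        + ENNReal.ofReal (∫ v, v ^ 2 * Real.exp (-lam * v) ∂μV) * stringInt lam μV n (fun _ => 1))
      = ENNReal.ofReal (2 * (∫ v, v * Real.exp (-lam * v) ∂μV)
          * ((∫ v, v ∂μV) / (1 - lst μV lam)))
        + ENNReal.ofReal (∫ v, v ^ 2 * Real.exp (-lam * v) ∂μV) := by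
    rw [ENNReal.tsum_add, ENNReal.tsum_mul_left, ENNReal.tsum_mul_left,
      tsum_stringInt_one lam hV0 hVpos, mul_one, hA, ENNReal.ofReal_mul (by positivity),
      ENNReal.ofReal_mul zero_le_two]
    simp
  obtain ⟨h1, h2⟩ := tsum_of_linear_recursion
    (b := fun n => stringInt lam μV n fun y => ENNReal.ofReal y.1.1 ^ 2)
    (ofReal_lst_lt_one lam hV0 hVpos)
    (ne_top_of_le_ne_top ENNReal.ofReal_ne_top (le_self_add.trans_eq h0))
    (by rw [hd]; exact ENNReal.add_ne_top.2 ⟨ENNReal.ofReal_ne_top, ENNReal.ofReal_ne_top⟩)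
    (stringInt_succ_two lam hV0 hV1 hV2)
  rw [hd, add_comm (ENNReal.ofReal (2 * _ * _)), ← add_assoc, h0,
    ← ENNReal.ofReal_add (integral_pow_nonneg hV0 2) (by positivity)] at h2
  exact eq_ofReal_of_linear h1 (add_nonneg (integral_pow_nonneg hV0 2) (by positivity))
    (lst_nonneg _ _) hq h2

/-- The contribution of single vacations is E[Φ(V) - Φ(0)], and the geometric recursion divides it
by 1 - q. Nonnegativity of the value is recorded because it is needed to pass from the extended
integral to the real one. -/
lemma lintegral_vacWait (hV0 : μV (Set.Iio 0) = 0) (hVpos : μV (Set.Ioi 0) ≠ 0)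
    {φ Φ : ℝ → ℝ} (hφ : Continuous φ) (hφ0 : ∀ t, 0 ≤ t → 0 ≤ φ t)
    (hΦ : ∀ t, HasDerivAt Φ (φ t * (lam * Real.exp (-(lam * t)))) t)
    (hi : Integrable (fun v => Φ v - Φ 0) μV) :
    0 ≤ (∫ v, (Φ v - Φ 0) ∂μV) / (1 - lst μV lam) ∧
      ∫⁻ z, ENNReal.ofReal (φ (vacOut z).1.2) ∂(vacLaw lam μV)
        = ENNReal.ofReal ((∫ v, (Φ v - Φ 0) ∂μV) / (1 - lst μV lam)) := by
  have hmφ : Measurable fun t => ENNReal.ofReal (φ t) := hφ.measurable.ennreal_ofReal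
  rw [lintegral_vacOut lam hV0 hVpos (G := fun y => ENNReal.ofReal (φ y.1.2)) (by fun_prop)]
  have hq := lst_lt_one hV0 hVpos hlam.out
  have hmono : MonotoneOn Φ (Set.Ici 0) := by
    refine monotoneOn_of_deriv_nonneg (convex_Ici 0)
      (fun t _ => (hΦ t).continuousAt.continuousWithinAt)
      (fun t _ => (hΦ t).differentiableAt.differentiableWithinAt) fun t ht => ?_
    rw [interior_Ici] at ht
    rw [(hΦ t).deriv]
    exact mul_nonneg (hφ0 t (le_of_lt ht)) (mul_nonneg hlam.out.le (Real.exp_pos _).le)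
  have hnn : 0 ≤ᵐ[μV] fun v => Φ v - Φ 0 := by
    filter_upwards [ae_nonneg_of_measure_Iio_eq_zero hV0] with v hv
    exact sub_nonneg.2 (hmono (Set.mem_Ici.2 le_rfl) hv hv)
  have h0 : stringInt lam μV 0 (fun y => ENNReal.ofReal (φ y.1.2))
      = ENNReal.ofReal (∫ v, (Φ v - Φ 0) ∂μV) := by
    rw [stringInt_zero_snd lam hV0 hmφ, ofReal_integral_eq_lintegral_ofReal hi hnn]
    refine lintegral_congr_ae ?_
    filter_upwards [ae_nonneg_of_measure_Iio_eq_zero hV0] with v hv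
    exact lintegral_Iio_expMeasure hlam.out hv hφ hφ0 hΦ
  obtain ⟨h1, h2⟩ := tsum_of_linear_recursion
    (b := fun n => stringInt lam μV n fun y => ENNReal.ofReal (φ y.1.2)) (d := fun _ => 0)
    (ofReal_lst_lt_one lam hV0 hVpos)
    (by rw [h0]; exact ENNReal.ofReal_ne_top) (by simp) (stringInt_succ_snd lam hV0 hmφ)
  rw [tsum_zero, add_zero, h0] at h2
  exact ⟨div_nonneg (integral_nonneg_of_ae hnn) (by linarith),
    eq_ofReal_of_linear h1 (integral_nonneg_of_ae hnn) (lst_nonneg _ _) hq h2⟩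

lemma ae_vacOut_nonneg (hV0 : μV (Set.Iio 0) = 0) :
    ∀ᵐ z ∂(vacLaw lam μV), 0 ≤ (vacOut z).1.1 ∧ 0 ≤ (vacOut z).1.2 := by
  have hv : ∀ᵐ z ∂(vacLaw lam μV), ∀ i, 0 ≤ z.2 i :=
    Measure.quasiMeasurePreserving_snd.ae (ae_iidSeq_nonneg hV0)
  filter_upwards [hv] with z hv
  exact ⟨psum_nonneg hv _, sub_nonneg.2 (lastEpoch_le z.1 (psum_nonneg hv _))⟩

lemma measurable_vacLength : Measurable fun z => (vacOut z).1.1 := by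
  exact measurable_fst.comp (measurable_fst.comp measurable_vacOut)

lemma measurable_vacWait : Measurable fun z => (vacOut z).1.2 := by
  exact measurable_snd.comp (measurable_fst.comp measurable_vacOut)

/-- First moment of the length of a string of vacations. -/
lemma integral_vacLength (hV0 : μV (Set.Iio 0) = 0) (hVpos : μV (Set.Ioi 0) ≠ 0)
    (hV1 : Integrable (fun v : ℝ => v) μV) :
    Integrable (fun z => (vacOut z).1.1) (vacLaw lam μV) ∧
      ∫ z, (vacOut z).1.1 ∂(vacLaw lam μV) = (∫ v, v ∂μV) / (1 - lst μV lam) := by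
  refine integrable_and_integral_eq measurable_vacLength.aestronglyMeasurable ?_ ?_
    (lintegral_vacLength lam hV0 hVpos hV1)
  · filter_upwards [ae_vacOut_nonneg lam hV0] with z hz using hz.1
  · exact div_nonneg (by simpa using integral_pow_nonneg hV0 1)
      (by linarith [lst_lt_one hV0 hVpos hlam.out])

/-- Second moment of the length of a string of vacations. -/
lemma integral_vacLength_sq (hV0 : μV (Set.Iio 0) = 0) (hVpos : μV (Set.Ioi 0) ≠ 0)
    (hV1 : Integrable (fun v : ℝ => v) μV) (hV2 : Integrable (fun v : ℝ => v ^ 2) μV) :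
    Integrable (fun z => (vacOut z).1.1 ^ 2) (vacLaw lam μV) ∧
      ∫ z, (vacOut z).1.1 ^ 2 ∂(vacLaw lam μV)
        = ((∫ v, v ^ 2 ∂μV) + 2 * (∫ v, v * Real.exp (-lam * v) ∂μV)
          * ((∫ v, v ∂μV) / (1 - lst μV lam))) / (1 - lst μV lam) := by
  have hq := lst_lt_one hV0 hVpos hlam.out
  refine integrable_and_integral_eq 
    (measurable_vacLength.pow_const 2).aestronglyMeasurable ?_ ?_ ?_
  · filter_upwards with z using sq_nonneg _
  · have h1 : 0 ≤ ∫ v, v * Real.exp (-lam * v) ∂μV := by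
      simpa using integral_pow_mul_exp_nonneg lam hV0 1
    have h2 : 0 ≤ ∫ v, v ∂μV := by simpa using integral_pow_nonneg hV0 1
    have h3 := integral_pow_nonneg hV0 2
    have h4 : 0 ≤ 1 - lst μV lam := by linarith
    positivity
  · rw [← lintegral_vacLength_sq lam hV0 hVpos hV1 hV2]
    refine lintegral_congr_ae ?_
    filter_upwards [ae_vacOut_nonneg lam hV0] with z hz
    rw [ENNReal.ofReal_pow hz.1]

/-- First moment of the waiting time of the packet found at the end of a string of vacations. -/
lemma integral_vacWait (hV0 : μV (Set.Iio 0) = 0) (hVpos : μV (Set.Ioi 0) ≠ 0)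
    (hV1 : Integrable (fun v : ℝ => v) μV) :
    Integrable (fun z => (vacOut z).1.2) (vacLaw lam μV) ∧
      ∫ z, (vacOut z).1.2 ∂(vacLaw lam μV)
        = 1 / lam - (∫ v, v * Real.exp (-lam * v) ∂μV) / (1 - lst μV lam) := by
  have hl := hlam.out
  have hq := lst_lt_one hV0 hVpos hl
  have hi0 : Integrable (fun v : ℝ => Real.exp (-lam * v)) μV := by
    simpa using integrable_pow_mul_exp hV0 (k := 0) (by simp) hl.le
  have hi1 : Integrable (fun v : ℝ => v * Real.exp (-lam * v)) μV := by
    simpa using integrable_pow_mul_exp hV0 (k := 1) (by simpa using hV1) hl.le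
  -- A primitive of t λ e^{-λt}, by integration by parts.
  set Φ : ℝ → ℝ := fun t => -(t * Real.exp (-lam * t)) - Real.exp (-lam * t) / lam with hΦ
  have hder : ∀ t, HasDerivAt Φ (t * (lam * Real.exp (-(lam * t)))) t := by
    intro t
    have he : HasDerivAt (fun t => Real.exp (-lam * t)) (Real.exp (-lam * t) * (-lam * 1)) t :=
      ((hasDerivAt_id t).const_mul (-lam)).exp
    convert! ((hasDerivAt_id t).mul he).neg.sub (he.div_const lam) using 1
    simp only [id, neg_mul]
    field_simp
    ring
  have hi : Integrable (fun v => Φ v - Φ 0) μV :=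
    (hi1.neg.sub (hi0.div_const lam)).sub (integrable_const _)
  have hval : ∫ v, (Φ v - Φ 0) ∂μV
      = (1 - lst μV lam) / lam - ∫ v, v * Real.exp (-lam * v) ∂μV := by
    have hi2 : Integrable (fun v : ℝ => -(v * Real.exp (-lam * v))) μV := hi1.neg
    have hiΦ : Integrable Φ μV := hi2.sub (hi0.div_const lam)
    rw [integral_sub hiΦ (integrable_const _)]
    simp only [hΦ]
    rw [integral_sub hi2 (hi0.div_const lam), integral_neg, integral_div]
    simp only [integral_const, probReal_univ, lst]
    simp
    ring
  have hcalc : (∫ v, (Φ v - Φ 0) ∂μV) / (1 - lst μV lam)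
      = 1 / lam - (∫ v, v * Real.exp (-lam * v) ∂μV) / (1 - lst μV lam) := by
    have : 1 - lst μV lam ≠ 0 := by linarith
    rw [hval]
    field_simp
  obtain ⟨hmain0, hmain⟩ := lintegral_vacWait lam hV0 hVpos (φ := fun t => t) continuous_id (fun t ht => ht)
    hder hi
  rw [hcalc] at hmain0 hmain
  have hnn : 0 ≤ᵐ[vacLaw lam μV] fun z => (vacOut z).1.2 := by
    filter_upwards [ae_vacOut_nonneg lam hV0] with z hz using hz.2
  refine integrable_and_integral_eq measurable_vacWait.aestronglyMeasurable hnn hmain0 hmain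

/-- Second moment of the waiting time of the packet found at the end of a string of vacations. -/
lemma integral_vacWait_sq (hV0 : μV (Set.Iio 0) = 0) (hVpos : μV (Set.Ioi 0) ≠ 0)
    (hV1 : Integrable (fun v : ℝ => v) μV) (hV2 : Integrable (fun v : ℝ => v ^ 2) μV) :
    Integrable (fun z => (vacOut z).1.2 ^ 2) (vacLaw lam μV) ∧
      ∫ z, (vacOut z).1.2 ^ 2 ∂(vacLaw lam μV)
        = 2 / lam * (1 / lam - (∫ v, v * Real.exp (-lam * v) ∂μV) / (1 - lst μV lam))
          - (∫ v, v ^ 2 * Real.exp (-lam * v) ∂μV) / (1 - lst μV lam) := by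
  have hl := hlam.out
  have hq := lst_lt_one hV0 hVpos hl
  have hi0 : Integrable (fun v : ℝ => Real.exp (-lam * v)) μV := by
    simpa using integrable_pow_mul_exp hV0 (k := 0) (by simp) hl.le
  have hi1 : Integrable (fun v : ℝ => v * Real.exp (-lam * v)) μV := by
    simpa using integrable_pow_mul_exp hV0 (k := 1) (by simpa using hV1) hl.le
  have hi2 : Integrable (fun v : ℝ => v ^ 2 * Real.exp (-lam * v)) μV :=
    integrable_pow_mul_exp hV0 hV2 hl.le
  -- A primitive of t² λ e^{-λt}, by integrating by parts twice.
  set Φ : ℝ → ℝ := fun t => -(t ^ 2 * Real.exp (-lam * t)) - 2 / lam * (t * Real.exp (-lam * t))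
    - 2 / lam ^ 2 * Real.exp (-lam * t) with hΦ
  have hder : ∀ t, HasDerivAt Φ (t ^ 2 * (lam * Real.exp (-(lam * t)))) t := by
    intro t
    have he : HasDerivAt (fun t => Real.exp (-lam * t)) (Real.exp (-lam * t) * (-lam * 1)) t :=
      ((hasDerivAt_id t).const_mul (-lam)).exp
    convert! ((((hasDerivAt_id t).pow 2).mul he).neg.sub
      (((hasDerivAt_id t).mul he).const_mul (2 / lam))).sub (he.const_mul (2 / lam ^ 2)) using 1
    simp only [id, neg_mul, Pi.pow_apply]
    field_simp
    push_cast
    ring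
  have hi2' : Integrable (fun v : ℝ => -(v ^ 2 * Real.exp (-lam * v))) μV := hi2.neg
  have hi : Integrable (fun v => Φ v - Φ 0) μV :=
    ((hi2'.sub (hi1.const_mul _)).sub (hi0.const_mul _)).sub (integrable_const _)
  have hval : ∫ v, (Φ v - Φ 0) ∂μV = 2 / lam ^ 2 * (1 - lst μV lam)
      - 2 / lam * (∫ v, v * Real.exp (-lam * v) ∂μV) - ∫ v, v ^ 2 * Real.exp (-lam * v) ∂μV := by
    have hi3 : Integrable (fun t : ℝ => -(t ^ 2 * Real.exp (-lam * t))
        - 2 / lam * (t * Real.exp (-lam * t))) μV := hi2'.sub (hi1.const_mul _)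
    have hiΦ : Integrable Φ μV := hi3.sub (hi0.const_mul _)
    rw [integral_sub hiΦ (integrable_const _)]
    simp only [hΦ]
    rw [integral_sub hi3 (hi0.const_mul _),
      integral_sub hi2' (hi1.const_mul _), integral_neg, integral_const_mul, integral_const_mul]
    simp only [integral_const, probReal_univ, lst]
    simp
    ring
  have hcalc : (∫ v, (Φ v - Φ 0) ∂μV) / (1 - lst μV lam)
      = 2 / lam * (1 / lam - (∫ v, v * Real.exp (-lam * v) ∂μV) / (1 - lst μV lam))
          - (∫ v, v ^ 2 * Real.exp (-lam * v) ∂μV) / (1 - lst μV lam) := by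
    have : 1 - lst μV lam ≠ 0 := by linarith
    rw [hval]
    field_simp
  obtain ⟨hmain0, hmain⟩ := lintegral_vacWait lam hV0 hVpos (φ := fun t => t ^ 2) (continuous_pow 2)
    (fun t _ => sq_nonneg t) hder hi
  rw [hcalc] at hmain0 hmain
  refine integrable_and_integral_eq (measurable_vacWait.pow_const 2).aestronglyMeasurable
    (Eventually.of_forall fun _ => sq_nonneg _) hmain0 hmain

end ConventionalBuffer

end

noncomputable section

namespace ConventionalBuffer

open scoped ENNReal

/-! ### Regeneration and independent cycles -/

section Regeneration

variable {S E : Type*} [MeasurableSpace S] [MeasurableSpace E] {Q : Measure S}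
  [IsProbabilityMeasure Q] {ξ : S → E} {θ : S → S}

/-- If the first output is independent of the rest of the system, which has the original law,
then the successive outputs are independent and identically distributed. -/
lemma map_outputs_eq_iidSeq (hξ : Measurable ξ) (hθ : Measurable θ)
    (hreg : ∀ {g : E → ℝ≥0∞} {F : S → ℝ≥0∞}, Measurable g → Measurable F →
      ∫⁻ p, g (ξ p) * F (θ p) ∂Q = (∫⁻ p, g (ξ p) ∂Q) * ∫⁻ p, F p ∂Q) [IsProbabilityMeasure (Q.map ξ)] :
    Q.map (fun p l => ξ (θ^[l] p)) = iidSeq (Q.map ξ) := by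
  have hmeas : Measurable fun (p : S) (l : ℕ) => ξ (θ^[l] p) :=
    measurable_pi_iff.2 fun l => hξ.comp (hθ.iterate l)
  have hset : ∀ (N : ℕ) (t : ℕ → Set E), (∀ i, MeasurableSet (t i)) →
      MeasurableSet {p | ∀ i < N, ξ (θ^[i] p) ∈ t i} := by
    intro N t ht
    have : {p | ∀ i < N, ξ (θ^[i] p) ∈ t i} = ⋂ i, ⋂ _ : i < N, (fun p => ξ (θ^[i] p)) ⁻¹' t i := by
      ext p; simp
    rw [this]
    exact MeasurableSet.iInter fun i => MeasurableSet.iInter fun _ =>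
      (hξ.comp (hθ.iterate i)) (ht i)
  have hmain : ∀ (N : ℕ) (t : ℕ → Set E), (∀ i, MeasurableSet (t i)) →
      Q {p | ∀ i < N, ξ (θ^[i] p) ∈ t i} = ∏ i ∈ Finset.range N, Q.map ξ (t i) := by
    intro N
    induction N with
    | zero => intro t _; simp
    | succ N ih =>
      intro t ht
      have hm := hset N (fun i => t (i + 1)) fun i => ht _
      have h := hreg (g := (t 0).indicator 1)
        (F := {p | ∀ i < N, ξ (θ^[i] p) ∈ t (i + 1)}.indicator 1)
        (measurable_one.indicator (ht 0)) (measurable_one.indicator hm)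
      rw [lintegral_indicator_one hm, ih (fun i => t (i + 1)) fun i => ht _,
        ← lintegral_map (f := (t 0).indicator 1) (measurable_one.indicator (ht 0)) hξ,
        lintegral_indicator_one (ht 0), mul_comm,
        ← Finset.prod_range_succ' fun i => Q.map ξ (t i)] at h
      rw [← h, ← lintegral_indicator_one (hset (N + 1) t ht)]
      refine lintegral_congr fun p => ?_
      have hiff : p ∈ {p | ∀ i < N + 1, ξ (θ^[i] p) ∈ t i} ↔
          ξ p ∈ t 0 ∧ θ p ∈ {p | ∀ i < N, ξ (θ^[i] p) ∈ t (i + 1)} := by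
        simp only [Set.mem_ofPred_eq]
        constructor
        · exact fun h => ⟨h 0 N.succ_pos, fun i hi => by
            simpa using h (i + 1) (Nat.succ_lt_succ hi)⟩
        · rintro ⟨h0, h1⟩ i hi
          cases i with
          | zero => exact h0
          | succ i => simpa using h1 i (Nat.lt_of_succ_lt_succ hi)
      by_cases h0 : ξ p ∈ t 0
      · by_cases h1 : θ p ∈ {p | ∀ i < N, ξ (θ^[i] p) ∈ t (i + 1)}
        · rw [Set.indicator_of_mem (hiff.2 ⟨h0, h1⟩), Set.indicator_of_mem h0,
            Set.indicator_of_mem h1]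
          simp
        · rw [Set.indicator_of_notMem fun h => h1 (hiff.1 h).2, Set.indicator_of_notMem h1, mul_zero]
      · rw [Set.indicator_of_notMem fun h => h0 (hiff.1 h).1, Set.indicator_of_notMem h0, zero_mul]
  refine eq_iidSeq _ fun N t ht => ?_
  rw [Measure.map_apply hmeas, ← hmain N t ht]
  · rfl
  · have : {x : ℕ → E | ∀ i < N, x i ∈ t i} = Set.pi (Finset.range N) t := by
      ext x; simp [Set.mem_pi]
    rw [this]
    exact MeasurableSet.pi (Finset.range N).countable_toSet fun i _ => ht i

end Regeneration

/-! ### The cycles of the buffer system -/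

/-- Interarrival times, vacation times and processing times. -/
abbrev InputSpace : Type := ((ℕ → ℝ) × (ℕ → ℝ)) × (ℕ → ℝ)

/-- The length of the string of vacations, the age at its end of the packet that is then served,
and the processing time, for the first service cycle. -/
def cycleOut (p : InputSpace) : (ℝ × ℝ) × ℝ := ((vacOut p.1).1, p.2 0)

/-- The input seen from the end of the first service cycle. -/
def cycleNext (p : InputSpace) : InputSpace :=
  ((elapse (p.2 0) (vacOut p.1).2.1, (vacOut p.1).2.2), seqTail p.2)

@[fun_prop]
lemma measurable_cycleOut : Measurable cycleOut :=
  ((measurable_fst.comp measurable_vacOut).comp measurable_fst).prodMk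
    ((measurable_pi_apply 0).comp measurable_snd)

@[fun_prop]
lemma measurable_cycleNext : Measurable cycleNext := by
  have h : Measurable fun p : InputSpace => vacOut p.1 := measurable_vacOut.comp measurable_fst
  have h1 : Measurable fun p : InputSpace => (p.2 0, (vacOut p.1).2.1) :=
    ((measurable_pi_apply 0).comp measurable_snd).prodMk
      (measurable_fst.comp (measurable_snd.comp h))
  exact ((measurable_elapse.comp h1).prodMk (measurable_snd.comp (measurable_snd.comp h))).prodMk
    (measurable_seqTail.comp measurable_snd)

variable (lam : ℝ) [hlam : Fact (0 < lam)] (μH μV : Measure ℝ) [IsProbabilityMeasure μH]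
  [IsProbabilityMeasure μV]

/-- The law of the input. -/
abbrev inputLaw : Measure InputSpace := (vacLaw lam μV).prod (iidSeq μH)

lemma lintegral_inputLaw {F : InputSpace → ℝ≥0∞} (hF : Measurable F) :
    ∫⁻ p, F p ∂(inputLaw lam μH μV) = ∫⁻ h₀, ∫⁻ h, ∫⁻ z, F (z, seqCons (h₀, h))
      ∂(vacLaw lam μV) ∂(iidSeq μH) ∂μH := by
  have hm : Measurable fun y : ℝ × (ℕ → ℝ) => ∫⁻ z, F (z, seqCons y) ∂(vacLaw lam μV) :=
    (hF.comp (measurable_fst.prodMk (measurable_seqCons.comp measurable_snd))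
      (f := fun w : ((ℕ → ℝ) × (ℕ → ℝ)) × (ℝ × (ℕ → ℝ)) => (w.1, seqCons w.2))).lintegral_prod_left'
  rw [inputLaw, lintegral_prod_symm' _ hF, ← lintegral_head_tail _ hm]
  refine lintegral_congr fun v => ?_
  rw [seqCons_head_seqTail]

variable {μH μV}

/-- Packets that arrive during processing are rejected; by `map_elapse`, discarding them leaves the
law of the remaining input unchanged. -/
lemma lintegral_elapse_vacLaw {d : ℝ} (hd : 0 ≤ d) {F : (ℕ → ℝ) × (ℕ → ℝ) → ℝ≥0∞}
    (hF : Measurable F) :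
    ∫⁻ z, F (elapse d z.1, z.2) ∂(vacLaw lam μV) = ∫⁻ z, F z ∂(vacLaw lam μV) := by
  have hm : Measurable (elapse d) :=
    measurable_elapse.comp (f := fun x : ℕ → ℝ => (d, x)) (by fun_prop)
  rw [vacLaw, lintegral_prod_symm' _ hF, lintegral_prod_symm'
    (f := fun z : (ℕ → ℝ) × (ℕ → ℝ) => F (elapse d z.1, z.2))
    (hF.comp ((hm.comp measurable_fst).prodMk measurable_snd))]
  refine lintegral_congr fun v => ?_
  conv_rhs => rw [← map_elapse lam hd]
  rw [lintegral_map (by fun_prop) hm]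

/-- The first service cycle is independent of what comes afterwards. -/
lemma lintegral_cycle_mul (hH0 : μH (Set.Iio 0) = 0) (hV0 : μV (Set.Iio 0) = 0)
    (hVpos : μV (Set.Ioi 0) ≠ 0) {g : (ℝ × ℝ) × ℝ → ℝ≥0∞} {F : InputSpace → ℝ≥0∞}
    (hg : Measurable g) (hF : Measurable F) :
    ∫⁻ p, g (cycleOut p) * F (cycleNext p) ∂(inputLaw lam μH μV)
      = (∫⁻ p, g (cycleOut p) ∂(inputLaw lam μH μV)) * ∫⁻ p, F p ∂(inputLaw lam μH μV) := by
  have hgm : Measurable fun h₀ => ∫⁻ z, g ((vacOut z).1, h₀) ∂(vacLaw lam μV) :=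
    (hg.comp (((measurable_fst.comp measurable_vacOut).comp measurable_fst).prodMk measurable_snd)
      (f := fun w : ((ℕ → ℝ) × (ℕ → ℝ)) × ℝ => ((vacOut w.1).1, w.2))).lintegral_prod_left'
  have hF' : ∫⁻ p, F p ∂(inputLaw lam μH μV) = ∫⁻ h, ∫⁻ z, F (z, h)
      ∂(vacLaw lam μV) ∂(iidSeq μH) := lintegral_prod_symm' _ hF
  have hgout : Measurable fun p => g (cycleOut p) := hg.comp measurable_cycleOut
  have hFnext : Measurable fun p => F (cycleNext p) := hF.comp measurable_cycleNext
  have hprod : Measurable fun p => g (cycleOut p) * F (cycleNext p) := hgout.mul hFnext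
  rw [lintegral_inputLaw lam μH μV hprod, lintegral_inputLaw lam μH μV hgout]
  have e1 : ∀ h₀ : ℝ, ∫⁻ h, ∫⁻ z, g (cycleOut (z, seqCons (h₀, h)))
      ∂(vacLaw lam μV) ∂(iidSeq μH) = ∫⁻ z, g ((vacOut z).1, h₀) ∂(vacLaw lam μV) := by
    intro h₀
    simp only [cycleOut, seqCons_zero, lintegral_const, measure_univ, mul_one]
  simp only [e1]
  rw [← lintegral_mul_const _ hgm]
  refine lintegral_congr_ae ?_
  filter_upwards [ae_nonneg_of_measure_Iio_eq_zero hH0] with h₀ hh₀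
  rw [hF', ← lintegral_const_mul _ hF.lintegral_prod_left']
  refine lintegral_congr fun h => ?_
  have hm : Measurable (elapse h₀) :=
    measurable_elapse.comp (f := fun x : ℕ → ℝ => (h₀, x)) (by fun_prop)
  -- For a fixed processing time `h₀` the cycle ends in two stages: regeneration at the end of the
  -- string, then a further lapse of `h₀`.
  have h1 := lintegral_vacOut_mul lam hV0 hVpos (g := fun y => g (y, h₀)) (by fun_prop)
    (F := fun z => F ((elapse h₀ z.1, z.2), h))
    (hF.comp (((hm.comp measurable_fst).prodMk measurable_snd).prodMk measurable_const))
  rw [lintegral_elapse_vacLaw lam hh₀ (F := fun z => F (z, h)) (by fun_prop)] at h1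
  exact h1

/-- The law of the quantities of one service cycle. -/
def cycleLaw (lam : ℝ) [Fact (0 < lam)] (μH μV : Measure ℝ) [IsProbabilityMeasure μH]
    [IsProbabilityMeasure μV] : Measure ((ℝ × ℝ) × ℝ) :=
  (inputLaw lam μH μV).map cycleOut

instance : IsProbabilityMeasure (cycleLaw lam μH μV) :=
  Measure.isProbabilityMeasure_map measurable_cycleOut.aemeasurable

lemma map_cycles (hH0 : μH (Set.Iio 0) = 0) (hV0 : μV (Set.Iio 0) = 0)
    (hVpos : μV (Set.Ioi 0) ≠ 0) :
    (inputLaw lam μH μV).map (fun p l => cycleOut (cycleNext^[l] p))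
      = iidSeq (cycleLaw lam μH μV) := by
  have : IsProbabilityMeasure ((inputLaw lam μH μV).map cycleOut) :=
    Measure.isProbabilityMeasure_map measurable_cycleOut.aemeasurable
  exact map_outputs_eq_iidSeq measurable_cycleOut measurable_cycleNext
    (fun hg hF => lintegral_cycle_mul lam hH0 hV0 hVpos hg hF)

lemma cycleLaw_eq_prod :
    cycleLaw lam μH μV = ((vacLaw lam μV).map fun z => (vacOut z).1).prod μH := by
  have hm : Measurable fun z => (vacOut z).1 := measurable_fst.comp measurable_vacOut
  conv_rhs => rw [← map_head μH]
  rw [Measure.map_prod_map _ _ hm (measurable_pi_apply 0)]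
  rfl

/-! ### The input on a probability space -/

/-- The input of the system as a random element of the input space. -/
def inputOf {Ω : Type*} (T H V : ℕ → Ω → ℝ) (ω : Ω) : InputSpace :=
  ((fun n => T n ω, fun n => V n ω), fun n => H n ω)

lemma measurable_inputOf {Ω : Type*} [MeasurableSpace Ω] {T H V : ℕ → Ω → ℝ}
    (hT : ∀ n, Measurable (T n)) (hH : ∀ n, Measurable (H n)) (hV : ∀ n, Measurable (V n)) :
    Measurable (inputOf T H V) :=
  ((measurable_pi_iff.2 hT).prodMk (measurable_pi_iff.2 hV)).prodMk (measurable_pi_iff.2 hH)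

/-- Join the three input sequences to one family. -/
def joinInput (p : InputSpace) : ℕ ⊕ ℕ ⊕ ℕ → ℝ := Sum.elim p.1.1 (Sum.elim p.2 p.1.2)

lemma measurable_joinInput : Measurable joinInput := by
  refine measurable_pi_iff.2 fun i => ?_
  rcases i with i | i | i
  · exact (measurable_pi_apply i).comp (measurable_fst.comp measurable_fst)
  · exact (measurable_pi_apply i).comp measurable_snd
  · exact (measurable_pi_apply i).comp (measurable_snd.comp measurable_fst)

lemma map_joinInput (μ : ℕ ⊕ ℕ ⊕ ℕ → Measure ℝ) [∀ i, IsProbabilityMeasure (μ i)]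
    (hT : ∀ i, μ (Sum.inl i) = expMeasure lam) (hH : ∀ i, μ (Sum.inr (Sum.inl i)) = μH)
    (hV : ∀ i, μ (Sum.inr (Sum.inr i)) = μV) :
    (inputLaw lam μH μV).map joinInput = Measure.infinitePi μ := by
  refine Measure.eq_infinitePi _ fun s t ht => ?_
  have hset : joinInput ⁻¹' (Set.pi s t)
      = (Set.pi s.toLeft (fun i => t (Sum.inl i)) ×ˢ
          Set.pi s.toRight.toRight fun i => t (Sum.inr (Sum.inr i))) ×ˢ
        Set.pi s.toRight.toLeft fun i => t (Sum.inr (Sum.inl i)) := by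
    ext p
    simp [Set.mem_pi, joinInput]
    tauto
  rw [Measure.map_apply measurable_joinInput (MeasurableSet.pi s.countable_toSet fun i _ => ht i),
    hset, inputLaw, vacLaw, Measure.prod_prod, Measure.prod_prod,
    Measure.infinitePi_pi _ fun i _ => ht _, Measure.infinitePi_pi _ fun i _ => ht _,
    Measure.infinitePi_pi _ fun i _ => ht _, Finset.prod_sum_eq_prod_toLeft_mul_prod_toRight,
    Finset.prod_sum_eq_prod_toLeft_mul_prod_toRight]
  simp only [hT, hH, hV]
  ring

lemma map_inputOf {Ω : Type*} [MeasurableSpace Ω] {P : Measure Ω} [IsProbabilityMeasure P]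
    {T H V : ℕ → Ω → ℝ} (hTm : ∀ n, Measurable (T n)) (hHm : ∀ n, Measurable (H n))
    (hVm : ∀ n, Measurable (V n)) (hT : ∀ n, HasLaw (T n) (expMeasure lam) P)
    (hH : ∀ n, HasLaw (H n) μH P) (hV : ∀ n, HasLaw (V n) μV P)
    (hindep : iIndepFun (fun i : ℕ ⊕ ℕ ⊕ ℕ => Sum.elim T (Sum.elim H V) i) P) :
    P.map (inputOf T H V) = inputLaw lam μH μV := by
  have hm : ∀ i : ℕ ⊕ ℕ ⊕ ℕ, Measurable (Sum.elim T (Sum.elim H V) i) := by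
    rintro (i | i | i)
    exacts [hTm i, hHm i, hVm i]
  have : ∀ i : ℕ ⊕ ℕ ⊕ ℕ, IsProbabilityMeasure (P.map (Sum.elim T (Sum.elim H V) i)) :=
    fun i => Measure.isProbabilityMeasure_map (hm i).aemeasurable
  have h1 := hindep.map_fun_eq_infinitePi_map hm
  have h2 := map_joinInput lam (μH := μH) (μV := μV)
    (fun i => P.map (Sum.elim T (Sum.elim H V) i)) (fun i => (hT i).map_eq)
    (fun i => (hH i).map_eq) (fun i => (hV i).map_eq)
  -- A left inverse of `joinInput`: mutual independence describes the law of the joined family, and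
  -- splitting recovers the three sequences.
  set split : (ℕ ⊕ ℕ ⊕ ℕ → ℝ) → InputSpace := fun f =>
    ((fun n => f (Sum.inl n), fun n => f (Sum.inr (Sum.inr n))), fun n => f (Sum.inr (Sum.inl n)))
    with hsplit
  have hms : Measurable split := by fun_prop
  have h3 := congrArg (Measure.map split) (h1.trans h2.symm)
  rw [Measure.map_map hms (measurable_pi_iff.2 hm), Measure.map_map hms measurable_joinInput] at h3
  have e2 : split ∘ joinInput = id := rfl
  rw [e2, Measure.map_id] at h3
  exact h3

end ConventionalBuffer

end

noncomputable section

namespace ConventionalBuffer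

/-! ### Sample paths in terms of service cycles -/

/-- Inputs on which the system never gets stuck. -/
structure GoodInput (p : InputSpace) : Prop where
  gaps : GoodGaps p.1.1
  vacations : GoodVacations p.1.2
  services : ∀ i, 0 ≤ p.2 i

/-- The sample path with a given input. -/
def pathOf (p : InputSpace) : CBSPath := ⟨p.1.1, p.2, p.1.2⟩

lemma pathOf_arrival (p : InputSpace) (n : ℕ) : (pathOf p).arrival n = psum p.1.1 (n + 1) := rfl

lemma pathOf_vacationEnd (p : InputSpace) (c : ℝ) (k j : ℕ) :
    (pathOf p).vacationEnd c k j = c + psum (fun i => p.1.2 (k + i)) j := rfl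

/-- The length of the service cycle with index `i`. -/
def cycleLength (p : InputSpace) (i : ℕ) : ℝ :=
  (cycleOut (cycleNext^[i] p)).1.1 + (cycleOut (cycleNext^[i] p)).2

/-- The age, when it is completed, of the packet served in the cycle with index `i`. -/
def cycleAge (p : InputSpace) (i : ℕ) : ℝ :=
  (cycleOut (cycleNext^[i] p)).1.2 + (cycleOut (cycleNext^[i] p)).2

lemma seqTail_cycleLength (p : InputSpace) :
    seqTail (cycleLength p) = cycleLength (cycleNext p) := by
  funext i
  simp only [seqTail, cycleLength, Function.iterate_succ_apply]

lemma cycleAge_succ (p : InputSpace) (i : ℕ) :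
    cycleAge p (i + 1) = cycleAge (cycleNext p) i := by
  simp only [cycleAge, Function.iterate_succ_apply]

/-- Arrivals after `d` are the arrivals of the restarted process, translated. Applied twice, for the
string and for the processing time, this translates arrivals by a whole cycle in `arrival_next`. -/
lemma exists_psum_elapse_iff {x : ℕ → ℝ} (d : ℝ) {y : ℝ} (hy : 0 < y) :
    (∃ n, psum (elapse d x) (n + 1) = y) ↔ ∃ n, psum x (n + 1) = d + y := by
  constructor
  · rintro ⟨n, hn⟩
    refine ⟨passIdx d x + n, ?_⟩
    rw [psum_elapse] at hn
    linarith
  · rintro ⟨n, hn⟩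
    have h1 : passIdx d x ≤ n := Nat.sInf_le (show d < psum x (n + 1) by linarith)
    obtain ⟨k, rfl⟩ := Nat.exists_eq_add_of_le h1
    refine ⟨k, ?_⟩
    rw [psum_elapse]
    linarith

namespace GoodInput

variable {p : InputSpace}

lemma next (hp : GoodInput p) : GoodInput (cycleNext p) where
  gaps := (hp.gaps.elapse_goodGaps _).elapse_goodGaps _
  vacations := hp.vacations.shift _
  services _ := hp.services _

lemma iterate (hp : GoodInput p) (i : ℕ) : GoodInput (cycleNext^[i] p) := by
  induction i generalizing p with
  | zero => exact hp
  | succ i ih => exact ih hp.next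

lemma le_vacLength (hp : GoodInput p) : p.1.1 0 ≤ (cycleOut p).1.1 := by
  obtain ⟨n, hn, hc⟩ := exists_mem_stringSet hp.gaps hp.vacations
  change p.1.1 0 ≤ psum p.1.2 (vacCount p.1)
  rw [hc]
  exact hn.2

lemma vacLength_pos (hp : GoodInput p) : 0 < (cycleOut p).1.1 :=
  (hp.gaps.pos 0).trans_le hp.le_vacLength

lemma lastEpoch_eq : lastEpoch (cycleOut p).1.1 p.1.1 = (cycleOut p).1.1 - (cycleOut p).1.2 := by
  change _ = psum p.1.2 (vacCount p.1) - (psum p.1.2 (vacCount p.1) - _)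
  rw [sub_sub_cancel]
  rfl

lemma vacWait_nonneg (hp : GoodInput p) : 0 ≤ (cycleOut p).1.2 := by
  have := lastEpoch_le p.1.1 hp.vacLength_pos.le
  rw [lastEpoch_eq] at this
  linarith

lemma vacWait_lt (hp : GoodInput p) : (cycleOut p).1.2 < (cycleOut p).1.1 := by
  have := (hp.gaps.lastEpoch_pos_iff hp.vacLength_pos.le).2 hp.le_vacLength
  rw [lastEpoch_eq] at this
  linarith

lemma cycleLength_pos (hp : GoodInput p) (i : ℕ) : 0 < cycleLength p i :=
  add_pos_of_pos_of_nonneg (hp.iterate i).vacLength_pos ((hp.iterate i).services 0)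

lemma cycleAge_nonneg (hp : GoodInput p) (i : ℕ) : 0 ≤ cycleAge p i :=
  add_nonneg (hp.iterate i).vacWait_nonneg ((hp.iterate i).services 0)

lemma cycleAge_le (hp : GoodInput p) (i : ℕ) : cycleAge p i ≤ cycleLength p i := by
  have := (hp.iterate i).vacWait_lt
  unfold cycleAge cycleLength
  linarith

lemma arrival_next (hp : GoodInput p) {y : ℝ} (hy : 0 < y) :
    y ∈ Set.range (pathOf (cycleNext p)).arrival ↔
      cycleLength p 0 + y ∈ Set.range (pathOf p).arrival := by
  have h0 : 0 ≤ p.2 0 := hp.services 0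
  change (∃ n, psum (elapse (p.2 0) (elapse (cycleOut p).1.1 p.1.1)) (n + 1) = y) ↔
    ∃ n, psum p.1.1 (n + 1) = ((cycleOut p).1.1 + p.2 0) + y
  rw [exists_psum_elapse_iff _ hy, exists_psum_elapse_iff _ (by linarith), add_assoc]

lemma vacationEnd_next (c : ℝ) (k j : ℕ) :
    (pathOf p).vacationEnd (cycleLength p 0 + c) (vacCount p.1 + k) j
      = cycleLength p 0 + (pathOf (cycleNext p)).vacationEnd c k j := by
  rw [pathOf_vacationEnd, pathOf_vacationEnd, add_assoc]
  congr 3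
  funext i
  change _ = p.1.2 (vacCount p.1 + (k + i))
  rw [add_assoc]

lemma numVacations_next (hp : GoodInput p) {c : ℝ} (hc : 0 ≤ c) (k : ℕ) :
    (pathOf p).numVacations (cycleLength p 0 + c) (vacCount p.1 + k)
      = (pathOf (cycleNext p)).numVacations c k := by
  unfold CBSPath.numVacations
  congr 1
  ext j
  simp only [Set.mem_ofPred_eq, vacationEnd_next]
  constructor
  · rintro ⟨n, h1, h2⟩
    have hy : 0 < (pathOf p).arrival n - cycleLength p 0 := by linarith
    obtain ⟨m, hm⟩ := (hp.arrival_next hy).2 ⟨n, by ring⟩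
    exact ⟨m, by rw [hm]; linarith, by rw [hm]; linarith⟩
  · rintro ⟨n, h1, h2⟩
    obtain ⟨m, hm⟩ := (hp.arrival_next (hc.trans_lt h1)).1 ⟨n, rfl⟩
    exact ⟨m, by rw [hm]; linarith, by rw [hm]; linarith⟩

lemma numVacations_zero (hp : GoodInput p) : (pathOf p).numVacations 0 0 = vacCount p.1 := by
  unfold CBSPath.numVacations vacCount
  congr 1
  ext j
  simp only [Set.mem_ofPred_eq, pathOf_vacationEnd, pathOf_arrival, zero_add, Set.mem_Ioc]
  constructor
  · rintro ⟨n, -, h⟩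
    refine le_trans ?_ h
    rw [psum_succ']
    linarith [psum_nonneg hp.gaps.tail.nonneg n]
  · intro h
    refine ⟨0, ?_, ?_⟩ <;> simp only [zero_add, psum_succ, psum_zero]
    · exact hp.gaps.pos 0
    · exact h

lemma serviceStart_zero (hp : GoodInput p) : (pathOf p).serviceStart 0 = (cycleOut p).1.1 := by
  simp only [CBSPath.serviceStart, CBSPath.leave]
  rw [hp.numVacations_zero, pathOf_vacationEnd]
  simp only [zero_add]
  rfl

lemma leave_one (hp : GoodInput p) : (pathOf p).leave 1 = (cycleLength p 0, vacCount p.1) := by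
  have h := hp.serviceStart_zero
  simp only [CBSPath.serviceStart, CBSPath.leave] at h
  simp only [CBSPath.leave]
  rw [h, hp.numVacations_zero, zero_add]
  rfl

/-- Homogeneity in time: after the first cycle the path is that of `cycleNext p`, translated by the
cycle length in time and by `vacCount` in the vacation index. Nonnegativity is carried through the
induction because arrivals of the two paths correspond only after the end of the first cycle. -/
lemma leave_succ (hp : GoodInput p) (l : ℕ) : 0 ≤ ((pathOf (cycleNext p)).leave l).1 ∧
    (pathOf p).leave (l + 1) = (cycleLength p 0 + ((pathOf (cycleNext p)).leave l).1,
      vacCount p.1 + ((pathOf (cycleNext p)).leave l).2) := by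
  induction l with
  | zero =>
    refine ⟨le_rfl, ?_⟩
    rw [zero_add, hp.leave_one]
    simp [CBSPath.leave]
  | succ l ih =>
    obtain ⟨h0, ih⟩ := ih
    have hserv : (pathOf p).service (l + 1) = (pathOf (cycleNext p)).service l := rfl
    constructor
    · rw [CBSPath.leave]
      dsimp only
      rw [pathOf_vacationEnd]
      have h1 : 0 ≤ (pathOf (cycleNext p)).service l := hp.next.services l
      have h2 := psum_nonneg (fun i => hp.next.vacations.nonneg
        (((pathOf (cycleNext p)).leave l).2 + i))
        ((pathOf (cycleNext p)).numVacations ((pathOf (cycleNext p)).leave l).1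
          ((pathOf (cycleNext p)).leave l).2)
      linarith
    · rw [CBSPath.leave]
      rw [ih, hp.numVacations_next h0, vacationEnd_next, hserv, add_assoc, add_assoc]
      rfl

lemma serviceStart_succ (hp : GoodInput p) (l : ℕ) :
    (pathOf p).serviceStart (l + 1)
      = cycleLength p 0 + (pathOf (cycleNext p)).serviceStart l := by
  obtain ⟨h0, h1⟩ := hp.leave_succ l
  rw [CBSPath.serviceStart, h1]
  dsimp only
  rw [hp.numVacations_next h0, vacationEnd_next]
  rfl

lemma serviceStart_eq (hp : GoodInput p) (l : ℕ) :
    (pathOf p).serviceStart l = psum (cycleLength p) l + (cycleOut (cycleNext^[l] p)).1.1 := by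
  induction l generalizing p with
  | zero => rw [hp.serviceStart_zero, psum_zero, zero_add]; rfl
  | succ l ih =>
    rw [hp.serviceStart_succ, ih hp.next, psum_succ', seqTail_cycleLength, add_assoc]
    rfl

lemma service_eq (l : ℕ) : (pathOf p).service l = (cycleOut (cycleNext^[l] p)).2 := by
  induction l generalizing p with
  | zero => rfl
  | succ l ih => exact ih (p := cycleNext p)

lemma completion_eq (hp : GoodInput p) (l : ℕ) :
    (pathOf p).completion l = psum (cycleLength p) (l + 1) := by
  rw [CBSPath.completion, hp.serviceStart_eq, service_eq, psum_succ, cycleLength, add_assoc]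

/-- In the first cycle the greatest arrival of the string is the last epoch before its end; later
cycles are translates. Attainment of the maximum is what identifies the supremum in `generation`. -/
lemma isGreatest_generation (hp : GoodInput p) (l : ℕ) :
    IsGreatest {x | x ∈ Set.range (pathOf p).arrival ∧
      x ∈ Set.Ioc ((pathOf p).leave l).1 ((pathOf p).serviceStart l)}
      (psum (cycleLength p) (l + 1) - cycleAge p l) := by
  induction l generalizing p with
  | zero =>
    have h1 : psum (cycleLength p) (0 + 1) - cycleAge p 0 = lastEpoch (cycleOut p).1.1 p.1.1 := by
      rw [lastEpoch_eq, psum_succ, psum_zero]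
      simp only [cycleLength, cycleAge, Function.iterate_zero, id]
      ring
    have hX := hp.vacLength_pos.le
    have hpos := (hp.gaps.lastEpoch_pos_iff hX).2 hp.le_vacLength
    rw [h1, hp.serviceStart_zero]
    change IsGreatest {x | x ∈ Set.range (pathOf p).arrival ∧ x ∈ Set.Ioc 0 (cycleOut p).1.1} _
    refine ⟨⟨?_, hpos, lastEpoch_le _ hX⟩, ?_⟩
    -- With no arrival, `lastEpoch` would have the default value 0, which is not an arrival time;
    -- positivity rules this out.
    · unfold lastEpoch at hpos ⊢
      rcases hk : passIdx (cycleOut p).1.1 p.1.1 with _ | k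
      · rw [hk, psum_zero] at hpos
        exact absurd hpos (lt_irrefl 0)
      · exact ⟨k, rfl⟩
    · rintro y ⟨⟨n, rfl⟩, -, hy⟩
      rw [pathOf_arrival] at hy ⊢
      refine psum_mono hp.gaps.nonneg ?_
      by_contra! hlt
      have h2 := hp.gaps.lt_psum_passIdx_succ (cycleOut p).1.1
      have h3 := psum_mono hp.gaps.nonneg (show passIdx (cycleOut p).1.1 p.1.1 + 1 ≤ n + 1 by omega)
      linarith
  | succ l ih =>
    obtain ⟨h0, h1⟩ := hp.leave_succ l
    have hG := ih hp.next
    have e : psum (cycleLength p) (l + 1 + 1) - cycleAge p (l + 1) = cycleLength p 0 +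
        (psum (cycleLength (cycleNext p)) (l + 1) - cycleAge (cycleNext p) l) := by
      rw [psum_succ', seqTail_cycleLength, cycleAge_succ]
      ring
    rw [e, hp.serviceStart_succ, h1]
    dsimp only
    refine ⟨⟨(hp.arrival_next (h0.trans_lt hG.1.2.1)).1 hG.1.1, ?_, ?_⟩, ?_⟩
    · linarith [hG.1.2.1]
    · linarith [hG.1.2.2]
    · rintro y ⟨hy, hy1, hy2⟩
      have hy0 : 0 < y - cycleLength p 0 := by linarith
      have := hG.2 ⟨(hp.arrival_next hy0).2 (by simpa using hy), by linarith, by linarith⟩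
      linarith

lemma generation_eq (hp : GoodInput p) (l : ℕ) :
    (pathOf p).generation l = psum (cycleLength p) (l + 1) - cycleAge p l :=
  (hp.isGreatest_generation l).csSup_eq

end GoodInput

/-! ### The age process of a sequence of cycles -/

/-- The age at time `t` if the cycles have lengths `y` and the age drops to `g l` at the end of the
cycle with index `l`. -/
def cyclicAge (y g : ℕ → ℝ) (a t : ℝ) : ℝ :=
  t - sSup (insert (-a) {x | ∃ l, psum y (l + 1) ≤ t ∧ x = psum y (l + 1) - g l})

/-- The generation time of the update in use during the cycle with index `l`. -/
def lastUpdate (y g : ℕ → ℝ) (a : ℝ) : ℕ → ℝ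
  | 0 => -a
  | l + 1 => psum y (l + 1) - g l

lemma GoodInput.age_eq {p : InputSpace} (hp : GoodInput p) (a : ℝ) :
    (pathOf p).age a = cyclicAge (cycleLength p) (cycleAge p) a := by
  funext t
  simp only [CBSPath.age, cyclicAge, hp.completion_eq, hp.generation_eq]

lemma GoodInput.peakAge_eq {p : InputSpace} (hp : GoodInput p) (a : ℝ) (l : ℕ) :
    (pathOf p).peakAge a l
      = Function.leftLim (cyclicAge (cycleLength p) (cycleAge p) a)
        (psum (cycleLength p) (l + 1)) := by
  rw [CBSPath.peakAge, hp.age_eq, hp.completion_eq]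

section CyclicAge

variable {y g : ℕ → ℝ} {a : ℝ}

/-- Since `g i` ≤ `y i`, a served packet is generated within its own cycle, hence after the
generation of the previous one. So the maximum in the definition of the age is attained at the
latest completion. -/
lemma lastUpdate_mono (hg0 : ∀ i, 0 ≤ g i) (hg : ∀ i, g i ≤ y i) (ha : 0 ≤ a) :
    Monotone (lastUpdate y g a) := by
  refine monotone_nat_of_le_succ fun l => ?_
  rcases l with _ | l
  · simp only [lastUpdate, psum_succ, psum_zero]
    linarith [hg 0]
  · simp only [lastUpdate, psum_succ y (l + 1)]
    linarith [hg0 l, hg (l + 1)]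

/-- During a cycle the age grows linearly. -/
lemma cyclicAge_eq (hy : ∀ i, 0 < y i) (hg0 : ∀ i, 0 ≤ g i) (hg : ∀ i, g i ≤ y i) (ha : 0 ≤ a)
    {l : ℕ} {t : ℝ} (h1 : l = 0 ∨ psum y l ≤ t) (h2 : t < psum y (l + 1)) :
    cyclicAge y g a t = t - lastUpdate y g a l := by
  have hmono := lastUpdate_mono hg0 hg ha
  rw [cyclicAge]
  congr 1
  refine IsGreatest.csSup_eq ⟨?_, ?_⟩
  -- In the initial cycle no lower bound on `t` is needed, so the formula also covers negative
  -- times.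
  · rcases l with _ | l
    · exact Set.mem_insert _ _
    · exact Set.mem_insert_of_mem _ ⟨l, h1.resolve_left l.succ_ne_zero, rfl⟩
  · rintro x (rfl | ⟨k, hk, rfl⟩)
    · exact hmono (Nat.zero_le l)
    · refine hmono (show k + 1 ≤ l from ?_)
      have := (psum_strictMono hy).lt_iff_lt.1 (hk.trans_lt h2)
      omega

lemma leftLim_cyclicAge (hy : ∀ i, 0 < y i) (hg0 : ∀ i, 0 ≤ g i) (hg : ∀ i, g i ≤ y i)
    (ha : 0 ≤ a) (l : ℕ) :
    Function.leftLim (cyclicAge y g a) (psum y (l + 1))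
      = psum y (l + 1) - lastUpdate y g a l := by
  have hlt : psum y l < psum y (l + 1) := psum_strictMono hy l.lt_succ_self
  refine leftLim_eq_of_tendsto ?_
  have h : Tendsto (fun t => t - lastUpdate y g a l) (𝓝[<] (psum y (l + 1)))
      (𝓝 (psum y (l + 1) - lastUpdate y g a l)) :=
    (tendsto_id.sub_const _).mono_left nhdsWithin_le_nhds
  refine h.congr' ?_
  filter_upwards [Ioo_mem_nhdsLT hlt] with t ht
  exact (cyclicAge_eq hy hg0 hg ha (Or.inr ht.1.le) ht.2).symm

end CyclicAge

end ConventionalBuffer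

end

noncomputable section

namespace ConventionalBuffer

/-! ### The integral of the age over the cycles -/

/-- The age at the beginning of the cycle with index `l`. -/
def initialAge (g : ℕ → ℝ) (a : ℝ) : ℕ → ℝ
  | 0 => a
  | l + 1 => g l

/-- The integral of the age over the cycle with index `l`. -/
def reward (y g : ℕ → ℝ) (a : ℝ) (l : ℕ) : ℝ := initialAge g a l * y l + y l ^ 2 / 2

section CyclicAge

variable {y g : ℕ → ℝ} {a : ℝ}

lemma psum_sub_lastUpdate (y g : ℕ → ℝ) (a : ℝ) (l : ℕ) :
    psum y l - lastUpdate y g a l = initialAge g a l := by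
  cases l <;> simp [lastUpdate, initialAge]

/-- The peak of the age at the end of a cycle. -/
lemma peak_eq (hy : ∀ i, 0 < y i) (hg0 : ∀ i, 0 ≤ g i) (hg : ∀ i, g i ≤ y i) (ha : 0 ≤ a) (l : ℕ) :
    Function.leftLim (cyclicAge y g a) (psum y (l + 1)) = initialAge g a l + y l := by
  rw [leftLim_cyclicAge hy hg0 hg ha, ← psum_sub_lastUpdate y g a l, psum_succ]
  ring

lemma cyclicAge_eqOn (hy : ∀ i, 0 < y i) (hg0 : ∀ i, 0 ≤ g i) (hg : ∀ i, g i ≤ y i) (ha : 0 ≤ a)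
    (l : ℕ) : Set.EqOn (fun t => t - lastUpdate y g a l) (cyclicAge y g a)
      (Set.uIoo (psum y l) (psum y (l + 1))) := by
  intro t ht
  rw [Set.uIoo_of_le (psum_strictMono hy l.lt_succ_self).le] at ht
  exact (cyclicAge_eq hy hg0 hg ha (Or.inr ht.1.le) ht.2).symm

lemma intervalIntegrable_cycle (hy : ∀ i, 0 < y i) (hg0 : ∀ i, 0 ≤ g i) (hg : ∀ i, g i ≤ y i)
    (ha : 0 ≤ a) (l : ℕ) :
    IntervalIntegrable (cyclicAge y g a) volume (psum y l) (psum y (l + 1)) :=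
  ((continuous_id.sub continuous_const).intervalIntegrable _ _).congr_uIoo
    (cyclicAge_eqOn hy hg0 hg ha l)

lemma integral_cycle (hy : ∀ i, 0 < y i) (hg0 : ∀ i, 0 ≤ g i) (hg : ∀ i, g i ≤ y i)
    (ha : 0 ≤ a) (l : ℕ) :
    ∫ t in (psum y l)..(psum y (l + 1)), cyclicAge y g a t = reward y g a l := by
  rw [← intervalIntegral.integral_congr_uIoo (cyclicAge_eqOn hy hg0 hg ha l),
    intervalIntegral.integral_sub (by simp) (by simp), integral_id, intervalIntegral.integral_const,
    reward, ← psum_sub_lastUpdate y g a l, psum_succ, smul_eq_mul]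
  ring

lemma integral_cycles (hy : ∀ i, 0 < y i) (hg0 : ∀ i, 0 ≤ g i) (hg : ∀ i, g i ≤ y i)
    (ha : 0 ≤ a) (n : ℕ) :
    ∫ t in (0 : ℝ)..(psum y n), cyclicAge y g a t = ∑ l ∈ Finset.range n, reward y g a l := by
  have h := intervalIntegral.sum_integral_adjacent_intervals (f := cyclicAge y g a) (μ := volume)
    (a := psum y) (n := n) fun l _ => intervalIntegrable_cycle hy hg0 hg ha l
  rw [psum_zero] at h
  rw [← h]
  exact Finset.sum_congr rfl fun l _ => integral_cycle hy hg0 hg ha l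

lemma intervalIntegrable_cyclicAge (hy : GoodGaps y) (hg0 : ∀ i, 0 ≤ g i) (hg : ∀ i, g i ≤ y i)
    (ha : 0 ≤ a) (t : ℝ) : IntervalIntegrable (cyclicAge y g a) volume 0 t := by
  rcases le_or_gt 0 t with ht | ht
  · obtain ⟨n, hn⟩ := hy.unbounded t
    have h := IntervalIntegrable.trans_iterate (f := cyclicAge y g a) (μ := volume)
      (a := psum y) (n := n) fun l _ => intervalIntegrable_cycle hy.pos hg0 hg ha l
    rw [psum_zero] at h
    refine h.mono_set ?_
    rw [Set.uIcc_of_le ht, Set.uIcc_of_le (ht.trans hn.le)]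
    exact Set.Icc_subset_Icc_right hn.le
  · refine ((continuous_id.sub (continuous_const (y := lastUpdate y g a 0))).intervalIntegrable
      0 t).congr_uIoo fun u hu => ?_
    rw [Set.uIoo_of_ge ht.le] at hu
    refine (cyclicAge_eq hy.pos hg0 hg ha (Or.inl rfl) (hu.2.trans ?_)).symm
    rw [psum_succ, psum_zero, zero_add]
    exact hy.pos 0

/-- The deterministic bound t + a makes the age at a fixed time integrable and later controls the
unlikely event of too many completions. -/
lemma cyclicAge_mem_Icc (hy : GoodGaps y) (hg0 : ∀ i, 0 ≤ g i) (hg : ∀ i, g i ≤ y i)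
    (ha : 0 ≤ a) {t : ℝ} (ht : 0 ≤ t) : cyclicAge y g a t ∈ Set.Icc 0 (t + a) := by
  have h := hy.mem_passSet ht
  rw [cyclicAge_eq hy.pos hg0 hg ha (Or.inr h.1) h.2]
  have h1 := psum_sub_lastUpdate y g a (passIdx t y)
  have h2 : 0 ≤ initialAge g a (passIdx t y) := by
    cases passIdx t y with
    | zero => exact ha
    | succ l => exact hg0 l
  have h3 : -a ≤ lastUpdate y g a (passIdx t y) := lastUpdate_mono hg0 hg ha (Nat.zero_le _)
  exact ⟨by linarith [h.1], by linarith⟩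

lemma integral_cyclicAge_mono (hy : GoodGaps y) (hg0 : ∀ i, 0 ≤ g i) (hg : ∀ i, g i ≤ y i)
    (ha : 0 ≤ a) {s t : ℝ} (hs : 0 ≤ s) (hst : s ≤ t) :
    ∫ u in (0 : ℝ)..s, cyclicAge y g a u ≤ ∫ u in (0 : ℝ)..t, cyclicAge y g a u := by
  refine intervalIntegral.integral_mono_interval le_rfl hs hst ?_
    (intervalIntegrable_cyclicAge hy hg0 hg ha t)
  filter_upwards [ae_restrict_mem measurableSet_Ioc] with u hu
  exact (cyclicAge_mem_Icc hy hg0 hg ha hu.1.le).1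

lemma reward_nonneg (hy : ∀ i, 0 < y i) (hg0 : ∀ i, 0 ≤ g i) (ha : 0 ≤ a) (l : ℕ) :
    0 ≤ reward y g a l := by
  have h1 := (hy l).le
  have h2 : 0 ≤ initialAge g a l := by
    cases l with
    | zero => exact ha
    | succ l => exact hg0 l
  unfold reward
  positivity

end CyclicAge

/-! ### Averages -/

lemma tendsto_passIdx {y : ℕ → ℝ} (hy : GoodGaps y) :
    Tendsto (fun t => passIdx t y) atTop atTop := by
  refine tendsto_atTop.2 fun N => ?_
  filter_upwards [eventually_ge_atTop (psum y N)] with t ht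
  have h := ht.trans_lt (hy.lt_psum_passIdx_succ t)
  have := (psum_strictMono hy.pos).lt_iff_lt.1 h
  omega

/-- The renewal reward theorem for a sample path. -/
lemma tendsto_average_of_cycles {y : ℕ → ℝ} (hy : GoodGaps y) {F : ℝ → ℝ}
    (hF0 : ∀ t, 0 ≤ t → 0 ≤ F t) (hF : ∀ s t, 0 ≤ s → s ≤ t → F s ≤ F t) {m ρ : ℝ} (hm : 0 < m)
    (h1 : Tendsto (fun n : ℕ => psum y n / n) atTop (𝓝 m))
    (h2 : Tendsto (fun n : ℕ => F (psum y n) / n) atTop (𝓝 ρ)) :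
    Tendsto (fun t : ℝ => 1 / t * F t) atTop (𝓝 (ρ / m)) := by
  have hone : Tendsto (fun n : ℕ => ((n + 1 : ℕ) : ℝ) / n) atTop (𝓝 1) := by
    have : Tendsto (fun n : ℕ => (1 : ℝ) + 1 / n) atTop (𝓝 (1 + 0)) :=
      tendsto_const_nhds.add tendsto_one_div_atTop_nhds_zero_nat
    rw [add_zero] at this
    refine this.congr' ?_
    filter_upwards [eventually_gt_atTop 0] with n hn
    have : (n : ℝ) ≠ 0 := by positivity
    push_cast
    field_simp
  have h1' := h1.comp (tendsto_add_atTop_nat 1)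
  have h2' := h2.comp (tendsto_add_atTop_nat 1)
  -- Write S_n for `psum y n`. If S_n ≤ t < S_{n+1}, monotonicity of `F` puts F(t)/t between
  -- F(S_n)/S_{n+1} and F(S_{n+1})/S_n, and both bounds tend to ρ/m.
  have hlow : Tendsto (fun n : ℕ => F (psum y n) / psum y (n + 1)) atTop (𝓝 (ρ / m)) := by
    have h := h2.div (h1'.mul hone) (by simpa using hm.ne')
    rw [mul_one] at h
    refine h.congr' ?_
    filter_upwards [eventually_gt_atTop 0] with n hn
    have hn' : (n : ℝ) ≠ 0 := by positivity
    have hn1 : ((n + 1 : ℕ) : ℝ) ≠ 0 := by positivity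
    have hp : psum y (n + 1) ≠ 0 := by
      have := psum_strictMono hy.pos n.succ_pos
      rw [psum_zero] at this
      exact this.ne'
    simp only [Pi.div_apply, Function.comp]
    field_simp
  have hupp : Tendsto (fun n : ℕ => F (psum y (n + 1)) / psum y n) atTop (𝓝 (ρ / m)) := by
    have h := (h2'.mul hone).div h1 hm.ne'
    rw [mul_one] at h
    refine h.congr' ?_
    filter_upwards [eventually_gt_atTop 0] with n hn
    have hn' : (n : ℝ) ≠ 0 := by positivity
    have hn1 : ((n + 1 : ℕ) : ℝ) ≠ 0 := by positivity
    have hp : psum y n ≠ 0 := by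
      have := psum_strictMono hy.pos hn
      rw [psum_zero] at this
      exact this.ne'
    simp only [Pi.div_apply, Function.comp]
    field_simp
  have hpass := tendsto_passIdx hy
  refine tendsto_of_tendsto_of_tendsto_of_le_of_le' (hlow.comp hpass) (hupp.comp hpass) ?_ ?_
  · filter_upwards [eventually_gt_atTop 0] with t ht
    have h := hy.mem_passSet ht.le
    simp only [Function.comp]
    rw [one_div, inv_mul_eq_div]
    have hp := psum_nonneg hy.nonneg (passIdx t y)
    exact div_le_div₀ (hF0 t ht.le) (hF _ _ hp h.1) ht h.2.le
  · filter_upwards [eventually_gt_atTop 0, hpass.eventually_gt_atTop 0] with t ht hn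
    have h := hy.mem_passSet ht.le
    simp only [Function.comp]
    rw [one_div, inv_mul_eq_div]
    have hp : 0 < psum y (passIdx t y) := by
      have := psum_strictMono hy.pos hn
      rwa [psum_zero] at this
    exact div_le_div₀ (hF0 _ (psum_nonneg hy.nonneg _)) (hF _ _ ht.le h.2.le) hp h.1

/-- Serves sequences whose neighbouring terms are dependent while terms two or more apart are
independent: among the first n indices (n + 1)/2 are even and n/2 are odd (rounded down), so each
class has weight tending to 1/2. -/
lemma tendsto_average_of_even_odd {f : ℕ → ℝ} {c : ℝ}
    (he : Tendsto (fun n : ℕ => (∑ i ∈ Finset.range n, f (2 * i)) / n) atTop (𝓝 c))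
    (ho : Tendsto (fun n : ℕ => (∑ i ∈ Finset.range n, f (2 * i + 1)) / n) atTop (𝓝 c)) :
    Tendsto (fun n : ℕ => (∑ i ∈ Finset.range n, f i) / n) atTop (𝓝 c) := by
  have hsplit : ∀ n, ∑ i ∈ Finset.range n, f i = ∑ i ∈ Finset.range ((n + 1) / 2), f (2 * i)
      + ∑ i ∈ Finset.range (n / 2), f (2 * i + 1) := by
    intro n
    induction n with
    | zero => simp
    | succ n ih =>
      rw [Finset.sum_range_succ, ih]
      rcases Nat.even_or_odd' n with ⟨k, rfl | rfl⟩
      · rw [show (2 * k + 1 + 1) / 2 = k + 1 by omega, show (2 * k + 1) / 2 = k by omega,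
          show 2 * k / 2 = k by omega, Finset.sum_range_succ]
        ring
      · rw [show (2 * k + 1 + 1 + 1) / 2 = k + 1 by omega, show (2 * k + 1 + 1) / 2 = k + 1 by omega,
          show (2 * k + 1) / 2 = k by omega, Finset.sum_range_succ (fun i => f (2 * i + 1))]
        ring
  have hhalf : Tendsto (fun n : ℕ => (((n + 1) / 2 : ℕ) : ℝ) / n) atTop (𝓝 (1 / 2)) := by
    have hu : Tendsto (fun n : ℕ => (1 / 2 : ℝ) + 1 / n) atTop (𝓝 (1 / 2 + 0)) :=
      tendsto_const_nhds.add tendsto_one_div_atTop_nhds_zero_nat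
    rw [add_zero] at hu
    refine tendsto_of_tendsto_of_tendsto_of_le_of_le' tendsto_const_nhds hu ?_ ?_
    · filter_upwards [eventually_gt_atTop 0] with n hn
      have : n ≤ 2 * ((n + 1) / 2) := by omega
      have h' : (n : ℝ) ≤ 2 * (((n + 1) / 2 : ℕ) : ℝ) := by exact_mod_cast this
      rw [le_div_iff₀ (by positivity)]
      linarith
    · filter_upwards [eventually_gt_atTop 0] with n hn
      have : 2 * ((n + 1) / 2) ≤ n + 1 := by omega
      have h' : 2 * (((n + 1) / 2 : ℕ) : ℝ) ≤ n + 1 := by exact_mod_cast this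
      rw [div_le_iff₀ (by positivity), add_mul, one_div_mul_cancel (by positivity)]
      linarith
  have hhalf' : Tendsto (fun n : ℕ => ((n / 2 : ℕ) : ℝ) / n) atTop (𝓝 (1 / 2)) := by
    have hl : Tendsto (fun n : ℕ => (1 / 2 : ℝ) - 1 / n) atTop (𝓝 (1 / 2 - 0)) :=
      tendsto_const_nhds.sub tendsto_one_div_atTop_nhds_zero_nat
    rw [sub_zero] at hl
    refine tendsto_of_tendsto_of_tendsto_of_le_of_le' hl tendsto_const_nhds ?_ ?_
    · filter_upwards [eventually_gt_atTop 0] with n hn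
      have : n ≤ 2 * (n / 2) + 1 := by omega
      have h' : (n : ℝ) ≤ 2 * ((n / 2 : ℕ) : ℝ) + 1 := by exact_mod_cast this
      rw [le_div_iff₀ (by positivity), sub_mul, one_div_mul_cancel (by positivity)]
      linarith
    · filter_upwards [eventually_gt_atTop 0] with n hn
      have : 2 * (n / 2) ≤ n := by omega
      have h' : 2 * ((n / 2 : ℕ) : ℝ) ≤ n := by exact_mod_cast this
      rw [div_le_iff₀ (by positivity)]
      linarith
  have t1 : Tendsto (fun n : ℕ => (n + 1) / 2) atTop atTop :=
    tendsto_atTop.2 fun N => by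
      filter_upwards [eventually_ge_atTop (2 * N)] with n hn
      omega
  have t2 : Tendsto (fun n : ℕ => n / 2) atTop atTop :=
    tendsto_atTop.2 fun N => by
      filter_upwards [eventually_ge_atTop (2 * N)] with n hn
      omega
  have h := ((he.comp t1).mul hhalf).add ((ho.comp t2).mul hhalf')
  rw [show c * (1 / 2) + c * (1 / 2) = c by ring] at h
  refine h.congr' ?_
  filter_upwards [eventually_ge_atTop 2] with n hn
  have a1 : (((n + 1) / 2 : ℕ) : ℝ) ≠ 0 := by
    have : (n + 1) / 2 ≠ 0 := by omega
    exact_mod_cast this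
  have a2 : ((n / 2 : ℕ) : ℝ) ≠ 0 := by
    have : n / 2 ≠ 0 := by omega
    exact_mod_cast this
  simp only [Function.comp]
  rw [hsplit n, div_mul_div_cancel₀ a1, div_mul_div_cancel₀ a2, add_div]

/-- The long-run average of a function that converges is its limit. -/
lemma tendsto_interval_average {f : ℝ → ℝ} {L : ℝ}
    (hi : ∀ t, 0 ≤ t → IntervalIntegrable f volume 0 t) (h : Tendsto f atTop (𝓝 L)) :
    Tendsto (fun t : ℝ => 1 / t * ∫ u in (0 : ℝ)..t, f u) atTop (𝓝 L) := by
  rw [Metric.tendsto_nhds]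
  intro ε hε
  obtain ⟨s, hs⟩ := eventually_atTop.1 ((Metric.tendsto_nhds.1 h) (ε / 2) (half_pos hε))
  set s' := max s 0 with hs'
  have hs0 : 0 ≤ s' := le_max_right _ _
  set K := |∫ u in (0 : ℝ)..s', (f u - L)| with hK
  -- Beyond 2K/ε the fixed contribution `K` of the initial segment is less than εt/2.
  filter_upwards [eventually_gt_atTop s', eventually_gt_atTop (2 * K / ε)] with t ht1 ht2
  have ht0 : 0 < t := hs0.trans_lt ht1
  have hi1 : IntervalIntegrable (fun u => f u - L) volume 0 s' :=
    (hi s' hs0).sub intervalIntegrable_const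
  have hi2 : IntervalIntegrable (fun u => f u - L) volume 0 t :=
    (hi t ht0.le).sub intervalIntegrable_const
  have hi3 : IntervalIntegrable (fun u => f u - L) volume s' t := hi1.symm.trans hi2
  have e1 : 1 / t * (∫ u in (0 : ℝ)..t, f u) - L = 1 / t * ∫ u in (0 : ℝ)..t, (f u - L) := by
    rw [intervalIntegral.integral_sub (hi t ht0.le) intervalIntegrable_const,
      intervalIntegral.integral_const, smul_eq_mul]
    field_simp
    ring
  have e2 : |∫ u in s'..t, (f u - L)| ≤ ε / 2 * |t - s'| := by
    rw [← Real.norm_eq_abs]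
    refine intervalIntegral.norm_integral_le_of_norm_le_const fun u hu => ?_
    rw [Set.uIoc_of_le ht1.le] at hu
    have := hs u ((le_max_left s 0).trans hu.1.le)
    rw [Real.dist_eq] at this
    exact this.le
  rw [Real.dist_eq, e1, ← intervalIntegral.integral_add_adjacent_intervals hi1 hi3, abs_mul,
    abs_of_pos (by positivity : 0 < 1 / t), one_div, inv_mul_lt_iff₀ ht0]
  rw [abs_of_pos (by linarith : 0 < t - s')] at e2
  have h3 := abs_add_le (∫ u in (0 : ℝ)..s', (f u - L)) (∫ u in s'..t, (f u - L))
  rw [div_lt_iff₀ hε] at ht2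
  nlinarith

end ConventionalBuffer

end

noncomputable section

namespace ConventionalBuffer

/-! ### Independent identically distributed cycles -/

/-- Random cycle lengths `y` and ages `g` at the ends of the cycles, such that the cycles are
independent and identically distributed. -/
structure IsRenewalCycle {Ω : Type*} [MeasurableSpace Ω] (P : Measure Ω) (y g : ℕ → Ω → ℝ) :
    Prop where
  measurable_length : ∀ i, Measurable (y i)
  measurable_age : ∀ i, Measurable (g i)
  indep : iIndepFun (fun i ω => (y i ω, g i ω)) P
  ident : ∀ i, IdentDistrib (fun ω => (y i ω, g i ω)) (fun ω => (y 0 ω, g 0 ω)) P P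
  pos : ∀ᵐ ω ∂P, ∀ i, 0 < y i ω
  age_nonneg : ∀ᵐ ω ∂P, ∀ i, 0 ≤ g i ω
  age_le : ∀ᵐ ω ∂P, ∀ i, g i ω ≤ y i ω
  integrable_length : Integrable (y 0) P

namespace IsRenewalCycle

variable {Ω : Type*} [MeasurableSpace Ω] {P : Measure Ω} {y g : ℕ → Ω → ℝ}

lemma ident_length (h : IsRenewalCycle P y g) (i : ℕ) : IdentDistrib (y i) (y 0) P P :=
  (h.ident i).comp measurable_fst

lemma ident_age (h : IsRenewalCycle P y g) (i : ℕ) : IdentDistrib (g i) (g 0) P P :=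
  (h.ident i).comp measurable_snd

lemma indep_length (h : IsRenewalCycle P y g) : iIndepFun y P :=
  h.indep.comp (fun _ => Prod.fst) fun _ => measurable_fst

lemma indep_age (h : IsRenewalCycle P y g) : iIndepFun g P :=
  h.indep.comp (fun _ => Prod.snd) fun _ => measurable_snd

lemma indep_age_length (h : IsRenewalCycle P y g) {i j : ℕ} (hij : i ≠ j) : g i ⟂ᵢ[P] y j :=
  (h.indep.indepFun hij).comp measurable_snd measurable_fst

lemma measurable_peak (h : IsRenewalCycle P y g) (a : ℝ) (l : ℕ) :
    Measurable fun ω => initialAge (fun i => g i ω) a l + y l ω := by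
  cases l with
  | zero => exact measurable_const.add (h.measurable_length 0)
  | succ l => exact (h.measurable_age l).add (h.measurable_length (l + 1))

lemma integrable_length' (h : IsRenewalCycle P y g) (i : ℕ) : Integrable (y i) P :=
  (h.ident_length i).integrable_iff.2 h.integrable_length

lemma integrable_age (h : IsRenewalCycle P y g) (i : ℕ) : Integrable (g i) P := by
  refine (h.integrable_length' i).mono' (h.measurable_age i).aestronglyMeasurable ?_
  filter_upwards [h.age_nonneg, h.age_le] with ω h1 h2
  rw [Real.norm_of_nonneg (h1 i)]
  exact h2 i

lemma integral_length (h : IsRenewalCycle P y g) (i : ℕ) : ∫ ω, y i ω ∂P = ∫ ω, y 0 ω ∂P :=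
  (h.ident_length i).integral_eq

lemma integral_age (h : IsRenewalCycle P y g) (i : ℕ) : ∫ ω, g i ω ∂P = ∫ ω, g 0 ω ∂P :=
  (h.ident_age i).integral_eq

lemma ae_tendsto_length (h : IsRenewalCycle P y g) :
    ∀ᵐ ω ∂P, Tendsto (fun n : ℕ => psum (fun i => y i ω) n / n) atTop (𝓝 (∫ ω, y 0 ω ∂P)) :=
  strong_law_ae_real y h.integrable_length (fun _ _ hij => h.indep_length.indepFun hij)
    h.ident_length

lemma ae_tendsto_age (h : IsRenewalCycle P y g) :
    ∀ᵐ ω ∂P, Tendsto (fun n : ℕ => psum (fun i => g i ω) n / n) atTop (𝓝 (∫ ω, g 0 ω ∂P)) :=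
  strong_law_ae_real g (h.integrable_age 0) (fun _ _ hij => h.indep_age.indepFun hij)
    h.ident_age

lemma memLp_length (h : IsRenewalCycle P y g) (h2 : MemLp (y 0) 2 P) (i : ℕ) : MemLp (y i) 2 P :=
  (h.ident_length i).memLp_iff.2 h2

lemma memLp_age (h : IsRenewalCycle P y g) (h2 : MemLp (y 0) 2 P) (i : ℕ) : MemLp (g i) 2 P := by
  refine (h.memLp_length h2 i).mono (h.measurable_age i).aestronglyMeasurable ?_
  filter_upwards [h.age_nonneg, h.age_le, h.pos] with ω h1 h2 h3
  rw [Real.norm_of_nonneg (h1 i), Real.norm_of_nonneg (h3 i).le]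
  exact h2 i

variable [IsProbabilityMeasure P]

lemma integral_length_pos (h : IsRenewalCycle P y g) : 0 < ∫ ω, y 0 ω ∂P := by
  refine (integral_pos_iff_support_of_nonneg_ae ?_ h.integrable_length).2 ?_
  · filter_upwards [h.pos] with ω h1 using (h1 0).le
  · have : (Function.support (y 0) : Set Ω) =ᵐ[P] Set.univ := by
      refine eventuallyEq_univ.2 ?_
      filter_upwards [h.pos] with ω h1 using (h1 0).ne'
    rw [measure_congr this]
    simp

lemma ae_goodGaps (h : IsRenewalCycle P y g) : ∀ᵐ ω ∂P, GoodGaps fun i => y i ω := by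
  filter_upwards [h.pos, h.ae_tendsto_length] with ω h1 h2
  refine ⟨h1, fun c => ?_⟩
  have h3 : Tendsto (fun n : ℕ => psum (fun i => y i ω) n / n * n) atTop atTop :=
    h2.pos_mul_atTop h.integral_length_pos tendsto_natCast_atTop_atTop
  obtain ⟨n, hn, hn0⟩ := ((h3.eventually_gt_atTop c).and (eventually_gt_atTop 0)).exists
  refine ⟨n, ?_⟩
  rwa [div_mul_cancel₀ _ (by positivity)] at hn

/-! #### Peaks -/

/-- The peaks of the age have an almost sure average. -/
lemma ae_tendsto_peak (h : IsRenewalCycle P y g) (a : ℝ) :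
    ∀ᵐ ω ∂P, Tendsto (fun k : ℕ => 1 / (k : ℝ) *
      ∑ l ∈ Finset.range k, (initialAge (fun i => g i ω) a l + y l ω)) atTop
      (𝓝 (∫ ω, g 0 ω ∂P + ∫ ω, y 0 ω ∂P)) := by
  filter_upwards [h.ae_tendsto_length, h.ae_tendsto_age] with ω h1 h2
  have h3 : Tendsto (fun k : ℕ => (∑ l ∈ Finset.range k, initialAge (fun i => g i ω) a l) / k)
      atTop (𝓝 (∫ ω, g 0 ω ∂P)) := by
    -- The age at the start of cycle l + 1 is `g l`, so after a shift the sum is a sum of the `g l`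
    -- plus the single term `a`, which is negligible.
    rw [← tendsto_add_atTop_iff_nat 1]
    have h4 : Tendsto (fun k : ℕ => (k : ℝ) / (k + 1)) atTop (𝓝 1) :=
      tendsto_natCast_div_add_atTop 1
    have h5 : Tendsto (fun k : ℕ => a / ((k : ℝ) + 1)) atTop (𝓝 0) :=
      tendsto_const_nhds.div_atTop
      (tendsto_natCast_atTop_atTop.atTop_add tendsto_const_nhds)
    have h6 := (h2.mul h4).add h5
    rw [mul_one, add_zero] at h6
    refine h6.congr' ?_
    filter_upwards [eventually_gt_atTop 0] with k hk
    rw [Finset.sum_range_succ', psum]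
    simp only [initialAge]
    have : (k : ℝ) ≠ 0 := by positivity
    push_cast
    field_simp
  refine (h3.add h1).congr fun k => ?_
  rw [Finset.sum_add_distrib, psum]
  ring

lemma integrable_peak (h : IsRenewalCycle P y g) (a : ℝ) (l : ℕ) :
    Integrable (fun ω => initialAge (fun i => g i ω) a l + y l ω) P := by
  cases l with
  | zero => exact (integrable_const a).add (h.integrable_length' 0)
  | succ l => exact (h.integrable_age l).add (h.integrable_length' (l + 1))

lemma ident_pair (h : IsRenewalCycle P y g) (l : ℕ) :
    IdentDistrib (fun ω => ((y l ω, g l ω), (y (l + 1) ω, g (l + 1) ω)))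
      (fun ω => ((y 0 ω, g 0 ω), (y 1 ω, g 1 ω))) P P :=
  (h.ident l).prodMk ((h.ident (l + 1)).trans (h.ident 1).symm) (h.indep.indepFun (by simp))
    (h.indep.indepFun (by simp))

/-- From index 1 on, a peak adds the age left by one cycle to the length of the next, so its law no
longer depends on the index. All limits of laws, means and variances are therefore limits of
eventually constant sequences. -/
lemma ident_peak (h : IsRenewalCycle P y g) (a : ℝ) (l : ℕ) :
    IdentDistrib (fun ω => initialAge (fun i => g i ω) a (l + 1) + y (l + 1) ω)
      (fun ω => g 0 ω + y 1 ω) P P :=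
  (h.ident_pair l).comp (u := fun z : (ℝ × ℝ) × (ℝ × ℝ) => z.1.2 + z.2.1) (by fun_prop)

lemma integral_peak (h : IsRenewalCycle P y g) :
    ∫ ω, g 0 ω + y 1 ω ∂P = ∫ ω, g 0 ω ∂P + ∫ ω, y 0 ω ∂P := by
  rw [integral_add (h.integrable_age 0) (h.integrable_length' 1), h.integral_length 1]

lemma tendsto_integral_peak (h : IsRenewalCycle P y g) (a : ℝ) :
    Tendsto (fun l : ℕ => ∫ ω, initialAge (fun i => g i ω) a l + y l ω ∂P) atTop
      (𝓝 (∫ ω, g 0 ω ∂P + ∫ ω, y 0 ω ∂P)) := by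
  rw [← tendsto_add_atTop_iff_nat 1]
  refine tendsto_const_nhds.congr fun l => ?_
  rw [(h.ident_peak a l).integral_eq, h.integral_peak]

lemma tendstoInDistribution_peak (h : IsRenewalCycle P y g) (a : ℝ) {ν : Measure ℝ}
    [IsProbabilityMeasure ν] (hν : P.map (fun ω => g 0 ω + y 1 ω) = ν) :
    TendstoInDistribution (fun (l : ℕ) ω => initialAge (fun i => g i ω) a l + y l ω) atTop
      (fun x : ℝ => x) (fun _ => P) ν where
  forall_aemeasurable l := (h.measurable_peak a l).aemeasurable
  aemeasurable_limit := aemeasurable_id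
  tendsto := by
    refine tendsto_const_nhds.congr' ?_
    filter_upwards [eventually_gt_atTop 0] with l hl
    obtain ⟨k, rfl⟩ := Nat.exists_eq_succ_of_ne_zero hl.ne'
    refine Subtype.ext ?_
    exact Measure.map_id.trans (hν.symm.trans (h.ident_peak a k).map_eq.symm)

/-! #### Second moments -/

lemma memLp_peak (h : IsRenewalCycle P y g) (h2 : MemLp (y 0) 2 P) (a : ℝ) (l : ℕ) :
    MemLp (fun ω => initialAge (fun i => g i ω) a l + y l ω) 2 P := by
  cases l with
  | zero => exact (memLp_const a).add (h.memLp_length h2 0)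
  | succ l => exact (h.memLp_age h2 l).add (h.memLp_length h2 (l + 1))

/-- The two summands belong to different cycles and are independent, although age and length of the
same cycle are not assumed to be. -/
lemma variance_peak (h : IsRenewalCycle P y g) (h2 : MemLp (y 0) 2 P) :
    variance (fun ω => g 0 ω + y 1 ω) P = variance (g 0) P + variance (y 0) P := by
  rw [← (h.ident_length 1).variance_eq]
  exact IndepFun.variance_add (h.memLp_age h2 0) (h.memLp_length h2 1)
    (h.indep_age_length (by simp))

lemma tendsto_variance_peak (h : IsRenewalCycle P y g) (h2 : MemLp (y 0) 2 P) (a : ℝ) :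
    Tendsto (fun l : ℕ => variance (fun ω => initialAge (fun i => g i ω) a l + y l ω) P) atTop
      (𝓝 (variance (g 0) P + variance (y 0) P)) := by
  rw [← tendsto_add_atTop_iff_nat 1]
  refine tendsto_const_nhds.congr fun l => ?_
  rw [(h.ident_peak a l).variance_eq, h.variance_peak h2]

/-- The expected integral of the age over a cycle. -/
def meanReward (P : Measure Ω) (y g : ℕ → Ω → ℝ) : ℝ :=
  (∫ ω, g 0 ω ∂P) * ∫ ω, y 0 ω ∂P + (∫ ω, y 0 ω ^ 2 ∂P) / 2

lemma integrable_age_mul_length (h : IsRenewalCycle P y g) (l : ℕ) :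
    Integrable (fun ω => g l ω * y (l + 1) ω) P :=
  (h.indep_age_length l.succ_ne_self.symm).integrable_mul (h.integrable_age l)
    (h.integrable_length' (l + 1))

/-- The mixed term is a product of independent integrable variables; the second moment serves only
the square of the length. -/
lemma integrable_reward (h : IsRenewalCycle P y g) (h2 : MemLp (y 0) 2 P) (a : ℝ) (l : ℕ) :
    Integrable (fun ω => reward (fun i => y i ω) (fun i => g i ω) a l) P := by
  refine Integrable.add ?_ ((h.memLp_length h2 l).integrable_sq.div_const 2)
  cases l with
  | zero => exact (h.integrable_length' 0).const_mul a
  | succ l => exact h.integrable_age_mul_length l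

lemma integral_reward (h : IsRenewalCycle P y g) (h2 : MemLp (y 0) 2 P) (a : ℝ) (l : ℕ) :
    ∫ ω, reward (fun i => y i ω) (fun i => g i ω) a (l + 1) ∂P = meanReward P y g := by
  have h3 : IdentDistrib (fun ω => y (l + 1) ω ^ 2) (fun ω => y 0 ω ^ 2) P P :=
    (h.ident_length (l + 1)).comp (u := fun x => x ^ 2) (by fun_prop)
  simp only [reward, initialAge]
  rw [integral_add (h.integrable_age_mul_length l)
      ((h.memLp_length h2 (l + 1)).integrable_sq.div_const 2),
    (h.indep_age_length l.succ_ne_self.symm).integral_fun_mul_eq_mul_integral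
      (h.measurable_age l).aestronglyMeasurable (h.measurable_length _).aestronglyMeasurable,
    integral_div, h3.integral_eq, h.integral_age, h.integral_length, meanReward]

/-- The integrals of the age over the cycles have an almost sure average. -/
lemma ae_tendsto_reward (h : IsRenewalCycle P y g) (h2 : MemLp (y 0) 2 P) (a : ℝ) :
    ∀ᵐ ω ∂P, Tendsto (fun n : ℕ => (∑ l ∈ Finset.range n,
      reward (fun i => y i ω) (fun i => g i ω) a l) / n) atTop (𝓝 (meanReward P y g)) := by
  set f : ℕ → Ω → ℝ := fun l ω => reward (fun i => y i ω) (fun i => g i ω) a (l + 1) with hf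
  have hu : Measurable fun z : (ℝ × ℝ) × (ℝ × ℝ) => z.1.2 * z.2.1 + z.2.1 ^ 2 / 2 := by fun_prop
  have hid : ∀ k l, IdentDistrib (f k) (f l) P P := fun k l =>
    ((h.ident_pair k).trans (h.ident_pair l).symm).comp hu
  have hm : ∀ i, Measurable fun ω => (y i ω, g i ω) := fun i =>
    (h.measurable_length i).prodMk (h.measurable_age i)
  -- The shifted reward `f l` involves only the cycles l and l + 1, so rewards whose indices differ
  -- by at least two are independent.
  have hind : ∀ k l, k + 1 < l → f k ⟂ᵢ[P] f l := fun k l hkl =>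
    (h.indep.indepFun_prodMk_prodMk hm k (k + 1) l (l + 1) (by omega) (by omega) (by omega)
      (by omega)).comp hu hu
  have hind' : ∀ k l, (k + 1 < l ∨ l + 1 < k) → f k ⟂ᵢ[P] f l := fun k l hkl =>
    hkl.elim (hind k l) fun h => (hind l k h).symm
  have he := strong_law_ae_real (fun n => f (2 * n)) (h.integrable_reward h2 a _)
    (fun i j hij => hind' _ _ (by omega)) fun i => hid _ _
  have ho := strong_law_ae_real (fun n => f (2 * n + 1)) (h.integrable_reward h2 a _)
    (fun i j hij => hind' _ _ (by omega)) fun i => hid _ _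
  filter_upwards [he, ho] with ω h3 h4
  have h5 := tendsto_average_of_even_odd (f := fun l => f l ω)
    (h3.trans_eq (congrArg 𝓝 (h.integral_reward h2 a _)))
    (h4.trans_eq (congrArg 𝓝 (h.integral_reward h2 a _)))
  rw [← tendsto_add_atTop_iff_nat 1]
  have h6 : Tendsto (fun k : ℕ => (k : ℝ) / (k + 1)) atTop (𝓝 1) :=
    tendsto_natCast_div_add_atTop 1
  have h7 : Tendsto (fun k : ℕ => reward (fun i => y i ω) (fun i => g i ω) a 0 / ((k : ℝ) + 1))
      atTop (𝓝 0) := tendsto_const_nhds.div_atTop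
      (tendsto_natCast_atTop_atTop.atTop_add tendsto_const_nhds)
  have h8 := (h5.mul h6).add h7
  rw [mul_one, add_zero] at h8
  refine h8.congr' ?_
  filter_upwards [eventually_gt_atTop 0] with k hk
  rw [Finset.sum_range_succ']
  have : (k : ℝ) ≠ 0 := by positivity
  push_cast
  field_simp
  rfl

/-- The age has an almost sure time average. -/
lemma ae_tendsto_average_age (h : IsRenewalCycle P y g) (h2 : MemLp (y 0) 2 P) {a : ℝ}
    (ha : 0 ≤ a) :
    ∀ᵐ ω ∂P, Tendsto (fun t : ℝ =>
      1 / t * ∫ u in (0 : ℝ)..t, cyclicAge (fun i => y i ω) (fun i => g i ω) a u) atTop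
      (𝓝 (meanReward P y g / ∫ ω, y 0 ω ∂P)) := by
  filter_upwards [h.ae_goodGaps, h.age_nonneg, h.age_le, h.ae_tendsto_length,
    h.ae_tendsto_reward h2 a] with ω h3 h4 h5 h6 h7
  refine tendsto_average_of_cycles h3 (fun t ht => ?_)
    (fun s t => integral_cyclicAge_mono h3 h4 h5 ha) h.integral_length_pos h6 ?_
  · exact intervalIntegral.integral_nonneg ht fun u hu =>
      (cyclicAge_mem_Icc h3 h4 h5 ha hu.1).1
  · simpa only [integral_cycles h3.pos h4 h5 ha] using h7

end IsRenewalCycle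

end ConventionalBuffer

end

noncomputable section

namespace ConventionalBuffer

namespace IsRenewalCycle

variable {Ω : Type*} [MeasurableSpace Ω] {P : Measure Ω} [IsProbabilityMeasure P] {y g : ℕ → Ω → ℝ}

/-! #### Large deviations of the completion times -/

/-- The right derivative of θ ↦ E[e^{-θY}] at 0 is -E[Y]. For c < E[Y] some θ > 0 thus satisfies
E[e^{-θY}] ≤ 1 - cθ ≤ e^{-cθ}. A finite mean suffices, since Y ≥ 0. -/
lemma exists_mgf_le (h : IsRenewalCycle P y g) {c : ℝ} (hc : c < ∫ ω, y 0 ω ∂P) :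
    ∃ θ, 0 < θ ∧ mgf (y 0) P (-θ) ≤ Real.exp (-(c * θ)) := by
  have hm := (h.measurable_length 0).aemeasurable (μ := P)
  set μ := P.map (y 0) with hμ
  have : IsProbabilityMeasure μ := Measure.isProbabilityMeasure_map hm
  have h0 : μ (Set.Iio 0) = 0 := by
    rw [hμ, Measure.map_apply (h.measurable_length 0) measurableSet_Iio]
    refine measure_eq_zero_iff_ae_notMem.2 ?_
    filter_upwards [h.pos] with ω h1
    simp [(h1 0).le]
  have h1 : Integrable (fun x : ℝ => x) μ :=
    (integrable_map_measure (by fun_prop) hm).2 h.integrable_length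
  have hd := hasDerivWithinAt_integral_pow_mul_exp (μ := μ) h0 (k := 0) (by simp) (by simpa using h1)
    (le_refl (0 : ℝ))
  rw [hasDerivWithinAt_iff_tendsto_slope, Set.Ici_sdiff_left] at hd
  have hmean : -∫ x, x ^ (0 + 1) * Real.exp (-0 * x) ∂μ < -c := by
    have : ∫ x, x ^ (0 + 1) * Real.exp (-0 * x) ∂μ = ∫ ω, y 0 ω ∂P := by
      rw [hμ, integral_map hm (by fun_prop)]
      simp
    rw [this]
    exact neg_lt_neg hc
  obtain ⟨θ, hθ, hpos⟩ := ((hd.eventually_lt_const hmean).and self_mem_nhdsWithin).exists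
  refine ⟨θ, hpos, ?_⟩
  have hmgf : mgf (y 0) P (-θ) = ∫ x, x ^ 0 * Real.exp (-θ * x) ∂μ := by
    rw [hμ, integral_map hm (by fun_prop)]
    simp [mgf]
  have hone : ∫ x, x ^ 0 * Real.exp (-0 * x) ∂μ = 1 := by simp
  rw [slope_def_field, hone, ← hmgf, sub_zero, div_lt_iff₀ hpos] at hθ
  have := Real.add_one_le_exp (-(c * θ))
  linarith

/-- The number of completions by time `t` exceeds its mean substantially only with an exponentially
small probability. -/
lemma exists_measureReal_psum_le (h : IsRenewalCycle P y g) {b : ℝ}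
    (hb : 1 / ∫ ω, y 0 ω ∂P < b) :
    ∃ η, 0 < η ∧ ∀ t, ∀ n : ℕ, b * t ≤ n →
      P.real {ω | psum (fun i => y i ω) n ≤ t} ≤ Real.exp (-(η * t)) := by
  set m := ∫ ω, y 0 ω ∂P
  have hm : 0 < m := h.integral_length_pos
  have hb0 : 0 < b := (one_div_pos.2 hm).trans hb
  have hbm : 1 / b < m := by
    rw [div_lt_iff₀ hm] at hb
    rwa [div_lt_iff₀ hb0, mul_comm]
  obtain ⟨c, hc1, hc2⟩ := exists_between hbm
  obtain ⟨θ, hθ, hle⟩ := h.exists_mgf_le hc2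
  rw [div_lt_iff₀ hb0] at hc1
  have hc0 : 0 < c := by
    by_contra! hc0
    nlinarith
  -- The Chernoff exponent is θt - ncθ, which for n ≥ bt is at most -θ(cb - 1)t; the choice 1/b < c
  -- makes this rate positive.
  refine ⟨θ * (c * b - 1), mul_pos hθ (by linarith), fun t n hn => ?_⟩
  have hpos : ∀ᵐ ω ∂P, 0 ≤ psum (fun i => y i ω) n := by
    filter_upwards [h.pos] with ω h1 using psum_nonneg (fun i => (h1 i).le) n
  have hmeas : Measurable fun ω => psum (fun i => y i ω) n :=
    Finset.measurable_sum _ fun i _ => h.measurable_length i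
  have hint : Integrable (fun ω => Real.exp (-θ * psum (fun i => y i ω) n)) P := by
    refine (integrable_const (1 : ℝ)).mono'
      (Real.measurable_exp.comp (hmeas.const_mul _)).aestronglyMeasurable ?_
    filter_upwards [hpos] with ω h1
    rw [Real.norm_of_nonneg (Real.exp_pos _).le, Real.exp_le_one_iff]
    nlinarith
  have hsum : mgf (fun ω => psum (fun i => y i ω) n) P (-θ) = mgf (y 0) P (-θ) ^ n := by
    have h2 : (∑ i ∈ Finset.range n, y i) = fun ω => psum (fun i => y i ω) n := by
      ext ω
      simp [psum]
    rw [← h2, h.indep_length.mgf_sum h.measurable_length, Finset.prod_congr rfl fun i _ =>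
      congrFun (mgf_congr_identDistrib (h.ident_length i)) (-θ)]
    simp
  have hch := measure_le_le_exp_mul_mgf (μ := P) (X := fun ω => psum (fun i => y i ω) n)
    (t := -θ) t (by linarith) hint
  refine hch.trans ?_
  rw [hsum]
  calc Real.exp (- -θ * t) * mgf (y 0) P (-θ) ^ n
      ≤ Real.exp (- -θ * t) * Real.exp (-(c * θ)) ^ n := by
        gcongr
        exact mgf_nonneg
    _ = Real.exp (θ * t - n * (c * θ)) := by
        rw [← Real.exp_nat_mul, ← Real.exp_add]
        congr 1
        ring
    _ ≤ Real.exp (-(θ * (c * b - 1) * t)) := by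
        rw [Real.exp_le_exp]
        have := mul_le_mul_of_nonneg_right hn (mul_pos hc0 hθ).le
        linarith

/-! #### The expected age -/

/-- A jointly measurable version of the age, which is bounded on bounded intervals. -/
def measurableAge {Ω : Type*} (y g : ℕ → Ω → ℝ) (a : ℝ) (z : ℝ × Ω) : ℝ :=
  max 0 (min (z.1 + a) (z.1 - lastUpdate (fun i => y i z.2) (fun i => g i z.2) a
    (passIdx z.1 fun i => y i z.2)))

lemma measurable_measurableAge (h : IsRenewalCycle P y g) (a : ℝ) :
    Measurable (measurableAge y g a) := by
  have hy : Measurable fun ω => fun i => y i ω := measurable_pi_lambda _ h.measurable_length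
  have h1 : Measurable fun z : ℝ × Ω => lastUpdate (fun i => y i z.2) (fun i => g i z.2) a
      (passIdx z.1 fun i => y i z.2) := by
    refine (measurable_from_prod_countable_right (f := fun w : ℕ × (ℝ × Ω) =>
      lastUpdate (fun i => y i w.2.2) (fun i => g i w.2.2) a w.1) fun n => ?_).comp
      ((measurable_passIdx.comp (measurable_fst.prodMk (hy.comp measurable_snd))).prodMk
        measurable_id)
    cases n with
    | zero => exact measurable_const
    | succ n =>
      exact (((measurable_psum (n + 1)).comp hy).sub (h.measurable_age n)).comp measurable_snd
  exact measurable_const.max ((measurable_fst.add_const a).min (measurable_fst.sub h1))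

lemma ae_measurableAge_eq (h : IsRenewalCycle P y g) {a : ℝ} (ha : 0 ≤ a) :
    ∀ᵐ ω ∂P, ∀ t, 0 ≤ t →
      measurableAge y g a (t, ω) = cyclicAge (fun i => y i ω) (fun i => g i ω) a t := by
  filter_upwards [h.ae_goodGaps, h.age_nonneg, h.age_le] with ω h1 h2 h3 t ht
  have h4 := h1.mem_passSet ht
  have h5 := cyclicAge_mem_Icc h1 h2 h3 ha ht
  rw [measurableAge, ← cyclicAge_eq h1.pos h2 h3 ha (Or.inr h4.1) h4.2, min_eq_right h5.2,
    max_eq_right h5.1]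

lemma measurableAge_mem_Icc {Ω : Type*} (y g : ℕ → Ω → ℝ) {a : ℝ} (ha : 0 ≤ a) {t : ℝ} (ht : 0 ≤ t) (ω : Ω) :
    measurableAge y g a (t, ω) ∈ Set.Icc 0 (t + a) :=
  ⟨le_max_left _ _, max_le (add_nonneg ht ha) (min_le_left _ _)⟩

lemma integrable_cyclicAge (h : IsRenewalCycle P y g) {a : ℝ} (ha : 0 ≤ a) {t : ℝ} (ht : 0 ≤ t) :
    Integrable (fun ω => cyclicAge (fun i => y i ω) (fun i => g i ω) a t) P := by
  have h1 : Integrable (fun ω => measurableAge y g a (t, ω)) P := by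
    refine (integrable_const (t + a)).mono'
      ((h.measurable_measurableAge a).comp measurable_prodMk_left).aestronglyMeasurable ?_
    refine ae_of_all _ fun ω => ?_
    have := measurableAge_mem_Icc y g ha ht ω
    rw [Real.norm_of_nonneg this.1]
    exact this.2
  refine h1.congr ?_
  filter_upwards [h.ae_measurableAge_eq ha] with ω h2 using h2 t ht

lemma integrable_measurableAge (h : IsRenewalCycle P y g) {a : ℝ} (ha : 0 ≤ a) {t : ℝ} :
    Integrable (measurableAge y g a) ((volume.restrict (Set.Ioc 0 t)).prod P) := by
  refine (integrable_const (t + a)).mono' (h.measurable_measurableAge a).aestronglyMeasurable ?_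
  have h1 : ∀ᵐ z ∂((volume.restrict (Set.Ioc 0 t)).prod P), z.1 ∈ Set.Ioc 0 t :=
    Measure.quasiMeasurePreserving_fst.ae (ae_restrict_mem measurableSet_Ioc)
  filter_upwards [h1] with z hz
  have := measurableAge_mem_Icc y g ha hz.1.le z.2
  rw [Real.norm_of_nonneg this.1]
  exact this.2.trans (by linarith [hz.2])

/-- The integral of the age up to time `t`. -/
def totalAge {Ω : Type*} (y g : ℕ → Ω → ℝ) (a t : ℝ) (ω : Ω) : ℝ :=
  ∫ u in (0 : ℝ)..t, cyclicAge (fun i => y i ω) (fun i => g i ω) a u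

lemma totalAge_ae_eq (h : IsRenewalCycle P y g) {a : ℝ} (ha : 0 ≤ a) {t : ℝ} (ht : 0 ≤ t) :
    (fun ω => ∫ u in Set.Ioc 0 t, measurableAge y g a (u, ω)) =ᵐ[P] totalAge y g a t := by
  filter_upwards [h.ae_measurableAge_eq ha] with ω h1
  rw [totalAge, intervalIntegral.integral_of_le ht]
  exact setIntegral_congr_fun measurableSet_Ioc fun u hu => h1 u hu.1.le

lemma integrable_totalAge (h : IsRenewalCycle P y g) {a : ℝ} (ha : 0 ≤ a) {t : ℝ} (ht : 0 ≤ t) :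
    Integrable (totalAge y g a t) P :=
  (h.integrable_measurableAge ha).integral_prod_right.congr (h.totalAge_ae_eq ha ht)

lemma integral_totalAge (h : IsRenewalCycle P y g) {a : ℝ} (ha : 0 ≤ a) {t : ℝ} (ht : 0 ≤ t) :
    ∫ u in (0 : ℝ)..t, ∫ ω, cyclicAge (fun i => y i ω) (fun i => g i ω) a u ∂P
      = ∫ ω, totalAge y g a t ω ∂P := by
  rw [← integral_congr_ae (h.totalAge_ae_eq ha ht),
    ← integral_integral_swap (f := fun u ω => measurableAge y g a (u, ω))
      (h.integrable_measurableAge ha), intervalIntegral.integral_of_le ht]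
  refine setIntegral_congr_fun measurableSet_Ioc fun u hu => integral_congr_ae ?_
  filter_upwards [h.ae_measurableAge_eq ha] with ω h1 using (h1 u hu.1.le).symm

lemma intervalIntegrable_integral_cyclicAge (h : IsRenewalCycle P y g) {a : ℝ} (ha : 0 ≤ a) {t : ℝ}
    (ht : 0 ≤ t) :
    IntervalIntegrable (fun u => ∫ ω, cyclicAge (fun i => y i ω) (fun i => g i ω) a u ∂P)
      volume 0 t := by
  rw [intervalIntegrable_iff_integrableOn_Ioc_of_le ht]
  refine Integrable.congr (h.integrable_measurableAge ha (t := t)).integral_prod_left ?_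
  filter_upwards [ae_restrict_mem measurableSet_Ioc] with u hu
  refine integral_congr_ae ?_
  filter_upwards [h.ae_measurableAge_eq ha] with ω h1 using h1 u hu.1.le

/-- If the first n cycles outlast `t`, their rewards bound the integral; otherwise the crude bound
t(t + a) is used. -/
lemma totalAge_le (h : IsRenewalCycle P y g) {a : ℝ} (ha : 0 ≤ a) {t : ℝ} (ht : 0 ≤ t) (n : ℕ) :
    ∀ᵐ ω ∂P, totalAge y g a t ω ≤
      ∑ l ∈ Finset.range n, reward (fun i => y i ω) (fun i => g i ω) a l
        + {ω | psum (fun i => y i ω) n ≤ t}.indicator (fun _ => t * (t + a)) ω := by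
  filter_upwards [h.ae_goodGaps, h.age_nonneg, h.age_le] with ω h1 h2 h3
  have h5 : 0 ≤ ∑ l ∈ Finset.range n, reward (fun i => y i ω) (fun i => g i ω) a l :=
    Finset.sum_nonneg fun l _ => reward_nonneg h1.pos h2 ha l
  rcases le_or_gt (psum (fun i => y i ω) n) t with h4 | h4
  · rw [Set.indicator_of_mem (by exact h4)]
    refine le_add_of_nonneg_of_le h5 ?_
    calc totalAge y g a t ω ≤ ∫ _ in (0 : ℝ)..t, t + a := by
          refine intervalIntegral.integral_mono_on ht (intervalIntegrable_cyclicAge h1 h2 h3 ha t)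
            (by simp) fun u hu => ?_
          exact (cyclicAge_mem_Icc h1 h2 h3 ha hu.1).2.trans (by linarith [hu.2])
      _ = t * (t + a) := by simp [mul_add]
  · rw [Set.indicator_of_notMem (by simpa using h4), add_zero, ← integral_cycles h1.pos h2 h3 ha]
    exact integral_cyclicAge_mono h1 h2 h3 ha ht h4.le

lemma meanReward_nonneg (h : IsRenewalCycle P y g) : 0 ≤ meanReward P y g := by
  have h1 : 0 ≤ ∫ ω, g 0 ω ∂P := integral_nonneg_of_ae (by
    filter_upwards [h.age_nonneg] with ω h1 using h1 0)
  have h2 := h.integral_length_pos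
  have h3 : 0 ≤ ∫ ω, y 0 ω ^ 2 ∂P := integral_nonneg fun ω => sq_nonneg _
  unfold meanReward
  positivity

/-- The first reward is set apart because it alone involves the initial age; the other rewards all
have mean `meanReward`. -/
lemma integral_totalAge_le (h : IsRenewalCycle P y g) (h2 : MemLp (y 0) 2 P) {a : ℝ} (ha : 0 ≤ a)
    {t : ℝ} (ht : 0 ≤ t) (n : ℕ) :
    ∫ ω, totalAge y g a t ω ∂P ≤ ∫ ω, reward (fun i => y i ω) (fun i => g i ω) a 0 ∂P
      + n * meanReward P y g + t * (t + a) * P.real {ω | psum (fun i => y i ω) n ≤ t} := by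
  have hmeas : MeasurableSet {ω | psum (fun i => y i ω) n ≤ t} :=
    measurableSet_le (Finset.measurable_sum _ fun i _ => h.measurable_length i) measurable_const
  have hi1 : Integrable (fun ω => ∑ l ∈ Finset.range n,
      reward (fun i => y i ω) (fun i => g i ω) a l) P :=
    integrable_finsetSum _ fun l _ => h.integrable_reward h2 a l
  have hi2 : Integrable ({ω | psum (fun i => y i ω) n ≤ t}.indicator fun _ => t * (t + a)) P :=
    (integrable_const _).indicator hmeas
  have h0 : 0 ≤ ∫ ω, reward (fun i => y i ω) (fun i => g i ω) a 0 ∂P := integral_nonneg_of_ae (by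
    filter_upwards [h.pos, h.age_nonneg] with ω h1 h2 using reward_nonneg h1 h2 ha 0)
  have h3 : ∫ ω, ∑ l ∈ Finset.range n, reward (fun i => y i ω) (fun i => g i ω) a l ∂P ≤
      ∫ ω, reward (fun i => y i ω) (fun i => g i ω) a 0 ∂P + n * meanReward P y g := by
    rw [integral_finsetSum _ fun l _ => h.integrable_reward h2 a l]
    cases n with
    | zero => simpa using h0
    | succ n =>
      rw [Finset.sum_range_succ', Finset.sum_congr rfl fun l _ => h.integral_reward h2 a l]
      have := h.meanReward_nonneg
      simp only [Finset.sum_const, Finset.card_range, nsmul_eq_mul]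
      push_cast
      linarith
  refine (integral_mono_ae (h.integrable_totalAge ha ht) (hi1.add hi2)
    (h.totalAge_le ha ht n)).trans ?_
  rw [integral_add' hi1 hi2, integral_indicator_const _ hmeas, smul_eq_mul]
  linarith

/-- The renewal reward theorem for the expected age. -/
lemma tendsto_integral_average_age (h : IsRenewalCycle P y g) (h2 : MemLp (y 0) 2 P) {a : ℝ}
    (ha : 0 ≤ a) :
    Tendsto (fun t : ℝ => 1 / t * ∫ ω, totalAge y g a t ω ∂P) atTop
      (𝓝 (meanReward P y g / ∫ ω, y 0 ω ∂P)) := by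
  set m := ∫ ω, y 0 ω ∂P with hm
  set ρ := meanReward P y g with hρ
  refine tendsto_order.2 ⟨fun c hc => ?_, fun c hc => ?_⟩
  -- Lower bound: truncating the average at its almost sure limit makes dominated convergence
  -- applicable and only decreases the expectation.
  · have hlim : Tendsto (fun t : ℝ => ∫ ω, min (1 / t * totalAge y g a t ω) (ρ / m) ∂P) atTop
        (𝓝 (∫ _, ρ / m ∂P)) := by
      refine tendsto_integral_filter_of_dominated_convergence (fun _ => ρ / m) ?_ ?_
        (integrable_const _) ?_
      · filter_upwards [eventually_ge_atTop 0] with t ht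
        exact ((h.integrable_totalAge ha ht).const_mul _).aestronglyMeasurable.inf
          aestronglyMeasurable_const
      · filter_upwards [eventually_ge_atTop 0] with t ht
        filter_upwards [h.ae_goodGaps, h.age_nonneg, h.age_le] with ω h3 h4 h5
        have h6 : 0 ≤ totalAge y g a t ω := intervalIntegral.integral_nonneg ht fun u hu =>
          (cyclicAge_mem_Icc h3 h4 h5 ha hu.1).1
        rw [Real.norm_of_nonneg (le_min (by positivity)
          (div_nonneg h.meanReward_nonneg h.integral_length_pos.le))]
        exact min_le_right _ _
      · filter_upwards [h.ae_tendsto_average_age h2 ha] with ω h3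
        have := h3.min (tendsto_const_nhds (x := ρ / m))
        rwa [min_self] at this
    rw [integral_const, probReal_univ, one_smul] at hlim
    filter_upwards [hlim.eventually_const_lt hc, eventually_ge_atTop 0] with t ht ht0
    refine ht.trans_le ?_
    rw [← integral_const_mul]
    have hi := (h.integrable_totalAge ha ht0).const_mul (1 / t)
    exact integral_mono (hi.inf (integrable_const _)) hi fun ω => min_le_left _ _
  -- Upper bound: choose b slightly above 1/m and compare with the first ⌈bt⌉ cycles. They
  -- contribute about bρt, and by the Chernoff estimate they end by time `t` only with exponentially
  -- small probability.
  · have hb : ∀ᶠ b in 𝓝[>] (1 / m), b * ρ < c := by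
      have : Tendsto (fun b : ℝ => b * ρ) (𝓝[>] (1 / m)) (𝓝 (1 / m * ρ)) :=
        ((continuous_id.mul continuous_const).tendsto _).mono_left nhdsWithin_le_nhds
      exact this.eventually_lt_const (by rwa [one_div_mul_eq_div])
    obtain ⟨b, hbc, hb⟩ := (hb.and self_mem_nhdsWithin).exists
    obtain ⟨η, hη, hP⟩ := h.exists_measureReal_psum_le hb
    set r := ∫ ω, reward (fun i => y i ω) (fun i => g i ω) a 0 ∂P
    have hb0 : 0 < b := (one_div_pos.2 h.integral_length_pos).trans hb
    -- The crude bound t(t + a), weighted with e^{-ηt} and divided by t.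
    have hexp : Tendsto (fun t : ℝ => t * Real.exp (-(η * t)) + a * Real.exp (-(η * t))) atTop
        (𝓝 (0 + a * 0)) := by
      have h3 := Real.tendsto_pow_mul_exp_neg_atTop_nhds_zero 1
      have h4 := h3.comp (tendsto_id.const_mul_atTop hη)
      have h5 := (h4.const_mul η⁻¹)
      rw [mul_zero] at h5
      refine (h5.congr fun t => ?_).add (Tendsto.const_mul a ?_)
      · simp only [Function.comp, id, pow_one]
        field_simp
      · exact Real.tendsto_exp_neg_atTop_nhds_zero.comp (tendsto_id.const_mul_atTop hη)
    have hup : Tendsto (fun t : ℝ => (r + ρ) / t + b * ρ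
        + (t * Real.exp (-(η * t)) + a * Real.exp (-(η * t)))) atTop (𝓝 (0 + b * ρ + (0 + a * 0))) :=
      ((tendsto_const_nhds.div_atTop tendsto_id).add tendsto_const_nhds).add hexp
    rw [zero_add, mul_zero, add_zero, add_zero] at hup
    filter_upwards [hup.eventually_lt_const hbc, eventually_gt_atTop 0] with t ht ht0
    refine lt_of_le_of_lt ?_ ht
    have h3 := h.integral_totalAge_le h2 ha ht0.le ⌈b * t⌉₊
    have h4 := hP t ⌈b * t⌉₊ (Nat.le_ceil _)
    have h5 := (Nat.ceil_lt_add_one (mul_pos hb0 ht0).le).le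
    have h6 : ∫ ω, totalAge y g a t ω ∂P ≤
        r + (b * t + 1) * ρ + t * (t + a) * Real.exp (-(η * t)) := by
      refine h3.trans ?_
      have := h.meanReward_nonneg
      gcongr
    calc 1 / t * ∫ ω, totalAge y g a t ω ∂P
        ≤ 1 / t * (r + (b * t + 1) * ρ + t * (t + a) * Real.exp (-(η * t))) := by gcongr
      _ = _ := by field_simp; ring

end IsRenewalCycle

end ConventionalBuffer

end

noncomputable section

namespace ConventionalBuffer

/-! ### Moments of a service cycle -/

section Moments

variable (lam : ℝ) [hlam : Fact (0 < lam)] {μH μV : Measure ℝ} [IsProbabilityMeasure μH]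
  [IsProbabilityMeasure μV]

/-- The joint law of the length of a string of vacations and of the waiting time of the packet
found at its end. -/
def stringLaw (lam : ℝ) [Fact (0 < lam)] (μV : Measure ℝ) [IsProbabilityMeasure μV] :
    Measure (ℝ × ℝ) :=
  (vacLaw lam μV).map fun z => (vacOut z).1

lemma measurable_stringOut : Measurable fun z => (vacOut z).1 :=
  measurable_fst.comp measurable_vacOut

instance : IsProbabilityMeasure (stringLaw lam μV) :=
  Measure.isProbabilityMeasure_map measurable_stringOut.aemeasurable

lemma integrable_stringLaw {f : ℝ × ℝ → ℝ} (hf : Measurable f) :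
    Integrable f (stringLaw lam μV) ↔ Integrable (fun z => f (vacOut z).1) (vacLaw lam μV) :=
  integrable_map_measure hf.aestronglyMeasurable measurable_stringOut.aemeasurable

lemma integral_stringLaw {f : ℝ × ℝ → ℝ} (hf : Measurable f) :
    ∫ x, f x ∂(stringLaw lam μV) = ∫ z, f (vacOut z).1 ∂(vacLaw lam μV) :=
  integral_map measurable_stringOut.aemeasurable hf.aestronglyMeasurable

variable {α : Type*} [MeasurableSpace α] {μ : Measure α} [IsProbabilityMeasure μ]

lemma integrable_add_prod {u : α → ℝ} (hu : Integrable u μ) (hH : Integrable (fun x : ℝ => x) μH) :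
    Integrable (fun z : α × ℝ => u z.1 + z.2) (μ.prod μH) :=
  (hu.comp_fst μH).add (hH.comp_snd μ)

lemma integral_add_prod {u : α → ℝ} (hu : Integrable u μ) (hH : Integrable (fun x : ℝ => x) μH) :
    ∫ z, u z.1 + z.2 ∂(μ.prod μH) = ∫ x, u x ∂μ + ∫ x, x ∂μH := by
  rw [integral_add (hu.comp_fst μH) (hH.comp_snd μ), integral_fun_fst, integral_fun_snd (fun x => x)]
  simp

lemma memLp_add_prod {u : α → ℝ} (hu : MemLp u 2 μ) (hH : MemLp (fun x : ℝ => x) 2 μH) :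
    MemLp (fun z : α × ℝ => u z.1 + z.2) 2 (μ.prod μH) :=
  (hu.comp_fst μH).add (hH.comp_snd μ)

lemma variance_add_prod {u : α → ℝ} (hu : MemLp u 2 μ) (hH : MemLp (fun x : ℝ => x) 2 μH) :
    variance (fun z : α × ℝ => u z.1 + z.2) (μ.prod μH)
      = (∫ x, u x ^ 2 ∂μ - (∫ x, u x ∂μ) ^ 2) + (∫ x, x ^ 2 ∂μH - (∫ x, x ∂μH) ^ 2) := by
  have h1 := IndepFun.variance_add (hu.comp_fst μH) (hH.comp_snd μ)
    (indepFun_prod₀ hu.aestronglyMeasurable.aemeasurable hH.aestronglyMeasurable.aemeasurable)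
  have h2 : variance (fun z : α × ℝ => u z.1) (μ.prod μH) = variance u μ := by
    rw [variance_eq_sub (hu.comp_fst μH), variance_eq_sub hu]
    simp only [Pi.pow_apply, integral_fun_fst u, integral_fun_fst fun x => u x ^ 2]
    simp
  have h3 : variance (fun z : α × ℝ => z.2) (μ.prod μH) = variance (fun x : ℝ => x) μH := by
    rw [variance_eq_sub (hH.comp_snd μ), variance_eq_sub hH]
    simp only [Pi.pow_apply, integral_fun_snd fun x : ℝ => x, integral_fun_snd fun x : ℝ => x ^ 2]
    simp
  refine h1.trans ?_
  rw [h2, h3, variance_eq_sub hu, variance_eq_sub hH]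
  rfl

end Moments

lemma memLp_id_of_integrable_sq {μ : Measure ℝ} (h : Integrable (fun x : ℝ => x ^ 2) μ) :
    MemLp (fun x : ℝ => x) 2 μ :=
  (memLp_two_iff_integrable_sq measurable_id.aestronglyMeasurable).2 h

/-! ### The service cycles of a random input -/

section RandomInput

variable {lam : ℝ} [hlam : Fact (0 < lam)] {μH μV : Measure ℝ} [IsProbabilityMeasure μH]
  [IsProbabilityMeasure μV] {Ω : Type*} [MeasurableSpace Ω] {P : Measure Ω}
  {Φ : Ω → InputSpace}

lemma map_cycleOut_zero (hΦm : Measurable Φ) (hΦ : P.map Φ = inputLaw lam μH μV) :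
    P.map (fun ω => cycleOut (Φ ω)) = (stringLaw lam μV).prod μH := by
  rw [stringLaw, ← cycleLaw_eq_prod, cycleLaw, ← hΦ, Measure.map_map measurable_cycleOut hΦm]
  rfl

lemma measurable_cycleOut_iterate (hΦm : Measurable Φ) (l : ℕ) :
    Measurable fun ω => cycleOut (cycleNext^[l] (Φ ω)) :=
  measurable_cycleOut.comp ((measurable_cycleNext.iterate l).comp hΦm)

lemma map_cycleOuts (hΦm : Measurable Φ) (hΦ : P.map Φ = inputLaw lam μH μV)
    (hH0 : μH (Set.Iio 0) = 0) (hV0 : μV (Set.Iio 0) = 0) (hVpos : μV (Set.Ioi 0) ≠ 0) :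
    P.map (fun ω l => cycleOut (cycleNext^[l] (Φ ω))) = iidSeq (cycleLaw lam μH μV) := by
  rw [← map_cycles lam hH0 hV0 hVpos, ← hΦ, Measure.map_map _ hΦm]
  · rfl
  · exact measurable_pi_lambda _ fun l => measurable_cycleOut.comp (measurable_cycleNext.iterate l)

lemma map_cycleOut_iterate (hΦm : Measurable Φ) (hΦ : P.map Φ = inputLaw lam μH μV)
    (hH0 : μH (Set.Iio 0) = 0) (hV0 : μV (Set.Iio 0) = 0) (hVpos : μV (Set.Ioi 0) ≠ 0) (l : ℕ) :
    P.map (fun ω => cycleOut (cycleNext^[l] (Φ ω))) = cycleLaw lam μH μV := by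
  have h1 := (measurePreserving_eval_infinitePi (fun _ : ℕ => cycleLaw lam μH μV) l).map_eq
  have h2 := map_cycleOuts hΦm hΦ hH0 hV0 hVpos
  rw [iidSeq] at h2
  rw [← h2, Measure.map_map (measurable_pi_apply l)
    (measurable_pi_lambda _ fun l => measurable_cycleOut_iterate hΦm l)] at h1
  exact h1

lemma iIndepFun_cycleOut [IsProbabilityMeasure P] (hΦm : Measurable Φ)
    (hΦ : P.map Φ = inputLaw lam μH μV)
    (hH0 : μH (Set.Iio 0) = 0) (hV0 : μV (Set.Iio 0) = 0) (hVpos : μV (Set.Ioi 0) ≠ 0) :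
    iIndepFun (fun l ω => cycleOut (cycleNext^[l] (Φ ω))) P := by
  rw [iIndepFun_iff_map_fun_eq_infinitePi_map (measurable_cycleOut_iterate hΦm),
    map_cycleOuts hΦm hΦ hH0 hV0 hVpos, iidSeq]
  congr 1
  funext l
  exact (map_cycleOut_iterate hΦm hΦ hH0 hV0 hVpos l).symm

lemma ae_goodInput (hΦm : Measurable Φ) (hΦ : P.map Φ = inputLaw lam μH μV)
    (hH0 : μH (Set.Iio 0) = 0) (hV0 : μV (Set.Iio 0) = 0) (hVpos : μV (Set.Ioi 0) ≠ 0) :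
    ∀ᵐ ω ∂P, GoodInput (Φ ω) := by
  refine ae_of_ae_map hΦm.aemeasurable ?_
  rw [hΦ, inputLaw, vacLaw]
  have h1 : ∀ᵐ p ∂(((iidSeq (expMeasure lam)).prod (iidSeq μV)).prod (iidSeq μH)), GoodGaps p.1.1 :=
    Measure.quasiMeasurePreserving_fst.ae (Measure.quasiMeasurePreserving_fst.ae (ae_goodGaps lam))
  have h2 : ∀ᵐ p ∂(((iidSeq (expMeasure lam)).prod (iidSeq μV)).prod (iidSeq μH)),
      GoodVacations p.1.2 :=
    Measure.quasiMeasurePreserving_fst.ae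
      (Measure.quasiMeasurePreserving_snd.ae (ae_goodVacations hV0 hVpos))
  have h3 : ∀ᵐ p ∂(((iidSeq (expMeasure lam)).prod (iidSeq μV)).prod (iidSeq μH)),
      ∀ i, 0 ≤ p.2 i := Measure.quasiMeasurePreserving_snd.ae (ae_iidSeq_nonneg hH0)
  filter_upwards [h1, h2, h3] with p h1 h2 h3
  exact ⟨h1, h2, h3⟩

lemma identDistrib_cycleOut (hΦm : Measurable Φ) (hΦ : P.map Φ = inputLaw lam μH μV)
    {f : (ℝ × ℝ) × ℝ → ℝ} (hf : Measurable f) :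
    IdentDistrib (fun ω => f (cycleOut (Φ ω))) f P ((stringLaw lam μV).prod μH) where
  aemeasurable_fst := (hf.comp (measurable_cycleOut.comp hΦm)).aemeasurable
  aemeasurable_snd := hf.aemeasurable
  map_eq := by
    rw [← map_cycleOut_zero hΦm hΦ]
    exact (Measure.map_map hf (measurable_cycleOut.comp hΦm)).symm

/-- The service cycles of a random input are independent and identically distributed. -/
lemma isRenewalCycle [IsProbabilityMeasure P] (hΦm : Measurable Φ)
    (hΦ : P.map Φ = inputLaw lam μH μV)
    (hH0 : μH (Set.Iio 0) = 0) (hV0 : μV (Set.Iio 0) = 0) (hVpos : μV (Set.Ioi 0) ≠ 0)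
    (hH1 : Integrable (fun x : ℝ => x) μH) (hV1 : Integrable (fun x : ℝ => x) μV) :
    IsRenewalCycle P (fun l ω => cycleLength (Φ ω) l) (fun l ω => cycleAge (Φ ω) l) where
  measurable_length l := by
    have h := measurable_cycleOut_iterate hΦm l
    exact h.fst.fst.add h.snd
  measurable_age l := by
    have h := measurable_cycleOut_iterate hΦm l
    exact h.fst.snd.add h.snd
  indep := (iIndepFun_cycleOut hΦm hΦ hH0 hV0 hVpos).comp
    (fun _ z => (z.1.1 + z.2, z.1.2 + z.2)) fun _ => by fun_prop
  ident l := by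
    have h : IdentDistrib (fun ω => cycleOut (cycleNext^[l] (Φ ω))) (fun ω => cycleOut (Φ ω)) P P :=
      ⟨(measurable_cycleOut_iterate hΦm l).aemeasurable,
        (measurable_cycleOut.comp hΦm).aemeasurable,
        (map_cycleOut_iterate hΦm hΦ hH0 hV0 hVpos l).trans
          (map_cycleOut_iterate hΦm hΦ hH0 hV0 hVpos 0).symm⟩
    exact h.comp (u := fun z : (ℝ × ℝ) × ℝ => (z.1.1 + z.2, z.1.2 + z.2)) (by fun_prop)
  pos := (ae_goodInput hΦm hΦ hH0 hV0 hVpos).mono fun _ h => h.cycleLength_pos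
  age_nonneg := (ae_goodInput hΦm hΦ hH0 hV0 hVpos).mono fun _ h => h.cycleAge_nonneg
  age_le := (ae_goodInput hΦm hΦ hH0 hV0 hVpos).mono fun _ h => h.cycleAge_le
  integrable_length := (identDistrib_cycleOut hΦm hΦ (f := fun z => z.1.1 + z.2)
    (by fun_prop)).integrable_iff.2 (integrable_add_prod
      ((integrable_stringLaw lam measurable_fst).2 (integral_vacLength lam hV0 hVpos hV1).1) hH1)

lemma integral_cycleLength (hΦm : Measurable Φ) (hΦ : P.map Φ = inputLaw lam μH μV)
    (hV0 : μV (Set.Iio 0) = 0) (hVpos : μV (Set.Ioi 0) ≠ 0)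
    (hH1 : Integrable (fun x : ℝ => x) μH) (hV1 : Integrable (fun x : ℝ => x) μV) :
    ∫ ω, cycleLength (Φ ω) 0 ∂P = (∫ v, v ∂μV) / (1 - lst μV lam) + ∫ x, x ∂μH := by
  have h := integral_vacLength lam hV0 hVpos hV1
  rw [← h.2, ← integral_stringLaw lam measurable_fst, ← integral_add_prod
    ((integrable_stringLaw lam measurable_fst).2 h.1) hH1]
  exact (identDistrib_cycleOut hΦm hΦ (f := fun z => z.1.1 + z.2) (by fun_prop)).integral_eq

lemma integral_cycleAge (hΦm : Measurable Φ) (hΦ : P.map Φ = inputLaw lam μH μV)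
    (hV0 : μV (Set.Iio 0) = 0) (hVpos : μV (Set.Ioi 0) ≠ 0)
    (hH1 : Integrable (fun x : ℝ => x) μH) (hV1 : Integrable (fun x : ℝ => x) μV) :
    ∫ ω, cycleAge (Φ ω) 0 ∂P
      = 1 / lam - (∫ v, v * Real.exp (-lam * v) ∂μV) / (1 - lst μV lam) + ∫ x, x ∂μH := by
  have h := integral_vacWait lam hV0 hVpos hV1
  rw [← h.2, ← integral_stringLaw lam measurable_snd, ← integral_add_prod
    ((integrable_stringLaw lam measurable_snd).2 h.1) hH1]
  exact (identDistrib_cycleOut hΦm hΦ (f := fun z => z.1.2 + z.2) (by fun_prop)).integral_eq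

lemma memLp_vacLength (hV0 : μV (Set.Iio 0) = 0) (hVpos : μV (Set.Ioi 0) ≠ 0)
    (hV1 : Integrable (fun x : ℝ => x) μV) (hV2 : Integrable (fun x : ℝ => x ^ 2) μV) :
    MemLp (Prod.fst : ℝ × ℝ → ℝ) 2 (stringLaw lam μV) :=
  (memLp_two_iff_integrable_sq measurable_fst.aestronglyMeasurable).2
    ((integrable_stringLaw lam (measurable_fst.pow_const 2)).2
      (integral_vacLength_sq lam hV0 hVpos hV1 hV2).1)

lemma memLp_vacWait (hV0 : μV (Set.Iio 0) = 0) (hVpos : μV (Set.Ioi 0) ≠ 0)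
    (hV1 : Integrable (fun x : ℝ => x) μV) (hV2 : Integrable (fun x : ℝ => x ^ 2) μV) :
    MemLp (Prod.snd : ℝ × ℝ → ℝ) 2 (stringLaw lam μV) :=
  (memLp_two_iff_integrable_sq measurable_snd.aestronglyMeasurable).2
    ((integrable_stringLaw lam (measurable_snd.pow_const 2)).2
      (integral_vacWait_sq lam hV0 hVpos hV1 hV2).1)

lemma memLp_cycleLength (hΦm : Measurable Φ) (hΦ : P.map Φ = inputLaw lam μH μV)
    (hV0 : μV (Set.Iio 0) = 0) (hVpos : μV (Set.Ioi 0) ≠ 0)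
    (hV1 : Integrable (fun x : ℝ => x) μV)
    (hH2 : Integrable (fun x : ℝ => x ^ 2) μH) (hV2 : Integrable (fun x : ℝ => x ^ 2) μV) :
    MemLp (fun ω => cycleLength (Φ ω) 0) 2 P :=
  (identDistrib_cycleOut hΦm hΦ (f := fun z => z.1.1 + z.2) (by fun_prop)).memLp_iff.2
    (memLp_add_prod (memLp_vacLength hV0 hVpos hV1 hV2) (memLp_id_of_integrable_sq hH2))

lemma variance_cycleLength (hΦm : Measurable Φ) (hΦ : P.map Φ = inputLaw lam μH μV)
    (hV0 : μV (Set.Iio 0) = 0) (hVpos : μV (Set.Ioi 0) ≠ 0)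
    (hV1 : Integrable (fun x : ℝ => x) μV)
    (hH2 : Integrable (fun x : ℝ => x ^ 2) μH) (hV2 : Integrable (fun x : ℝ => x ^ 2) μV) :
    variance (fun ω => cycleLength (Φ ω) 0) P
      = (((∫ v, v ^ 2 ∂μV) + 2 * (∫ v, v * Real.exp (-lam * v) ∂μV)
          * ((∫ v, v ∂μV) / (1 - lst μV lam))) / (1 - lst μV lam)
          - ((∫ v, v ∂μV) / (1 - lst μV lam)) ^ 2)
        + (∫ x, x ^ 2 ∂μH - (∫ x, x ∂μH) ^ 2) := by
  have h := variance_add_prod (memLp_vacLength (lam := lam) hV0 hVpos hV1 hV2)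
    (memLp_id_of_integrable_sq hH2)
  rw [integral_stringLaw lam measurable_fst, integral_stringLaw lam (measurable_fst.pow_const 2),
    (integral_vacLength lam hV0 hVpos hV1).2, (integral_vacLength_sq lam hV0 hVpos hV1 hV2).2] at h
  rw [← h]
  exact (identDistrib_cycleOut hΦm hΦ (f := fun z => z.1.1 + z.2) (by fun_prop)).variance_eq

lemma variance_cycleAge (hΦm : Measurable Φ) (hΦ : P.map Φ = inputLaw lam μH μV)
    (hV0 : μV (Set.Iio 0) = 0) (hVpos : μV (Set.Ioi 0) ≠ 0)
    (hV1 : Integrable (fun x : ℝ => x) μV)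
    (hH2 : Integrable (fun x : ℝ => x ^ 2) μH) (hV2 : Integrable (fun x : ℝ => x ^ 2) μV) :
    variance (fun ω => cycleAge (Φ ω) 0) P
      = (2 / lam * (1 / lam - (∫ v, v * Real.exp (-lam * v) ∂μV) / (1 - lst μV lam))
          - (∫ v, v ^ 2 * Real.exp (-lam * v) ∂μV) / (1 - lst μV lam)
          - (1 / lam - (∫ v, v * Real.exp (-lam * v) ∂μV) / (1 - lst μV lam)) ^ 2)
        + (∫ x, x ^ 2 ∂μH - (∫ x, x ∂μH) ^ 2) := by
  have h := variance_add_prod (memLp_vacWait (lam := lam) hV0 hVpos hV1 hV2)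
    (memLp_id_of_integrable_sq hH2)
  rw [integral_stringLaw lam measurable_snd, integral_stringLaw lam (measurable_snd.pow_const 2),
    (integral_vacWait lam hV0 hVpos hV1).2, (integral_vacWait_sq lam hV0 hVpos hV1 hV2).2] at h
  rw [← h]
  exact (identDistrib_cycleOut hΦm hΦ (f := fun z => z.1.2 + z.2) (by fun_prop)).variance_eq

/-! ### The closed forms -/

lemma mean_peak_eq (hΦm : Measurable Φ) (hΦ : P.map Φ = inputLaw lam μH μV)
    (hH0 : μH (Set.Iio 0) = 0) (hV0 : μV (Set.Iio 0) = 0) (hVpos : μV (Set.Ioi 0) ≠ 0)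
    (hH1 : Integrable (fun x : ℝ => x) μH) (hV1 : Integrable (fun x : ℝ => x) μV) :
    ∫ ω, cycleAge (Φ ω) 0 ∂P + ∫ ω, cycleLength (Φ ω) 0 ∂P = cbsPAoI lam μH μV := by
  rw [integral_cycleAge hΦm hΦ hV0 hVpos hH1 hV1, integral_cycleLength hΦm hΦ hV0 hVpos hH1 hV1,
    cbsPAoI, lstDeriv_one hV0 hV1 le_rfl, lstDeriv_one hV0 hV1 hlam.out.le,
    lstDeriv_one hH0 hH1 le_rfl]
  simp only [neg_zero, zero_mul, Real.exp_zero, mul_one]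
  ring

lemma variance_peak_eq (hΦm : Measurable Φ) (hΦ : P.map Φ = inputLaw lam μH μV)
    (hH0 : μH (Set.Iio 0) = 0) (hV0 : μV (Set.Iio 0) = 0) (hVpos : μV (Set.Ioi 0) ≠ 0)
    (hH1 : Integrable (fun x : ℝ => x) μH) (hV1 : Integrable (fun x : ℝ => x) μV)
    (hH2 : Integrable (fun x : ℝ => x ^ 2) μH) (hV2 : Integrable (fun x : ℝ => x ^ 2) μV) :
    variance (fun ω => cycleAge (Φ ω) 0) P + variance (fun ω => cycleLength (Φ ω) 0) P
      = cbsVarPeak lam μH μV := by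
  rw [variance_cycleAge hΦm hΦ hV0 hVpos hV1 hH2 hV2,
    variance_cycleLength hΦm hΦ hV0 hVpos hV1 hH2 hV2,
    cbsVarPeak, lstDeriv_one hV0 hV1 le_rfl, lstDeriv_one hV0 hV1 hlam.out.le,
    lstDeriv_one hH0 hH1 le_rfl, lstDeriv_two hV0 hV1 hV2 le_rfl,
    lstDeriv_two hV0 hV1 hV2 hlam.out.le, lstDeriv_two hH0 hH1 hH2 le_rfl]
  simp only [neg_zero, zero_mul, Real.exp_zero, mul_one]
  ring

/-- Here v₁, v₂ and h₁, h₂ are the moments of V and H, b₁ = E[V e^{-λV}], w = 1/λ and D = 1 - V*(λ).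
In terms of d = 1/D and c = 1/(2(v₁d + h₁)) the identity is polynomial modulo the relation c(v₁d +
h₁) = 1/2. -/
lemma mean_age_algebra {v₁ h₁ D : ℝ} (v₂ b₁ h₂ w : ℝ) (hne : v₁ / D + h₁ ≠ 0) :
    ((w - b₁ / D + h₁) * (v₁ / D + h₁) + (((v₂ + 2 * b₁ * (v₁ / D)) / D - (v₁ / D) ^ 2)
        + (h₂ - h₁ ^ 2) + (v₁ / D + h₁) ^ 2) / 2) / (v₁ / D + h₁)
      = -(1 / (2 * (-h₁ + -v₁ / D))) * (h₂ + 2 * -h₁ * (-v₁ / D) + 2 * -v₁ * -b₁ / D ^ 2 + v₂ / D)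
        + w + -b₁ / D - -h₁ := by
  simp only [div_eq_mul_inv _ D, div_eq_mul_inv _ (D ^ 2), ← inv_pow] at hne ⊢
  generalize D⁻¹ = d at hne ⊢
  have e : 2 * (-h₁ + -v₁ * d) = -(2 * (v₁ * d + h₁)) := by ring
  have hc : 1 / (2 * (v₁ * d + h₁)) * (v₁ * d + h₁) = 1 / 2 := by field_simp
  rw [e, div_eq_iff hne, div_neg, neg_neg]
  generalize 1 / (2 * (v₁ * d + h₁)) = c at hc ⊢
  linear_combination
    (-(h₂ + 2 * -h₁ * (-v₁ * d) + 2 * -v₁ * -b₁ * d ^ 2 + v₂ * d)) * hc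

lemma mean_age_eq [IsProbabilityMeasure P] (hΦm : Measurable Φ)
    (hΦ : P.map Φ = inputLaw lam μH μV)
    (hH0 : μH (Set.Iio 0) = 0) (hV0 : μV (Set.Iio 0) = 0) (hVpos : μV (Set.Ioi 0) ≠ 0)
    (hH1 : Integrable (fun x : ℝ => x) μH) (hV1 : Integrable (fun x : ℝ => x) μV)
    (hH2 : Integrable (fun x : ℝ => x ^ 2) μH) (hV2 : Integrable (fun x : ℝ => x ^ 2) μV) :
    IsRenewalCycle.meanReward P (fun l ω => cycleLength (Φ ω) l) (fun l ω => cycleAge (Φ ω) l)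
      / ∫ ω, cycleLength (Φ ω) 0 ∂P = cbsAoI lam μH μV := by
  have hpos := (isRenewalCycle hΦm hΦ hH0 hV0 hVpos hH1 hV1).integral_length_pos
  have hm := integral_cycleLength hΦm hΦ hV0 hVpos hH1 hV1
  have hvar := variance_cycleLength hΦm hΦ hV0 hVpos hV1 hH2 hV2
  rw [variance_eq_sub (memLp_cycleLength hΦm hΦ hV0 hVpos hV1 hH2 hV2)] at hvar
  simp only [Pi.pow_apply] at hvar
  -- E[Y²] is recovered as variance plus squared mean.
  have hsq := eq_add_of_sub_eq hvar
  rw [IsRenewalCycle.meanReward, hsq, integral_cycleAge hΦm hΦ hV0 hVpos hH1 hV1]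
  rw [hm] at hpos ⊢
  rw [cbsAoI, lstDeriv_one hV0 hV1 le_rfl, lstDeriv_one hV0 hV1 hlam.out.le,
    lstDeriv_one hH0 hH1 le_rfl, lstDeriv_two hV0 hV1 hV2 le_rfl,
    lstDeriv_two hH0 hH1 hH2 le_rfl]
  simp only [neg_zero, zero_mul, Real.exp_zero, mul_one]
  exact mean_age_algebra _ _ _ _ hpos.ne'

end RandomInput

end ConventionalBuffer

end

/-! ### Assembly of the theorem -/

open ConventionalBuffer

theorem mainTheorem1
    {Ω : Type*} [MeasurableSpace Ω] (P : Measure Ω) [IsProbabilityMeasure P]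
    (lam : ℝ) (hlam : 0 < lam)
    -- the laws of a processing time and of a vacation time: nonnegative, finite mean, `V` not a.s. 0
    (μH μV : Measure ℝ) [IsProbabilityMeasure μH] [IsProbabilityMeasure μV]
    (hH0 : μH (Set.Iio 0) = 0) (hV0 : μV (Set.Iio 0) = 0) (hVpos : μV (Set.Ioi 0) ≠ 0)
    (hH1 : Integrable (fun x : ℝ => x) μH) (hV1 : Integrable (fun x : ℝ => x) μV)
    -- Poisson generation with rate `lam`, i.i.d. processing times, i.i.d. vacations, all independent
    (T H V : ℕ → Ω → ℝ)
    (hTm : ∀ n, Measurable (T n)) (hHm : ∀ n, Measurable (H n)) (hVm : ∀ n, Measurable (V n))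
    (hT : ∀ n, HasLaw (T n) (expMeasure lam) P)
    (hH : ∀ n, HasLaw (H n) μH P)
    (hV : ∀ n, HasLaw (V n) μV P)
    (hindep : iIndepFun (fun i : ℕ ⊕ ℕ ⊕ ℕ => Sum.elim T (Sum.elim H V) i) P)
    -- the age at time `0`
    (a : ℝ) (ha : 0 ≤ a) :
    -- PAoI: limit of the expected peaks, and almost sure average of the peaks
    ((∀ l, Integrable (fun ω => (cbsPath T H V ω).peakAge a l) P) ∧
      Tendsto (fun l : ℕ => ∫ ω, (cbsPath T H V ω).peakAge a l ∂P) atTop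
        (𝓝 (cbsPAoI lam μH μV)) ∧
      (∀ᵐ ω ∂P, Tendsto
        (fun k : ℕ => (1 / (k : ℝ)) * ∑ l ∈ Finset.range k, (cbsPath T H V ω).peakAge a l) atTop
        (𝓝 (cbsPAoI lam μH μV)))) ∧
    -- the limit distribution `ν` of the peaks, its mean and its variance
    (∃ ν : Measure ℝ, ∃ _ : IsProbabilityMeasure ν,
      TendstoInDistribution (fun (l : ℕ) ω => (cbsPath T H V ω).peakAge a l) atTop
        (fun x : ℝ => x) (fun _ => P) ν ∧
      Integrable (fun x : ℝ => x) ν ∧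
      ∫ x, x ∂ν = cbsPAoI lam μH μV ∧
      (Integrable (fun x : ℝ => x ^ 2) μH → Integrable (fun x : ℝ => x ^ 2) μV →
        MemLp (fun x : ℝ => x) 2 ν ∧
        variance (fun x : ℝ => x) ν = cbsVarPeak lam μH μV)) ∧
    -- the remaining claims, about quantities that involve second moments
    (Integrable (fun x : ℝ => x ^ 2) μH → Integrable (fun x : ℝ => x ^ 2) μV →
      -- variance of peak age: limit of the variances of the peaks
      ((∀ l, MemLp (fun ω => (cbsPath T H V ω).peakAge a l) 2 P) ∧
        Tendsto (fun l : ℕ => variance (fun ω => (cbsPath T H V ω).peakAge a l) P) atTop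
          (𝓝 (cbsVarPeak lam μH μV))) ∧
      -- AoI: almost sure time average of the age
      (∀ᵐ ω ∂P,
        (∀ t : ℝ, IntervalIntegrable ((cbsPath T H V ω).age a) volume 0 t) ∧
        Tendsto (fun t : ℝ => (1 / t) * ∫ u in (0 : ℝ)..t, (cbsPath T H V ω).age a u) atTop
          (𝓝 (cbsAoI lam μH μV))) ∧
      -- AoI: time average of the expected age, and its limit whenever this limit exists
      ((∀ t : ℝ, 0 ≤ t → Integrable (fun ω => (cbsPath T H V ω).age a t) P) ∧
        Tendsto (fun t : ℝ => (1 / t) * ∫ u in (0 : ℝ)..t, ∫ ω, (cbsPath T H V ω).age a u ∂P) atTop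
          (𝓝 (cbsAoI lam μH μV)) ∧
        ∀ L : ℝ, Tendsto (fun t : ℝ => ∫ ω, (cbsPath T H V ω).age a t ∂P) atTop (𝓝 L) →
          L = cbsAoI lam μH μV)) := by
  have : Fact (0 < lam) := ⟨hlam⟩
  set Φ : Ω → InputSpace := inputOf T H V with hΦdef
  have hΦm : Measurable Φ := measurable_inputOf hTm hHm hVm
  have hΦ : P.map Φ = inputLaw lam μH μV :=
    map_inputOf lam hTm hHm hVm hT hH hV hindep
  have hcyc := isRenewalCycle hΦm hΦ hH0 hV0 hVpos hH1 hV1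
  have hgood := ae_goodInput hΦm hΦ hH0 hV0 hVpos
  -- Almost every input is good, and there the age and its peaks are those of the i.i.d. cycles; all
  -- claims are transferred along these identities.
  have hage : ∀ᵐ ω ∂P, ∀ t, (cbsPath T H V ω).age a t = cyclicAge
      (fun i => cycleLength (Φ ω) i)
      (fun i => cycleAge (Φ ω) i) a t := by
    filter_upwards [hgood] with ω h t
    exact congrFun (h.age_eq a) t
  have hpeak : ∀ᵐ ω ∂P, ∀ l, (cbsPath T H V ω).peakAge a l = initialAge
      (fun i => cycleAge (Φ ω) i) a l
        + cycleLength (Φ ω) l := by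
    filter_upwards [hgood] with ω h l
    exact (h.peakAge_eq a l).trans
      (peak_eq h.cycleLength_pos h.cycleAge_nonneg h.cycleAge_le ha l)
  have hpeak' : ∀ l, (fun ω => (cbsPath T H V ω).peakAge a l) =ᵐ[P] fun ω =>
      initialAge (fun i => cycleAge (Φ ω) i) a l
        + cycleLength (Φ ω) l := fun l => hpeak.mono fun ω h => h l
  have hage' : ∀ t, (fun ω => (cbsPath T H V ω).age a t) =ᵐ[P] fun ω =>
      cyclicAge (fun i => cycleLength (Φ ω) i)
        (fun i => cycleAge (Φ ω) i) a t := fun t => hage.mono fun ω h => h t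
  have hmean := mean_peak_eq hΦm hΦ hH0 hV0 hVpos hH1 hV1
  refine ⟨⟨fun l => (hcyc.integrable_peak a l).congr (hpeak' l).symm, ?_, ?_⟩, ?_, ?_⟩
  · rw [← hmean]
    exact (hcyc.tendsto_integral_peak a).congr fun l => (integral_congr_ae (hpeak' l)).symm
  · rw [← hmean]
    filter_upwards [hcyc.ae_tendsto_peak a, hpeak] with ω h1 h2
    simpa only [h2] using h1
  · have hm : AEMeasurable (fun ω => cycleAge (Φ ω) 0
        + cycleLength (Φ ω) 1) P :=
      ((hcyc.measurable_age 0).add (hcyc.measurable_length 1)).aemeasurable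
    have hν := Measure.isProbabilityMeasure_map hm
    -- The limit law is that of the age left by cycle 0 plus the length of cycle 1.
    refine ⟨_, hν, (hcyc.tendstoInDistribution_peak a rfl).congr
      (fun l => (hpeak' l).symm) EventuallyEq.rfl, ?_, ?_, fun hH2 hV2 => ?_⟩
    · exact (integrable_map_measure (by fun_prop) hm).2
        ((hcyc.integrable_age 0).add (hcyc.integrable_length' 1))
    · rw [integral_map hm (by fun_prop), ← hmean]
      exact hcyc.integral_peak
    · have h2 := memLp_cycleLength hΦm hΦ hV0 hVpos hV1 hH2 hV2
      have hid : IdentDistrib (fun ω => cycleAge (Φ ω) 0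
          + cycleLength (Φ ω) 1) (fun x : ℝ => x) P
          (P.map fun ω => cycleAge (Φ ω) 0
            + cycleLength (Φ ω) 1) :=
        ⟨hm, aemeasurable_id, Measure.map_id.symm⟩
      refine ⟨hid.memLp_iff.1 (hcyc.memLp_peak h2 a 1), ?_⟩
      rw [← hid.variance_eq,
        ← variance_peak_eq hΦm hΦ hH0 hV0 hVpos hH1 hV1 hH2 hV2]
      exact hcyc.variance_peak h2
  · intro hH2 hV2
    have h2 := memLp_cycleLength hΦm hΦ hV0 hVpos hV1 hH2 hV2
    have hvar := variance_peak_eq hΦm hΦ hH0 hV0 hVpos hH1 hV1 hH2 hV2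
    have hmeanage := mean_age_eq hΦm hΦ hH0 hV0 hVpos hH1 hV1 hH2 hV2
    have hE : ∀ t, ∫ ω, (cbsPath T H V ω).age a t ∂P = ∫ ω, cyclicAge
        (fun i => cycleLength (Φ ω) i)
        (fun i => cycleAge (Φ ω) i) a t ∂P :=
      fun t => integral_congr_ae (hage' t)
    have hlim : Tendsto (fun t : ℝ => (1 / t) *
        ∫ u in (0 : ℝ)..t, ∫ ω, (cbsPath T H V ω).age a u ∂P) atTop (𝓝 (cbsAoI lam μH μV)) := by
      rw [← hmeanage]
      refine (hcyc.tendsto_integral_average_age h2 ha).congr' ?_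
      filter_upwards [eventually_ge_atTop 0] with t ht
      simp only [hE]
      rw [hcyc.integral_totalAge ha ht]
    refine ⟨⟨fun l => (memLp_congr_ae (hpeak' l)).2 (hcyc.memLp_peak h2 a l), ?_⟩, ?_,
      fun t ht => (hcyc.integrable_cyclicAge ha ht).congr (hage' t).symm, hlim, fun L hL => ?_⟩
    · rw [← hvar]
      exact (hcyc.tendsto_variance_peak h2 a).congr fun l => (variance_congr (hpeak' l)).symm
    · rw [← hmeanage]
      filter_upwards [hage, hcyc.ae_tendsto_average_age h2 ha, hcyc.ae_goodGaps, hgood]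
        with ω h3 h4 h5 h6
      have h7 := funext h3
      rw [h7]
      exact ⟨intervalIntegrable_cyclicAge h5 h6.cycleAge_nonneg h6.cycleAge_le ha,
        h4⟩
    -- A convergent function has its limit as time average, and that average is already known.
    · refine tendsto_nhds_unique (tendsto_interval_average
        (fun t ht => ?_) hL) hlim
      simp only [hE]
      exact hcyc.intervalIntegrable_integral_cyclicAge ha ht
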